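/- Let $\Lambda$ be a lattice of rank $n$ with a symmetric bilinear form $B$ on $\Lambda\otimes\mathbb{R}$ such that $Q(x)=B(x,x)$ has signature $(2,n-2)$ and is integer valued on $\Lambda$. Let $\Lambda^*$ be the dual lattice and let $p\in\Lambda$ be characteristic: $Q(k)+B(k,p)\in 2\mathbb{Z}$ for all $k\in\Lambda$. Put $\mathbf e(z)=e^{2\pi i z}$. For $\Phi:\Lambda\otimes\mathbb{R}\to\mathbb{C}$, $\lambda\in\mathbb{Z}$, $\mu\in\Lambda^*/\Lambda$, $\tau=\tau_1+i\tau_2$ with $\tau_2>0$, and $b,c\in\Lambda\otimes\mathbb{R}$, let $$\vartheta_\mu[\Phi,\lambda](\tau,b,c)=\tau_2^{-\lambda/2}\sum_{k\in\Lambda+\mu+\frac12p}(-1)^{B(k,p)}\,\Phi(\sqrt{2\tau_2}(k+b))\,\mathbf e(-\tfrac{\tau}{2}Q(k+b))\,\mathbf e(B(c,k+\tfrac12b)),\qquad (-1)^{B(k,p)}:=e^{\pi iB(k,p)}.$$ *Error functions.* Let $E_1(u)=\mathrm{Erf}(u\sqrt\pi)$, $M_1(u)=-\mathrm{sign}(u)\,\mathrm{Erfc}(|u|\sqrt\pi)$,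 with $\mathrm{sign}(0)=0$. For $\alpha\in\mathbb{R}$ and $u_1\ne0$, $u_2\neq\alpha u_1$ let $$M_2(\alpha;u_1,u_2)=-\frac1{\pi^2}\int_{\mathbb{R}-iu_1}dz_1\int_{\mathbb{R}-iu_2}dz_2\,\frac{e^{-\pi z_1^2-\pi z_2^2-2\pi i(u_1z_1+u_2z_2)}}{z_1(z_2-\alpha z_1)},$$ $$E_2(\alpha;u_1,u_2)=M_2(\alpha;u_1,u_2)+\mathrm{sign}(u_1)M_1(u_2)+\mathrm{sign}(u_2-\alpha u_1)M_1\Big(\tfrac{u_1+\alpha u_2}{\sqrt{1+\alpha^2}}\Big)+\mathrm{sign}(u_2)\,\mathrm{sign}(u_1+\alpha u_2),$$ and extend $E_2(\alpha;\cdot,\cdot)$ to $\mathbb{R}^2$ by continuity. For vectors put $C_{i\perp j}=C_i-\frac{B(C_i,C_j)}{Q(C_j)}C_j$, $\Delta(C_i,C_j)=Q(C_i)Q(C_j)-B(C_i,C_j)^2$, $E_1(C;x)=E_1\big(B(C,x)/\sqrt{Q(C)}\big)$ and $$E_2(C_i,C_j;x)=E_2\Big(\tfrac{B(C_i,C_j)}{\sqrt{\Delta(C_i,C_j)}};\tfrac{B(C_{i\perp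 j},x)}{\sqrt{Q(C_{i\perp j})}},\tfrac{B(C_j,x)}{\sqrt{Q(C_j)}}\Big).$$ *Hypotheses.* Let $C_1,C_1',C_2,C_2'\in\Lambda\otimes\mathbb{R}$ and write $C_{j'}=C_j'$. For $I\subseteq\{1,1',2,2'\}$ let $\Delta_I$ be the determinant of the Gram matrix $(B(C_i,C_j))_{i,j\in I}$, and let $D_{ij}$ be the (signed) cofactors of the full $4\times4$ Gram matrix. Assume 1. $Q(C_1),Q(C_1'),Q(C_2),Q(C_2')>0$; $\Delta_{11'22'}>0$; $D_{11'},D_{22'}\ge0$; and $$\begin{pmatrix}\Delta_{1'22'}&0&D_{12}&D_{12'}\\0&\Delta_{122'}&D_{1'2}&D_{1'2'}\\D_{12}&D_{1'2}&\Delta_{11'2'}&0\\D_{12'}&D_{1'2'}&0&\Delta_{11'2}\end{pmatrix}\text{ is negative definite};$$ 2. $\Delta_{12},\Delta_{1'2},\Delta_{12'},\Delta_{1'2'}>0$; 3. $B(C_{2\perp1},C_{2'\perp1})$, $B(C_{1\perp2},C_{1'\perp2})$, $B(C_{2\perp1'},C_{2'\perp1'})$, $B(C_{1\perp2'},C_{1'\perp2'})\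 \ge 0$. Let $$\widehat\Phi_2(x)=\tfrac14\big[E_2(C_1,C_2;x)-E_2(C_1,C_2';x)-E_2(C_1',C_2;x)+E_2(C_1',C_2';x)\big].$$ **Theorem.** The kernel $\widehat\Phi_2$ is $C^\infty$ and the series $\vartheta_\mu[\widehat\Phi_2,0](\tau,b,c)$ converges absolutely for all $\mu,\tau,b,c$. The family $\vartheta_\mu=\vartheta_\mu[\widehat\Phi_2,0]$, $\mu\in\Lambda^*/\Lambda$ (a finite group), is a non-holomorphic vector-valued Jacobi form of weight $(\frac n2,0)$. That is, for $k\in\Lambda$, $$\vartheta_\mu(\tau,b+k,c)=(-1)^{B(k,p)}\mathbf e(-\tfrac12B(c,k))\,\vartheta_\mu(\tau,b,c),\qquad \vartheta_\mu(\tau,b,c+k)=(-1)^{B(k,p)}\mathbf e(\tfrac12B(b,k))\,\vartheta_\mu(\tau,b,c),$$ $$\vartheta_\mu(-1/\tau,c,-b)=-\frac{(-i\tau)^{n/2}}{\sqrt{|\Lambda^*/\Lambda|}}\,\mathbf e(\tfrac14Q(p))\sum_{\nu\in\Lambda^*/\Lambda}\mathbf e(B(\mu,\nu))\,\vartheta_\nu(\tau,b,c),$$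 $$\vartheta_\mu(\tau+1,b,c+b)=\mathbf e(-\tfrac12Q(\mu+\tfrac12p))\,\vartheta_\mu(\tau,b,c),$$ and for every $\mu$ there are $b,c$ for which $\tau\mapsto\vartheta_\mu(\tau,b,c)$ is not holomorphic on the upper half plane. Its shadow is the theta series $\vartheta_\mu[\Psi_2,-2]$, that is, the latter converges absolutely for all $\mu,\tau,b,c$, the function $\tau\mapsto\vartheta_\mu[\widehat\Phi_2,0](\tau,b,c)$ is real-differentiable, and $$\tau_2^2\,\partial_{\bar\tau}\,\vartheta_\mu[\widehat\Phi_2,0](\tau,b,c)=\vartheta_\mu[\Psi_2,-2](\tau,b,c)\qquad(b,c\text{ fixed}),$$ where, with $g_C(x)=\frac{B(C,x)}{\sqrt{Q(C)}}\,e^{-\pi B(C,x)^2/Q(C)}$, $$\begin{aligned}\Psi_2(x)=\tfrac i8\Big\{&g_{C_1}(x)\big[E_1(C_{2\perp1};x)-E_1(C_{2'\perp1};x)\big]+g_{C_2}(x)\big[E_1(C_{1\perp2};x)-E_1(C_{1'\perp2};x)\big]\\&+g_{C_1'}(x)\big[E_1(C_{2'\perp1'};x)-E_1(C_{2\perp1'};x)\big]+g_{C_2'}(x)\big[E_1(C_{1'\perp2'};x)-E_1(C_{1\perp2'};x)\big]\Big\}.\end{aligned}$$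 -/

import Mathlib

open scoped ContDiff

noncomputable section

namespace IndefTheta

/-! ### Error functions -/

/-- The error function `Erf`. -/
def erf (x : ℝ) : ℝ := 2 / √Real.pi * ∫ t in (0 : ℝ)..x, Real.exp (-t ^ 2)

/-- The complementary error function `Erfc = 1 - Erf`. -/
def erfc (x : ℝ) : ℝ := 1 - erf x

/-- `E₁(u) = Erf(u √π)`. -/
def E1 (u : ℝ) : ℝ := erf (u * √Real.pi)

/-- `M₁(u) = -sign(u) Erfc(|u| √π)`. -/
def M1 (u : ℝ) : ℝ := -Real.sign u * erfc (|u| * √Real.pi)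

/-- The integrand of the complementary double error function, as a function of complex
`z₁, z₂`. -/
def M2Integrand (α u₁ u₂ : ℝ) (z₁ z₂ : ℂ) : ℂ :=
  Complex.exp (-Real.pi * z₁ ^ 2 - Real.pi * z₂ ^ 2
      - 2 * Real.pi * Complex.I * (u₁ * z₁ + u₂ * z₂)) / (z₁ * (z₂ - α * z₁))

/-- The complementary double error function `M₂(α; u₁, u₂)`, an integral over
`z₁ ∈ ℝ - i u₁`, `z₂ ∈ ℝ - i u₂`; meant for `u₁ ≠ 0`, `u₂ ≠ α u₁`. -/
def M2 (α u₁ u₂ : ℝ) : ℂ :=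
  -(1 / (Real.pi : ℂ) ^ 2) * ∫ x₁ : ℝ, ∫ x₂ : ℝ,
    M2Integrand α u₁ u₂ (x₁ - Complex.I * u₁) (x₂ - Complex.I * u₂)

/-- The complement of the two lines `u₁ = 0` and `u₂ = α u₁`, where `M₂` is defined. -/
def regularSet (α : ℝ) : Set (ℝ × ℝ) := {u | u.1 ≠ 0 ∧ u.2 ≠ α * u.1}

/-- The formula that defines the double error function on `regularSet α`. -/
def E2Regular (α : ℝ) (u : ℝ × ℝ) : ℂ :=
  M2 α u.1 u.2 + (Real.sign u.1 * M1 u.2 : ℝ)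
    + (Real.sign (u.2 - α * u.1) * M1 ((u.1 + α * u.2) / √(1 + α ^ 2)) : ℝ)
    + (Real.sign u.2 * Real.sign (u.1 + α * u.2) : ℝ)

/-- The double error function `E₂(α; u₁, u₂)` on all of `ℝ²`: the extension by continuity of
`E2Regular` from the dense set `regularSet α`. -/
def E2 (α : ℝ) (u₁ u₂ : ℝ) : ℂ := extendFrom (regularSet α) (E2Regular α) (u₁, u₂)

/-! ### Boosted error functions, Gram determinants, the conditions on the vectors -/

section Kernels

variable {V : Type*} [AddCommGroup V] [Module ℝ V] (B : LinearMap.BilinForm ℝ V)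

/-- `perp B C D` is `C_{C ⊥ D}`, the component of `C` that is `B`-orthogonal to `D`. -/
def perp (C D : V) : V := C - (B C D / B D D) • D

/-- The determinant `Δ` of the Gram matrix of a finite family of vectors. -/
def gramDet {m : ℕ} (v : Fin m → V) : ℝ :=
  (Matrix.of fun i j => B (v i) (v j)).det

/-- The normalized linear form `B(C, x) / √Q(C)`. -/
def unitForm (C x : V) : ℝ := B C x / √(B C C)

/-- `E₁(C; x)`. -/
def E1Boost (C x : V) : ℝ := E1 (unitForm B C x)

/-- `E₂(C₁, C₂; x)`. -/
def E2Boost (C₁ C₂ x : V) : ℂ :=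
  E2 (B C₁ C₂ / √(gramDet B ![C₁, C₂])) (unitForm B (perp B C₁ C₂) x) (unitForm B C₂ x)

/-- The cofactors of the Gram matrix of `C₁, C₁', C₂, C₂'` (in this order). -/
def gramCofactor (C₁ C₁' C₂ C₂' : V) (i j : Fin 4) : ℝ :=
  (Matrix.of fun i j => B (![C₁, C₁', C₂, C₂'] i) (![C₁, C₁', C₂, C₂'] j)).adjugate i j

/-- The symmetric matrix `M`. -/
def matM (C₁ C₁' C₂ C₂' : V) : Matrix (Fin 4) (Fin 4) ℝ :=
  let D := gramCofactor B C₁ C₁' C₂ C₂'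
  !![gramDet B ![C₁', C₂, C₂'], 0, D 0 2, D 0 3;
     0, gramDet B ![C₁, C₂, C₂'], D 1 2, D 1 3;
     D 0 2, D 1 2, gramDet B ![C₁, C₁', C₂'], 0;
     D 0 3, D 1 3, 0, gramDet B ![C₁, C₁', C₂]]

/-- The conditions under which the holomorphic theta series converges. -/
structure ConvergenceConditions (C₁ C₁' C₂ C₂' : V) : Prop where
  timelike : 0 < B C₁ C₁ ∧ 0 < B C₁' C₁' ∧ 0 < B C₂ C₂ ∧ 0 < B C₂' C₂'
  gram_pos : 0 < gramDet B ![C₁, C₁', C₂, C₂']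
  cofactor_nonneg : 0 ≤ gramCofactor B C₁ C₁' C₂ C₂' 0 1 ∧ 0 ≤ gramCofactor B C₁ C₁' C₂ C₂' 2 3
  matM_negDef : (-matM B C₁ C₁' C₂ C₂').PosDef

/-- The additional conditions for the modular completion. -/
structure CompletionConditions (C₁ C₁' C₂ C₂' : V) : Prop where
  gram_pos : 0 < gramDet B ![C₁, C₂] ∧ 0 < gramDet B ![C₁', C₂] ∧
    0 < gramDet B ![C₁, C₂'] ∧ 0 < gramDet B ![C₁', C₂']
  perp_1 : 0 ≤ B (perp B C₂ C₁) (perp B C₂' C₁)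
  perp_2 : 0 ≤ B (perp B C₁ C₂) (perp B C₁' C₂)
  perp_1' : 0 ≤ B (perp B C₂ C₁') (perp B C₂' C₁')
  perp_2' : 0 ≤ B (perp B C₁ C₂') (perp B C₁' C₂')

/-- The completed kernel `Φ̂₂`. -/
def hatPhi2 (C₁ C₁' C₂ C₂' x : V) : ℂ :=
  1 / 4 * (E2Boost B C₁ C₂ x - E2Boost B C₁ C₂' x - E2Boost B C₁' C₂ x + E2Boost B C₁' C₂' x)

/-- The factor `B(C,x)/√Q(C) · exp(-π B(C,x)²/Q(C))`. -/
def gaussFactor (C x : V) : ℝ :=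
  B C x / √(B C C) * Real.exp (-(Real.pi * B C x ^ 2 / B C C))

/-- The kernel `Ψ₂` of the shadow. -/
def Psi2 (C₁ C₁' C₂ C₂' x : V) : ℂ :=
  Complex.I / 8 *
    ((gaussFactor B C₁ x * (E1Boost B (perp B C₂ C₁) x - E1Boost B (perp B C₂' C₁) x)
      + gaussFactor B C₂ x * (E1Boost B (perp B C₁ C₂) x - E1Boost B (perp B C₁' C₂) x)
      + gaussFactor B C₁' x * (E1Boost B (perp B C₂' C₁') x - E1Boost B (perp B C₂ C₁') x)
      + gaussFactor B C₂' x *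
          (E1Boost B (perp B C₁' C₂') x - E1Boost B (perp B C₁ C₂') x) : ℝ) : ℂ)

end Kernels

/-! ### Theta series -/

/-- `e(z) = exp(2 π i z)`. -/
def e (z : ℂ) : ℂ := Complex.exp (2 * Real.pi * Complex.I * z)

section Theta

variable {V : Type*} [AddCommGroup V] [Module ℝ V] (B : LinearMap.BilinForm ℝ V)
  (Λ : Submodule ℤ V)

/-- The discriminant group `Λ*/Λ`, where `Λ*` is the dual lattice. -/
abbrev DiscGroup : Type _ := ↥(B.dualSubmodule Λ) ⧸ Λ.submoduleOf (B.dualSubmodule Λ)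

/-- The class in `Λ*/Λ` of a vector of `Λ*`. -/
def discMk (m : B.dualSubmodule Λ) : DiscGroup B Λ := Submodule.Quotient.mk m

/-- The set `Λ + μ + p/2` of summation. -/
def shiftedCoset (p : V) (μ : DiscGroup B Λ) : Set V :=
  {k | ∃ m : B.dualSubmodule Λ, discMk B Λ m = μ ∧ k = (m : V) + (2⁻¹ : ℝ) • p}

/-- One term of the theta series; `(-1)^{B(k,p)}` is `exp(π i B(k,p))`. -/
def thetaTerm (p : V) (Φ : V → ℂ) (τ : ℂ) (b c k : V) : ℂ :=
  e ((B k p : ℂ) / 2) * Φ (√(2 * τ.im) • (k + b)) * e (-τ * (B (k + b) (k + b) : ℂ) / 2)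
    * e (B c (k + (2⁻¹ : ℝ) • b) : ℂ)

/-- The theta series `ϑ_μ[Φ, wt](τ, b, c)` (for `τ` in the upper half plane). -/
def theta (p : V) (Φ : V → ℂ) (wt : ℤ) (μ : DiscGroup B Λ) (τ : ℂ) (b c : V) : ℂ :=
  ((τ.im ^ (-(wt : ℝ) / 2) : ℝ) : ℂ) *
    ∑' k : shiftedCoset B Λ p μ, thetaTerm B p Φ τ b c k

/-- Absolute convergence of the theta series for all parameters. -/
def ThetaConverges (p : V) (Φ : V → ℂ) : Prop :=
  ∀ (μ : DiscGroup B Λ) (τ : ℂ) (b c : V), 0 < τ.im →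
    Summable fun k : shiftedCoset B Λ p μ => ‖thetaTerm B p Φ τ b c k‖

/-- The elliptic and modular transformation laws of a (not necessarily holomorphic)
vector-valued Jacobi form of weight `(w, 0)` for the Weil representation of the lattice, in the
real variables `b, c`; `ε` is the constant phase in the law under `τ ↦ -1/τ`. -/
structure IsVectorValuedJacobiForm (p : V) (ε w : ℂ)
    (θ : DiscGroup B Λ → ℂ → V → V → ℂ) : Prop where
  finite_disc : Finite (DiscGroup B Λ)
  elliptic_b : ∀ μ τ b c, 0 < τ.im → ∀ k ∈ Λ,
    θ μ τ (b + k) c = e ((B k p : ℂ) / 2) * e (-(B c k : ℂ) / 2) * θ μ τ b c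
  elliptic_c : ∀ μ τ b c, 0 < τ.im → ∀ k ∈ Λ,
    θ μ τ b (c + k) = e ((B k p : ℂ) / 2) * e ((B b k : ℂ) / 2) * θ μ τ b c
  modular_S : ∀ (m : B.dualSubmodule Λ) τ b c, 0 < τ.im →
    θ (discMk B Λ m) (-1 / τ) c (-b) =
      ε * ((-Complex.I * τ) ^ w / (√(Nat.card (DiscGroup B Λ) : ℝ) : ℂ)) * e ((B p p : ℂ) / 4) *
        ∑ᶠ ν : DiscGroup B Λ, e (B m (Quotient.out ν : B.dualSubmodule Λ) : ℂ) * θ ν τ b c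
  modular_T : ∀ (m : B.dualSubmodule Λ) τ b c, 0 < τ.im →
    θ (discMk B Λ m) (τ + 1) b (c + b) =
      e (-(B (m + (2⁻¹ : ℝ) • p) (m + (2⁻¹ : ℝ) • p) : ℂ) / 2) * θ (discMk B Λ m) τ b c

end Theta

/-- The Wirtinger derivative `∂f/∂τ̄` of a real-differentiable function. -/
def dbar (f : ℂ → ℂ) (τ : ℂ) : ℂ :=
  1 / 2 * (fderiv ℝ f τ 1 + Complex.I * fderiv ℝ f τ Complex.I)

/-- `g` is the shadow of `f`: on the upper half plane `f` is real-differentiable and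
`τ₂² ∂f/∂τ̄ = g`. -/
def IsShadow (f g : ℂ → ℂ) : Prop :=
  ∀ τ : ℂ, 0 < τ.im → DifferentiableAt ℝ f τ ∧ (τ.im : ℂ) ^ 2 * dbar f τ = g τ

end IndefTheta

end

open IndefTheta

noncomputable section

namespace IndefTheta

open MeasureTheory Filter Topology Set

/-! ### The Gaussian `exp (-π x²)` and the error function -/

/-! Poisson summation gives a theta series a transformation law under inversion when its kernel,
multiplied by the exponential of `Q`, is reproduced by the Fourier transform. A Gaussian on a
positive plane times a suitable quadratic polynomial has this property. The completed kernel is not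
of that shape, but it is a superposition of such functions over a square of positive planes, and
nearly everything follows from this.

The superposition. Writing each pole of the contour integral as a Laplace integral identifies `E2`
with the Gaussian average `dblErf` of `sign(y) E1(u₁ + α y)` (`E2_eq`), whose partial derivatives
are explicit products of `gauss` and `E1`. When `C₁` moves along a segment, the derivative of the
boosted function still contains an error function. When `C₂` moves as well, that error function is
differentiated away and `mixedKernel` remains: a Gaussian on the plane of `C₁, C₂` times a quadratic
polynomial in directions orthogonal to it. The alternating sum over the four corners is therefore
the integral of `mixedKernel` over the unit square (`PosSquare.phiReal_eq`).

Positivity and decay. All planes of the square must be positive. A degenerate one would contain a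
nonzero isotropic vector orthogonal to a point of each of the segments `[C₁, C₁']` and `[C₂, C₂']`,
while the condition on the cofactors makes `Q` negative on such vectors
(`ConvergenceConditions.neg`, `ConvergenceConditions.posPair`). The complement of a positive plane
is negative definite by the signature, so twice the square of the projection to the plane minus `Q`
is positive definite, uniformly over the compact square. This gives Gaussian decay of the kernel
against `exp(πQ/2)`, hence absolute convergence.

Inversion. For a fixed plane, in a basis adapted to it, the Fourier transform at `-1/τ` is a product
of one-dimensional Gaussian integrals, and the polynomial is handled by integration by parts
(`fourierB_kernelAt`). Integrating over the square gives the same law for the completed kernel, and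
Poisson summation for `Λ` and its dual (`tsum_lattice_eq_tsum_dual`) turns it into the law for the
series. The elliptic laws and the translation law come from reindexing and integrality alone.

Shadow. Apart from a holomorphic exponential, a term depends on `τ` only through the scaling `√(2 Im
τ)`, so its antiholomorphic derivative is governed by the Euler derivative of the kernel, which is
`psiReal` (`hasDerivAt_phiReal_radial`). Its four pieces decay by the mean value inequality along
the edges of the square, and the series may be differentiated term by term.

Failure of holomorphy. If the series were holomorphic for all `b, c`, the shadow would vanish
identically, and uniqueness of Fourier coefficients in `c` would give `psiReal = 0`. Then the
completed kernel would be constant along rays, although its limits along rays are `0` in some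
directions and `1` in others. -/

/-- The normalized Gaussian `exp (-π x²)`. -/
def gauss (x : ℝ) : ℝ := Real.exp (-(Real.pi * x ^ 2))

lemma gauss_pos (x : ℝ) : 0 < gauss x := Real.exp_pos _

lemma gauss_neg (x : ℝ) : gauss (-x) = gauss x := by simp [gauss]

lemma gauss_le_one (x : ℝ) : gauss x ≤ 1 := by
  rw [gauss, Real.exp_le_one_iff]
  have := Real.pi_pos
  have : 0 ≤ Real.pi * x ^ 2 := by positivity
  linarith

lemma contDiff_gauss {n : WithTop ℕ∞} : ContDiff ℝ n gauss := by
  unfold gauss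
  fun_prop

@[fun_prop]
lemma continuous_gauss : Continuous gauss := contDiff_gauss (n := 0).continuous

lemma hasDerivAt_gauss (x : ℝ) : HasDerivAt gauss (-(2 * Real.pi * x) * gauss x) x := by
  have h : HasDerivAt (fun x : ℝ => -(Real.pi * x ^ 2)) (-(2 * Real.pi * x)) x :=
    (((hasDerivAt_pow 2 x).const_mul Real.pi).fun_neg).congr_deriv (by simp; ring)
  exact h.exp.congr_deriv (by rw [gauss]; ring)

lemma integrable_gauss : Integrable gauss := by
  have := integrable_exp_neg_mul_sq Real.pi_pos
  unfold gauss
  simpa only [neg_mul] using this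

lemma integral_gauss : ∫ x, gauss x = 1 := by
  have := integral_gaussian Real.pi
  simp only [neg_mul] at this
  unfold gauss
  rw [this, div_self Real.pi_ne_zero, Real.sqrt_one]

lemma integrable_mul_gauss : Integrable fun x : ℝ => x * gauss x := by
  have := integrable_mul_exp_neg_mul_sq Real.pi_pos
  unfold gauss
  simpa only [neg_mul] using this

lemma integrable_gauss_sub (v : ℝ) : Integrable fun x : ℝ => gauss (x - v) :=
  integrable_gauss.comp_sub_right v

lemma integrable_mul_gauss_sub (v : ℝ) : Integrable fun x : ℝ => x * gauss (x - v) := by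
  have := (integrable_mul_gauss.comp_sub_right v).add ((integrable_gauss_sub v).const_mul v)
  refine this.congr (Eventually.of_forall fun x => ?_)
  simp only [Pi.add_apply]
  ring

lemma integral_gauss_sub (v : ℝ) : ∫ x : ℝ, gauss (x - v) = 1 := by
  rw [integral_sub_right_eq_self, integral_gauss]

lemma tendsto_gauss_atTop : Tendsto gauss atTop (𝓝 0) :=
  Real.tendsto_exp_neg_atTop_nhds_zero.comp
    ((tendsto_pow_atTop two_ne_zero).const_mul_atTop Real.pi_pos)

lemma tendsto_gauss_atBot : Tendsto gauss atBot (𝓝 0) := by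
  have := tendsto_gauss_atTop.comp tendsto_neg_atBot_atTop
  exact this.congr fun x => gauss_neg x

/-- The substitution `t ↦ t √π` absorbs the normalization. In this form `E1` is the odd primitive of
`2 * gauss`, from which its smoothness, monotonicity and limits follow. -/
lemma E1_eq_integral (u : ℝ) : E1 u = 2 * ∫ t in (0 : ℝ)..u, gauss t := by
  have h : ∫ t in (0 : ℝ)..u, gauss t = ∫ t in (0 : ℝ)..u, Real.exp (-(t * √Real.pi) ^ 2) := by
    refine intervalIntegral.integral_congr fun t _ => ?_
    simp only [gauss, mul_pow, Real.sq_sqrt Real.pi_pos.le]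
    ring_nf
  have hp : √Real.pi ≠ 0 := (Real.sqrt_pos.2 Real.pi_pos).ne'
  rw [h, intervalIntegral.integral_comp_mul_right (fun t => Real.exp (-t ^ 2)) hp, E1, erf]
  simp only [zero_mul, smul_eq_mul]
  ring

lemma hasDerivAt_E1 (u : ℝ) : HasDerivAt E1 (2 * gauss u) u := by
  have : E1 = fun u => 2 * ∫ t in (0 : ℝ)..u, gauss t := funext E1_eq_integral
  rw [this]
  exact (intervalIntegral.integral_hasDerivAt_right
    (continuous_gauss.intervalIntegrable _ _)
    (continuous_gauss.stronglyMeasurableAtFilter _ _) continuous_gauss.continuousAt).const_mul 2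

lemma contDiff_E1 : ContDiff ℝ ∞ E1 := by
  rw [contDiff_infty_iff_deriv]
  refine ⟨fun u => (hasDerivAt_E1 u).differentiableAt, ?_⟩
  have : deriv E1 = fun u => 2 * gauss u := funext fun u => (hasDerivAt_E1 u).deriv
  rw [this]
  exact contDiff_const.mul contDiff_gauss

@[fun_prop]
lemma continuous_E1 : Continuous E1 := contDiff_E1.continuous

lemma E1_zero : E1 0 = 0 := by simp [E1_eq_integral]

lemma E1_neg (u : ℝ) : E1 (-u) = -E1 u := by
  rw [E1_eq_integral, E1_eq_integral]
  have := intervalIntegral.integral_comp_neg (a := 0) (b := u) gauss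
  simp only [gauss_neg, neg_zero] at this
  rw [this, intervalIntegral.integral_symm 0 (-u)]
  ring

lemma integral_Ioi_zero_gauss : ∫ x in Ioi (0 : ℝ), gauss x = 1 / 2 := by
  have := integral_gaussian_Ioi Real.pi
  simp only [neg_mul] at this
  unfold gauss
  rw [this, div_self Real.pi_ne_zero, Real.sqrt_one]

lemma tendsto_E1_atTop : Tendsto E1 atTop (𝓝 1) := by
  have h := intervalIntegral_tendsto_integral_Ioi (0 : ℝ) integrable_gauss.integrableOn tendsto_id
  rw [integral_Ioi_zero_gauss] at h
  have := h.const_mul 2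
  norm_num at this
  exact this.congr fun u => (E1_eq_integral u).symm

lemma tendsto_E1_atBot : Tendsto E1 atBot (𝓝 (-1)) := by
  have := (tendsto_E1_atTop.comp tendsto_neg_atBot_atTop).neg
  exact this.congr fun u => by simp [E1_neg]

lemma monotone_E1 : Monotone E1 :=
  monotone_of_hasDerivAt_nonneg hasDerivAt_E1 fun u => by have := gauss_pos u; simp; positivity

lemma abs_E1_le_one (u : ℝ) : |E1 u| ≤ 1 :=
  abs_le.2 ⟨monotone_E1.le_of_tendsto tendsto_E1_atBot u, monotone_E1.ge_of_tendsto tendsto_E1_atTop u⟩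

lemma integral_Ioi_gauss (a : ℝ) : ∫ x in Ioi a, gauss x = (1 - E1 a) / 2 := by
  have h := integral_Ioi_of_hasDerivAt_of_tendsto' (a := a) (f := fun x => E1 x / 2) (f' := gauss)
    (m := 1 / 2) (fun x _ => by simpa using (hasDerivAt_E1 x).div_const 2)
    integrable_gauss.integrableOn (tendsto_E1_atTop.div_const 2)
  rw [h]; ring

lemma integral_Iio_gauss (a : ℝ) : ∫ x in Iio a, gauss x = (1 + E1 a) / 2 := by
  have h := integral_comp_neg_Ioi (-a) gauss
  simp only [gauss_neg, neg_neg] at h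
  rw [← integral_Iic_eq_integral_Iio, ← h, integral_Ioi_gauss, E1_neg]
  ring

lemma measurable_sign : Measurable Real.sign := by
  unfold Real.sign
  exact Measurable.ite measurableSet_Iio measurable_const
    (Measurable.ite measurableSet_Ioi measurable_const measurable_const)

lemma abs_sign_le_one (x : ℝ) : |Real.sign x| ≤ 1 := by
  rcases Real.sign_apply_eq x with h | h | h <;> simp [h]

lemma integrable_sign_mul {f : ℝ → ℝ} (hf : Integrable f) :
    Integrable fun x => Real.sign x * f x :=
  hf.bdd_mul (c := 1) measurable_sign.aestronglyMeasurable (Eventually.of_forall abs_sign_le_one)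

/-- An integral against the sign function is a difference of integrals over half-lines. -/
lemma integral_sign_mul {f : ℝ → ℝ} (hf : Integrable f) :
    ∫ x, Real.sign x * f x = (∫ x in Ioi 0, f x) - ∫ x in Iio 0, f x := by
  have hm := integrable_sign_mul hf
  have h1 : ∫ x in Ioi 0, Real.sign x * f x = ∫ x in Ioi 0, f x :=
    setIntegral_congr_fun measurableSet_Ioi fun x hx => by simp [Real.sign_of_pos hx]
  have h2 : ∫ x in Iic 0, Real.sign x * f x = -∫ x in Iio 0, f x := by
    rw [integral_Iic_eq_integral_Iio, ← integral_neg]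
    exact setIntegral_congr_fun measurableSet_Iio fun x hx => by simp [Real.sign_of_neg hx]
  rw [← intervalIntegral.integral_Iic_add_Ioi (b := 0) hm.integrableOn hm.integrableOn, h1, h2]
  ring

lemma integral_Ioi_comp_sub (f : ℝ → ℝ) (a v : ℝ) :
    ∫ x in Ioi a, f (x - v) = ∫ x in Ioi (a - v), f x := by
  have := (measurePreserving_sub_right volume v).setIntegral_preimage_emb
    (measurableEmbedding_subRight v) f (Ioi (a - v))
  simpa using this

lemma integral_Iio_comp_sub (f : ℝ → ℝ) (a v : ℝ) :
    ∫ x in Iio a, f (x - v) = ∫ x in Iio (a - v), f x := by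
  have := (measurePreserving_sub_right volume v).setIntegral_preimage_emb
    (measurableEmbedding_subRight v) f (Iio (a - v))
  simpa using this

/-- `E1` is the smoothing of the sign function by the Gaussian, the one-dimensional model of
`dblErf`. -/
lemma integral_sign_gauss_sub (v : ℝ) : ∫ x, Real.sign x * gauss (x - v) = E1 v := by
  rw [integral_sign_mul (integrable_gauss_sub v), integral_Ioi_comp_sub, integral_Iio_comp_sub,
    integral_Ioi_gauss, integral_Iio_gauss, zero_sub, E1_neg]
  ring

/-- Split `x = v + (x - v)`. The first part is `integral_sign_gauss_sub`; the second has the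
explicit primitive `-gauss / (2π)`, and the jump of the sign at `0` doubles its contribution. -/
lemma integral_sign_mul_gauss_sub (v : ℝ) :
    ∫ x, Real.sign x * (x * gauss (x - v)) = v * E1 v + gauss v / Real.pi := by
  have hi : Integrable fun x : ℝ => (x - v) * gauss (x - v) :=
    integrable_mul_gauss.comp_sub_right v
  have hd : ∀ x : ℝ, HasDerivAt (fun x => -gauss x / (2 * Real.pi)) (x * gauss x) x := fun x => by
    refine ((hasDerivAt_gauss x).fun_neg.div_const (2 * Real.pi)).congr_deriv ?_
    have := Real.pi_ne_zero
    field_simp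
  have e1 : ∫ x in Ioi (-v), x * gauss x = gauss v / (2 * Real.pi) := by
    rw [integral_Ioi_of_hasDerivAt_of_tendsto' (fun x _ => hd x) integrable_mul_gauss.integrableOn
      (by simpa using tendsto_gauss_atTop.neg.div_const (2 * Real.pi)), gauss_neg]
    ring
  have e2 : ∫ x in Iio (-v), x * gauss x = -(gauss v / (2 * Real.pi)) := by
    rw [← integral_Iic_eq_integral_Iio, integral_Iic_of_hasDerivAt_of_tendsto' (fun x _ => hd x)
      integrable_mul_gauss.integrableOn
      (by simpa using tendsto_gauss_atBot.neg.div_const (2 * Real.pi)), gauss_neg]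
    ring
  have h0 : ∫ x, Real.sign x * ((x - v) * gauss (x - v)) = gauss v / Real.pi := by
    rw [integral_sign_mul hi, integral_Ioi_comp_sub (fun x => x * gauss x),
      integral_Iio_comp_sub (fun x => x * gauss x), zero_sub, e1, e2]
    field_simp; ring
  rw [← h0, ← integral_sign_gauss_sub v, ← integral_const_mul, ← integral_add
    ((integrable_sign_mul (integrable_gauss_sub v)).const_mul v) (integrable_sign_mul hi)]
  congr 1; ext x; ring

end IndefTheta

end

noncomputable section

namespace IndefTheta

open MeasureTheory Filter Topology Set

/-! ### Gaussian averages of the error function -/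

/-- A Gaussian average of an error function with affine argument depends differentiably on the
coefficients of the argument. -/
lemma hasFDerivAt_integral_gauss_E1 {σ : ℝ → ℝ} (hσ : Measurable σ) (hb : ∀ y, |σ y| ≤ 1) (v : ℝ)
    (q : ℝ × ℝ) :
    ∃ L : ℝ × ℝ →L[ℝ] ℝ,
      HasFDerivAt (fun q : ℝ × ℝ => ∫ y, σ y * gauss (y - v) * E1 (q.1 + q.2 * y)) L q ∧
      ∀ h, L h = ∫ y, σ y * gauss (y - v) * (2 * gauss (q.1 + q.2 * y) * (h.1 + h.2 * y)) := by
  obtain ⟨F', hF'⟩ : ∃ F' : ℝ × ℝ → ℝ → (ℝ × ℝ →L[ℝ] ℝ), ∀ q y, F' q y =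
    (σ y * gauss (y - v) * (2 * gauss (q.1 + q.2 * y))) •
      (ContinuousLinearMap.fst ℝ ℝ ℝ + y • ContinuousLinearMap.snd ℝ ℝ ℝ) := ⟨_, fun _ _ => rfl⟩
  -- The derivative of `E1` is at most `2` and the affine argument has derivative of norm at most `1
  -- + |y|`. The resulting bound does not depend on `q`, so no localization is needed.
  have hbound : Integrable fun y : ℝ => 2 * gauss (y - v) + 2 * |y * gauss (y - v)| :=
    ((integrable_gauss_sub v).const_mul 2).add ((integrable_mul_gauss_sub v).abs.const_mul 2)
  have hF'b : ∀ q y, ‖F' q y‖ ≤ 2 * gauss (y - v) + 2 * |y * gauss (y - v)| := by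
    intro q y
    have hg := gauss_pos (y - v)
    have h1 : ‖ContinuousLinearMap.fst ℝ ℝ ℝ + y • ContinuousLinearMap.snd ℝ ℝ ℝ‖ ≤ 1 + |y| := by
      refine (norm_add_le _ _).trans (add_le_add (ContinuousLinearMap.norm_fst_le ℝ ℝ ℝ) ?_)
      rw [norm_smul]
      exact mul_le_of_le_one_right (norm_nonneg _) (ContinuousLinearMap.norm_snd_le ℝ ℝ ℝ)
    have h2 : ‖σ y * gauss (y - v) * (2 * gauss (q.1 + q.2 * y))‖ ≤ 2 * gauss (y - v) := by
      have hg2 := gauss_pos (q.1 + q.2 * y)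
      have hg3 := gauss_le_one (q.1 + q.2 * y)
      rw [Real.norm_eq_abs, abs_mul, abs_mul, abs_of_pos hg,
        abs_of_pos (mul_pos two_pos hg2)]
      calc |σ y| * gauss (y - v) * (2 * gauss (q.1 + q.2 * y))
          ≤ 1 * gauss (y - v) * (2 * 1) := by gcongr; exact hb y
        _ = _ := by ring
    rw [hF', norm_smul]
    calc _ ≤ 2 * gauss (y - v) * (1 + |y|) := by gcongr
      _ = _ := by rw [abs_mul, abs_of_pos hg]; ring
  have hmeas : ∀ q : ℝ × ℝ, AEStronglyMeasurable (fun y => σ y * gauss (y - v) * E1 (q.1 + q.2 * y))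
      volume := fun q => by
    refine Measurable.aestronglyMeasurable ?_
    exact (hσ.mul (by fun_prop)).mul (by fun_prop)
  have hmeas' : AEStronglyMeasurable (F' q) volume := by
    have h1 : Measurable fun y => σ y * gauss (y - v) * (2 * gauss (q.1 + q.2 * y)) :=
      (hσ.mul (by fun_prop)).mul (by fun_prop)
    have h2 : Continuous fun y : ℝ =>
        ContinuousLinearMap.fst ℝ ℝ ℝ + y • ContinuousLinearMap.snd ℝ ℝ ℝ := by fun_prop
    exact (h1.aestronglyMeasurable.smul h2.aestronglyMeasurable).congr
      (Eventually.of_forall fun y => (hF' q y).symm)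
  have hint : Integrable (fun y => σ y * gauss (y - v) * E1 (q.1 + q.2 * y)) := by
    refine (integrable_gauss_sub v).mono' (hmeas q) (Eventually.of_forall fun y => ?_)
    have hg := gauss_pos (y - v)
    rw [Real.norm_eq_abs, abs_mul, abs_mul, abs_of_pos hg]
    calc |σ y| * gauss (y - v) * |E1 (q.1 + q.2 * y)| ≤ 1 * gauss (y - v) * 1 := by
          gcongr
          · exact hb y
          · exact abs_E1_le_one _
      _ = _ := by ring
  have hdiff : ∀ y, ∀ q : ℝ × ℝ, HasFDerivAt
      (fun q : ℝ × ℝ => σ y * gauss (y - v) * E1 (q.1 + q.2 * y)) (F' q y) q := by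
    intro y q
    have h1 : HasFDerivAt (fun q : ℝ × ℝ => q.1 + q.2 * y)
        (ContinuousLinearMap.fst ℝ ℝ ℝ + y • ContinuousLinearMap.snd ℝ ℝ ℝ) q :=
      hasFDerivAt_fst.add (hasFDerivAt_snd.mul_const y)
    have h2 := ((hasDerivAt_E1 (q.1 + q.2 * y)).comp_hasFDerivAt q h1).const_mul
      (σ y * gauss (y - v))
    rw [hF', ← smul_smul]
    exact h2
  have key : HasFDerivAt (fun q : ℝ × ℝ => ∫ y, σ y * gauss (y - v) * E1 (q.1 + q.2 * y))
      (∫ y, F' q y) q :=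
    hasFDerivAt_integral_of_dominated_of_fderiv_le (𝕜 := ℝ) (μ := volume) (bound := fun y : ℝ =>
      2 * gauss (y - v) + 2 * |y * gauss (y - v)|) (F' := F') (s := univ) univ_mem
      (Eventually.of_forall hmeas) hint hmeas' (Eventually.of_forall fun y q _ => hF'b q y) hbound
      (Eventually.of_forall fun y q _ => hdiff y q)
  refine ⟨∫ y, F' q y, key, fun h => ?_⟩
  rw [ContinuousLinearMap.integral_apply (hbound.mono' hmeas' (Eventually.of_forall (hF'b q)))]
  congr 1
  ext y
  simp [hF']
  ring

lemma hasDerivAt_integral_gauss_E1 {σ : ℝ → ℝ} (hσ : Measurable σ) (hb : ∀ y, |σ y| ≤ 1) (v : ℝ)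
    {a α : ℝ → ℝ} {a' α' s : ℝ} (ha : HasDerivAt a a' s) (hα : HasDerivAt α α' s) :
    HasDerivAt (fun s => ∫ y, σ y * gauss (y - v) * E1 (a s + α s * y))
      (∫ y, σ y * gauss (y - v) * (2 * gauss (a s + α s * y) * (a' + α' * y))) s := by
  obtain ⟨L, hL, h⟩ := hasFDerivAt_integral_gauss_E1 hσ hb v (a s, α s)
  have := HasFDerivAt.comp_hasDerivAt s hL (ha.prodMk hα)
  rw [h] at this
  exact this

/-- As `y` varies, the point `(u₁ + α y, y - u₂)` runs along a line of direction `(α, 1)`. Its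
components orthogonal to and along that direction are the two arguments on the right, and only the
second depends on `y`. -/
lemma gauss_mul_gauss (α u₁ u₂ y : ℝ) :
    gauss (y - u₂) * gauss (u₁ + α * y) =
      gauss ((u₁ + α * u₂) / √(1 + α ^ 2)) * gauss (√(1 + α ^ 2) * y - (u₂ - α * u₁) / √(1 + α ^ 2)) := by
  have hβ : 0 < 1 + α ^ 2 := by positivity
  have hs : √(1 + α ^ 2) ^ 2 = 1 + α ^ 2 := Real.sq_sqrt hβ.le
  have hs0 : √(1 + α ^ 2) ≠ 0 := (Real.sqrt_pos.2 hβ).ne'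
  simp only [gauss, ← Real.exp_add]
  congr 1
  have : (√(1 + α ^ 2) * y - (u₂ - α * u₁) / √(1 + α ^ 2)) ^ 2 =
      (1 + α ^ 2) * y ^ 2 - 2 * y * (u₂ - α * u₁) + (u₂ - α * u₁) ^ 2 / (1 + α ^ 2) := by
    rw [sub_sq, mul_pow, hs, div_pow, hs]
    field_simp
  rw [this, div_pow, hs]
  field_simp
  ring

/-- What remains of a derivative of `dblErf` after the square is completed. Rescaling by `β > 0`
does not change the sign factor, so the two moments computed before suffice. -/
lemma integral_sign_affine_gauss {β : ℝ} (hβ : 0 < β) (v c c' : ℝ) :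
    ∫ y, Real.sign y * ((c + c' * y) * gauss (β * y - v)) =
      1 / β * ((c + c' * v / β) * E1 v + c' / (Real.pi * β) * gauss v) := by
  have hsign : ∀ y, Real.sign (β * y) = Real.sign y := fun y => by
    rcases lt_trichotomy y 0 with h | rfl | h
    · rw [Real.sign_of_neg h, Real.sign_of_neg (mul_neg_of_pos_of_neg hβ h)]
    · simp
    · rw [Real.sign_of_pos h, Real.sign_of_pos (mul_pos hβ h)]
  have h := Measure.integral_comp_mul_left
    (fun z => Real.sign z * ((c + c' / β * z) * gauss (z - v))) β
  simp only [hsign] at h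
  have e : ∀ y, c' / β * (β * y) = c' * y := fun y => by field_simp
  simp only [e] at h
  rw [h]
  have i1 := (integrable_sign_mul (integrable_gauss_sub v)).const_mul c
  have i2 := (integrable_sign_mul (integrable_mul_gauss_sub v)).const_mul (c' / β)
  have : (fun z => Real.sign z * ((c + c' / β * z) * gauss (z - v))) =
      fun z => c * (Real.sign z * gauss (z - v)) + c' / β * (Real.sign z * (z * gauss (z - v))) := by
    ext z; ring
  rw [this, integral_add i1 i2, integral_const_mul, integral_const_mul, integral_sign_gauss_sub,
    integral_sign_mul_gauss_sub, abs_of_pos (inv_pos.2 hβ), smul_eq_mul]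
  have := Real.pi_ne_zero
  field_simp
  ring

lemma integral_gauss_affine {β : ℝ} (hβ : 0 < β) (v : ℝ) : ∫ y, gauss (β * y - v) = 1 / β := by
  rw [Measure.integral_comp_mul_left (fun z => gauss (z - v)), integral_gauss_sub,
    abs_of_pos (inv_pos.2 hβ)]
  simp

/-- Averaging `E₁` of an affine function against a Gaussian gives `E₁` again. -/
lemma integral_gauss_mul_E1 (α u₁ u₂ : ℝ) :
    ∫ y, gauss (y - u₂) * E1 (u₁ + α * y) = E1 ((u₁ + α * u₂) / √(1 + α ^ 2)) := by
  have hβ : 0 < √(1 + α ^ 2) := Real.sqrt_pos.2 (by positivity)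
  -- The difference of the two sides as a function of `s = u₁`. Its derivative vanishes by
  -- `gauss_mul_gauss`, so one value decides.
  set f : ℝ → ℝ := fun s => (∫ y, 1 * gauss (y - u₂) * E1 (s + α * y)) -
    E1 ((s + α * u₂) / √(1 + α ^ 2)) with hf
  have hd : ∀ s, HasDerivAt f 0 s := fun s => by
    have h1 := hasDerivAt_integral_gauss_E1 (σ := fun _ => 1) measurable_const (by simp) u₂
      (hasDerivAt_id s) (hasDerivAt_const s α)
    have h2 : HasDerivAt (fun s => E1 ((s + α * u₂) / √(1 + α ^ 2))) _ s :=
      (hasDerivAt_E1 _).comp s (((hasDerivAt_id s).add_const (α * u₂)).div_const _)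
    refine (h1.sub h2).congr_deriv ?_
    have : ∀ y, 1 * gauss (y - u₂) * (2 * gauss (id s + α * y) * (1 + 0 * y)) =
        2 * gauss ((s + α * u₂) / √(1 + α ^ 2)) *
          gauss (√(1 + α ^ 2) * y - (u₂ - α * s) / √(1 + α ^ 2)) := fun y => by
      simp only [id]; linear_combination 2 * gauss_mul_gauss α s u₂ y
    simp only [this]
    rw [integral_const_mul, integral_gauss_affine hβ]
    ring
  have hc := is_const_of_deriv_eq_zero (fun s => (hd s).differentiableAt) (fun s => (hd s).deriv)
    u₁ (-(α * u₂))
  -- At this value of `s` the argument of `E1` is `α (y - u₂)`, so the integrand is odd about `u₂`.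
  have h0 : f (-(α * u₂)) = 0 := by
    have e1 : ∫ y, 1 * gauss (y - u₂) * E1 (-(α * u₂) + α * y) = ∫ z, gauss z * E1 (α * z) := by
      rw [← integral_sub_right_eq_self (fun z => gauss z * E1 (α * z)) u₂]
      congr 1; ext y; rw [one_mul]; ring_nf
    have e2 : ∫ z, gauss z * E1 (α * z) = 0 := by
      have := integral_neg_eq_self (fun z => gauss z * E1 (α * z)) volume
      simp only [gauss_neg, mul_neg, E1_neg, integral_neg] at this
      linarith
    rw [hf]; simp only [e1, e2]; simp [E1_zero]
  rw [h0] at hc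
  simp only [hf, one_mul] at hc
  linarith

/-! ### The double error function as a Gaussian average -/

/-- The double error function in the form of a Gaussian average of `sign(y) E₁(u₁ + α y)`. -/
def dblErf (α u₁ u₂ : ℝ) : ℝ := ∫ y, Real.sign y * gauss (y - u₂) * E1 (u₁ + α * y)

/-- The variation of the double error function with its first argument and its parameter. -/
lemma hasDerivAt_dblErf_left (u₂ : ℝ) {a α : ℝ → ℝ} {a' α' s : ℝ} (ha : HasDerivAt a a' s)
    (hα : HasDerivAt α α' s) :
    HasDerivAt (fun s => dblErf (α s) (a s) u₂)
      (2 / √(1 + α s ^ 2) * gauss ((a s + α s * u₂) / √(1 + α s ^ 2)) *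
        ((a' + α' * ((u₂ - α s * a s) / √(1 + α s ^ 2)) / √(1 + α s ^ 2)) *
            E1 ((u₂ - α s * a s) / √(1 + α s ^ 2)) +
          α' / (Real.pi * √(1 + α s ^ 2)) * gauss ((u₂ - α s * a s) / √(1 + α s ^ 2)))) s := by
  have hβ : 0 < √(1 + α s ^ 2) := Real.sqrt_pos.2 (by positivity)
  refine (hasDerivAt_integral_gauss_E1 measurable_sign abs_sign_le_one u₂ ha hα).congr_deriv ?_
  have : ∀ y, Real.sign y * gauss (y - u₂) * (2 * gauss (a s + α s * y) * (a' + α' * y)) =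
      2 * gauss ((a s + α s * u₂) / √(1 + α s ^ 2)) * (Real.sign y * ((a' + α' * y) *
        gauss (√(1 + α s ^ 2) * y - (u₂ - α s * a s) / √(1 + α s ^ 2)))) := fun y => by
    linear_combination (Real.sign y * 2 * (a' + α' * y)) * gauss_mul_gauss (α s) (a s) u₂ y
  simp only [this]
  rw [integral_const_mul, integral_sign_affine_gauss hβ]
  ring

end IndefTheta

end

/-! ### Smoothness of the double error function and its limits along rays. -/

noncomputable section

namespace IndefTheta

open MeasureTheory Filter Topology Set

/-- The distributional derivative of the sign function is twice the delta at `0`. -/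
lemma integral_sign_deriv {g g' : ℝ → ℝ} (hg : ∀ x, HasDerivAt g (g' x) x) (hi : Integrable g')
    (ht : Tendsto g atTop (𝓝 0)) (hb : Tendsto g atBot (𝓝 0)) :
    ∫ x, Real.sign x * g' x = -2 * g 0 := by
  rw [integral_sign_mul hi, ← integral_Iic_eq_integral_Iio,
    integral_Ioi_of_hasDerivAt_of_tendsto' (fun x _ => hg x) hi.integrableOn ht,
    integral_Iic_of_hasDerivAt_of_tendsto' (fun x _ => hg x) hi.integrableOn hb]
  ring

/-- A dominating function independent of `u` near `v`. Since `π > 3`, the Gaussian absorbs the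
linear factor and leaves `exp(-2 (y - u)²)`; then `(y - v)² ≤ 2 (y - u)² + 2 (u - v)²` recentres it.
-/
lemma abs_mul_gauss_sub_le {y u v : ℝ} (h : |u - v| < 1) :
    |(y - u) * gauss (y - u)| ≤ Real.exp 2 * Real.exp (-1 * (y - v) ^ 2) := by
  have h1 : |y - u| ≤ Real.exp ((y - u) ^ 2) := by
    have := Real.add_one_le_exp ((y - u) ^ 2)
    nlinarith [sq_nonneg (|y - u| - 1), sq_abs (y - u), abs_nonneg (y - u)]
  have h2 : gauss (y - u) ≤ Real.exp (-3 * (y - u) ^ 2) := by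
    rw [gauss, Real.exp_le_exp]
    nlinarith [Real.pi_gt_three, sq_nonneg (y - u)]
  rw [abs_mul, abs_of_pos (gauss_pos _)]
  calc |y - u| * gauss (y - u) ≤ Real.exp ((y - u) ^ 2) * Real.exp (-3 * (y - u) ^ 2) := by
        gcongr
        exact (gauss_pos _).le
    _ = Real.exp (-2 * (y - u) ^ 2) := by rw [← Real.exp_add]; ring_nf
    _ ≤ Real.exp (2 + -1 * (y - v) ^ 2) := by
        rw [Real.exp_le_exp]
        have : (u - v) ^ 2 ≤ 1 := by
          rw [← sq_abs]; nlinarith [abs_nonneg (u - v)]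
        nlinarith [sq_nonneg ((y - u) - (u - v))]
    _ = _ := Real.exp_add _ _

lemma integral_sign_gauss_mul_gauss (α u₁ u₂ : ℝ) :
    ∫ y, Real.sign y * (gauss (y - u₂) * gauss (u₁ + α * y)) =
      1 / √(1 + α ^ 2) * gauss ((u₁ + α * u₂) / √(1 + α ^ 2)) *
        E1 ((u₂ - α * u₁) / √(1 + α ^ 2)) := by
  have hβ : 0 < √(1 + α ^ 2) := Real.sqrt_pos.2 (by positivity)
  have h := integral_sign_affine_gauss hβ ((u₂ - α * u₁) / √(1 + α ^ 2)) 1 0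
  have e : ∀ y, Real.sign y * (gauss (y - u₂) * gauss (u₁ + α * y)) =
      gauss ((u₁ + α * u₂) / √(1 + α ^ 2)) * (Real.sign y * ((1 + 0 * y) *
        gauss (√(1 + α ^ 2) * y - (u₂ - α * u₁) / √(1 + α ^ 2)))) := fun y => by
    rw [gauss_mul_gauss]; ring
  simp only [e]
  rw [integral_const_mul, h]
  ring

lemma integrable_gauss_mul_E1 (α u₁ u₂ : ℝ) :
    Integrable fun y => gauss (y - u₂) * E1 (u₁ + α * y) :=
  (integrable_gauss_sub u₂).mul_bdd (c := 1)
    (Continuous.aestronglyMeasurable (by fun_prop))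
    (Eventually.of_forall fun y => abs_E1_le_one _)

/-- The derivative in `u₂` falls on `gauss (y - u₂)`, where it equals minus the derivative in `y`.
Integrating by parts, the jump of the sign at `0` produces the first term and the derivative of `E1`
the second. -/
lemma hasDerivAt_dblErf_right (α u₁ u₂ : ℝ) :
    HasDerivAt (fun v => dblErf α u₁ v)
      (2 * gauss u₂ * E1 u₁ + 2 * α / √(1 + α ^ 2) * gauss ((u₁ + α * u₂) / √(1 + α ^ 2)) *
        E1 ((u₂ - α * u₁) / √(1 + α ^ 2))) u₂ := by
  have hgd : ∀ y v : ℝ, HasDerivAt (fun v => gauss (y - v)) (2 * Real.pi * ((y - v) * gauss (y - v))) v :=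
    fun y v => ((hasDerivAt_gauss (y - v)).comp v ((hasDerivAt_id v).const_sub y)).congr_deriv
      (by simp; ring)
  have hint : Integrable fun y : ℝ =>
      2 * Real.pi * (Real.exp 2 * Real.exp (-1 * (y - u₂) ^ 2)) :=
    (((integrable_exp_neg_mul_sq one_pos).comp_sub_right u₂).const_mul _).const_mul _
  have hmeas : ∀ v, AEStronglyMeasurable
      (fun y => Real.sign y * gauss (y - v) * E1 (u₁ + α * y)) volume := fun v =>
    ((measurable_sign.mul (by fun_prop)).mul (by fun_prop)).aestronglyMeasurable
  have hmeas' : AEStronglyMeasurable (fun y => Real.sign y *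
      (2 * Real.pi * ((y - u₂) * gauss (y - u₂))) * E1 (u₁ + α * y)) volume :=
    ((measurable_sign.mul (by fun_prop)).mul (by fun_prop)).aestronglyMeasurable
  have hint0 : Integrable (fun y => Real.sign y * gauss (y - u₂) * E1 (u₁ + α * y)) := by
    simpa only [mul_assoc] using integrable_sign_mul (integrable_gauss_mul_E1 α u₁ u₂)
  have key := hasDerivAt_integral_of_dominated_loc_of_deriv_le (𝕜 := ℝ) (μ := volume)
    (F := fun v y => Real.sign y * gauss (y - v) * E1 (u₁ + α * y))
    (F' := fun v y => Real.sign y * (2 * Real.pi * ((y - v) * gauss (y - v))) * E1 (u₁ + α * y))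
    (bound := fun y => 2 * Real.pi * (Real.exp 2 * Real.exp (-1 * (y - u₂) ^ 2)))
    (Metric.ball_mem_nhds u₂ one_pos) (Eventually.of_forall hmeas) hint0 hmeas'
    (Eventually.of_forall fun y v hv => by
      have h1 := abs_mul_gauss_sub_le (y := y) (Metric.mem_ball.1 hv)
      have hp := Real.pi_pos
      rw [Real.norm_eq_abs, abs_mul, abs_mul, abs_mul (2 * Real.pi),
        abs_of_pos (mul_pos two_pos hp)]
      calc _ ≤ 1 * (2 * Real.pi * (Real.exp 2 * Real.exp (-1 * (y - u₂) ^ 2))) * 1 := by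
            gcongr
            · exact abs_sign_le_one y
            · exact abs_E1_le_one _
        _ = _ := by ring) hint
    (Eventually.of_forall fun y v _ => ((hgd y v).const_mul _).mul_const _)
  refine key.2.congr_deriv ?_
  have hg' : ∀ y, HasDerivAt (fun y => gauss (y - u₂) * E1 (u₁ + α * y))
      (-(2 * Real.pi * ((y - u₂) * gauss (y - u₂)) * E1 (u₁ + α * y)) +
        2 * α * (gauss (y - u₂) * gauss (u₁ + α * y))) y := fun y => by
    have h1 := (hasDerivAt_gauss (y - u₂)).comp y ((hasDerivAt_id y).sub_const u₂)
    have h2 := (hasDerivAt_E1 (u₁ + α * y)).comp y (((hasDerivAt_id y).const_mul α).const_add u₁)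
    exact (h1.mul h2).congr_deriv (by simp; ring)
  have i1 : Integrable fun y : ℝ => 2 * Real.pi * ((y - u₂) * gauss (y - u₂)) * E1 (u₁ + α * y) :=
    ((integrable_mul_gauss.comp_sub_right u₂).const_mul (2 * Real.pi)).mul_bdd (c := 1)
    (Continuous.aestronglyMeasurable (by fun_prop))
      (Eventually.of_forall fun y => abs_E1_le_one _)
  have i2 : Integrable fun y : ℝ => 2 * α * (gauss (y - u₂) * gauss (u₁ + α * y)) :=
    ((integrable_gauss_sub u₂).mul_bdd (c := 1)
    (Continuous.aestronglyMeasurable (by fun_prop)) (Eventually.of_forall fun y => by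
      rw [Real.norm_eq_abs, abs_of_pos (gauss_pos _)]; exact gauss_le_one _)).const_mul _
  have hlim : ∀ l : Filter ℝ, Tendsto (fun y => gauss (y - u₂)) l (𝓝 0) →
      Tendsto (fun y => gauss (y - u₂) * E1 (u₁ + α * y)) l (𝓝 0) := fun l hl =>
    squeeze_zero_norm (fun y => by
      rw [Real.norm_eq_abs, abs_mul, abs_of_pos (gauss_pos _)]
      exact mul_le_of_le_one_right (gauss_pos _).le (abs_E1_le_one _)) hl
  -- The integration by parts: the boundary terms at infinity vanish because `E1` is bounded.
  have hs := integral_sign_deriv hg' (i1.neg.add i2)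
    (hlim _ (tendsto_gauss_atTop.comp (tendsto_atTop_add_const_right _ (-u₂) tendsto_id)))
    (hlim _ (tendsto_gauss_atBot.comp (tendsto_atBot_add_const_right _ (-u₂) tendsto_id)))
  have e : ∀ y, Real.sign y * (-(2 * Real.pi * ((y - u₂) * gauss (y - u₂)) * E1 (u₁ + α * y)) +
        2 * α * (gauss (y - u₂) * gauss (u₁ + α * y))) =
      2 * α * (Real.sign y * (gauss (y - u₂) * gauss (u₁ + α * y))) -
      Real.sign y * (2 * Real.pi * ((y - u₂) * gauss (y - u₂))) * E1 (u₁ + α * y) := fun y => by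
    ring
  simp only [e] at hs
  have i3 : Integrable fun y : ℝ => 2 * α * (Real.sign y * (gauss (y - u₂) * gauss (u₁ + α * y))) :=
    (integrable_sign_mul i2).congr (Eventually.of_forall fun y => by ring)
  rw [integral_sub i3 key.1, integral_const_mul, integral_sign_gauss_mul_gauss] at hs
  simp only [zero_sub, gauss_neg, mul_zero, add_zero] at hs
  linear_combination -hs

/-- The partial derivative of `dblErf` in the first argument. -/
def dblErfLeft (α : ℝ) (u : ℝ × ℝ) : ℝ :=
  2 / √(1 + α ^ 2) * gauss ((u.1 + α * u.2) / √(1 + α ^ 2)) * E1 ((u.2 - α * u.1) / √(1 + α ^ 2))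

/-- The partial derivative of `dblErf` in the second argument. -/
def dblErfRight (α : ℝ) (u : ℝ × ℝ) : ℝ :=
  2 * gauss u.2 * E1 u.1 + α * dblErfLeft α u

lemma contDiff_dblErfLeft (α : ℝ) : ContDiff ℝ ∞ (dblErfLeft α) := by
  unfold dblErfLeft
  exact (contDiff_const.mul (contDiff_gauss.comp (by fun_prop))).mul (contDiff_E1.comp (by fun_prop))

lemma contDiff_dblErfRight (α : ℝ) : ContDiff ℝ ∞ (dblErfRight α) := by
  unfold dblErfRight
  exact ((contDiff_const.mul (contDiff_gauss.comp contDiff_snd)).mul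
    (contDiff_E1.comp contDiff_fst)).add (contDiff_const.mul (contDiff_dblErfLeft α))

lemma hasStrictFDerivAt_dblErf (α : ℝ) (u : ℝ × ℝ) :
    HasStrictFDerivAt (fun u : ℝ × ℝ => dblErf α u.1 u.2)
      ((dblErfLeft α u • ContinuousLinearMap.id ℝ ℝ).coprod
        (dblErfRight α u • ContinuousLinearMap.id ℝ ℝ)) u := by
  have h := hasStrictFDerivAt_uncurry_coprod (𝕜 := ℝ) (u := u) (f := fun a b => dblErf α a b)
    (f₁ := fun a b => dblErfLeft α (a, b) • ContinuousLinearMap.id ℝ ℝ)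
    (f₂ := fun a b => dblErfRight α (a, b) • ContinuousLinearMap.id ℝ ℝ)
    (Eventually.of_forall fun v => by
      have := hasDerivAt_dblErf_left v.2 (hasDerivAt_id v.1) (hasDerivAt_const v.1 α)
      rw [hasDerivAt_iff_hasFDerivAt] at this
      refine this.congr_fderiv ?_
      ext; simp [dblErfLeft, Function.HasUncurry.uncurry])
    (Eventually.of_forall fun v => by
      have := hasDerivAt_dblErf_right α v.1 v.2
      rw [hasDerivAt_iff_hasFDerivAt] at this
      refine this.congr_fderiv ?_
      ext; simp [dblErfRight, dblErfLeft, Function.HasUncurry.uncurry]; ring)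
    (Continuous.continuousAt (by
      have := (contDiff_dblErfLeft α).continuous
      exact this.smul continuous_const))
    (Continuous.continuousAt (by
      have := (contDiff_dblErfRight α).continuous
      exact this.smul continuous_const))
  exact h

/-- Although the integrand contains a discontinuous sign, both partial derivatives are products of
smooth one-variable functions, so a single differentiation gives smoothness of all orders. -/
lemma contDiff_dblErf (α : ℝ) : ContDiff ℝ ∞ (fun u : ℝ × ℝ => dblErf α u.1 u.2) := by
  rw [contDiff_infty_iff_fderiv]
  refine ⟨fun u => (hasStrictFDerivAt_dblErf α u).hasFDerivAt.differentiableAt, ?_⟩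
  have : fderiv ℝ (fun u : ℝ × ℝ => dblErf α u.1 u.2) = fun u =>
      dblErfLeft α u • ContinuousLinearMap.fst ℝ ℝ ℝ +
        dblErfRight α u • ContinuousLinearMap.snd ℝ ℝ ℝ := by
    ext1 u
    rw [(hasStrictFDerivAt_dblErf α u).hasFDerivAt.fderiv]
    ext <;> simp
  rw [this]
  exact ((contDiff_dblErfLeft α).smul contDiff_const).add
    ((contDiff_dblErfRight α).smul contDiff_const)

lemma tendsto_E1_mul_add {S : ℝ} (hS : S ≠ 0) (t : ℝ) :
    Tendsto (fun r => E1 (r * S + t)) atTop (𝓝 (Real.sign S)) := by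
  rcases hS.lt_or_gt with h | h
  · rw [Real.sign_of_neg h]
    exact tendsto_E1_atBot.comp (tendsto_atBot_add_const_right _ t
      (tendsto_id.atTop_mul_const_of_neg h))
  · rw [Real.sign_of_pos h]
    exact tendsto_E1_atTop.comp (tendsto_atTop_add_const_right _ t
      (tendsto_id.atTop_mul_const h))

lemma eventually_sign_add_mul {S : ℝ} (hS : S ≠ 0) (t : ℝ) :
    ∀ᶠ r : ℝ in atTop, Real.sign (t + r * S) = Real.sign S := by
  rcases hS.lt_or_gt with h | h
  · filter_upwards [(tendsto_atBot_add_const_left _ t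
      (tendsto_id.atTop_mul_const_of_neg h)).eventually_lt_atBot 0] with r hr
    simp only [id] at hr
    rw [Real.sign_of_neg h, Real.sign_of_neg hr]
  · filter_upwards [(tendsto_atTop_add_const_left _ t
      (tendsto_id.atTop_mul_const h)).eventually_gt_atTop 0] with r hr
    simp only [id] at hr
    rw [Real.sign_of_pos h, Real.sign_of_pos hr]

/-- Along a ray the double error function tends to a product of signs. -/
lemma tendsto_dblErf_atTop {α u₁ u₂ : ℝ} (h2 : u₂ ≠ 0) (h1 : u₁ + α * u₂ ≠ 0) :
    Tendsto (fun r => dblErf α (r * u₁) (r * u₂)) atTop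
      (𝓝 (Real.sign u₂ * Real.sign (u₁ + α * u₂))) := by
  -- Translating `y` by `r u₂` fixes the Gaussian. The scale `r` then sits only in bounded factors
  -- with pointwise limits, which is the setting of dominated convergence.
  have e : ∀ r, dblErf α (r * u₁) (r * u₂) =
      ∫ y, Real.sign (y + r * u₂) * gauss y * E1 (r * (u₁ + α * u₂) + α * y) := fun r => by
    rw [dblErf, ← integral_add_right_eq_self _ (r * u₂)]
    congr 1; ext y; rw [add_sub_cancel_right]; ring_nf
  simp only [e]
  have hc : Real.sign u₂ * Real.sign (u₁ + α * u₂) =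
      ∫ y, Real.sign u₂ * gauss y * Real.sign (u₁ + α * u₂) := by
    rw [integral_mul_const, integral_const_mul, integral_gauss, mul_one]
  rw [hc]
  refine tendsto_integral_filter_of_dominated_convergence gauss
    (Eventually.of_forall fun r => ?_) (Eventually.of_forall fun r => Eventually.of_forall fun y => ?_)
    integrable_gauss (Eventually.of_forall fun y => ?_)
  · exact (((measurable_sign.comp (by fun_prop)).mul (by fun_prop)).mul
      (by fun_prop)).aestronglyMeasurable
  · rw [Real.norm_eq_abs, abs_mul, abs_mul, abs_of_pos (gauss_pos y)]
    have := (gauss_pos y).le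
    calc _ ≤ 1 * gauss y * 1 := by
          gcongr
          · exact abs_sign_le_one _
          · exact abs_E1_le_one _
      _ = _ := by ring
  · refine Tendsto.mul (Tendsto.mul_const _ ?_) (tendsto_E1_mul_add h1 _)
    exact tendsto_const_nhds.congr' ((eventually_sign_add_mul h2 y).mono fun r hr => hr.symm)

end IndefTheta

end

noncomputable section

namespace IndefTheta

open MeasureTheory Filter Topology Set

/-! ### The contour integral for the complementary double error function -/

lemma integral_gauss_mul_cexp (k : ℝ) :
    ∫ x : ℝ, (gauss x : ℂ) * Complex.exp (2 * Real.pi * Complex.I * k * x) = gauss k := by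
  have h := fourierIntegral_gaussian (b := Real.pi) (by simpa using Real.pi_pos) (2 * Real.pi * k)
  have hp : (Real.pi : ℂ) ≠ 0 := by exact_mod_cast Real.pi_ne_zero
  rw [div_self hp, Complex.one_cpow, one_mul] at h
  have e : Complex.exp (-(2 * Real.pi * k : ℂ) ^ 2 / (4 * Real.pi)) = (gauss k : ℂ) := by
    rw [gauss, Complex.ofReal_exp]
    congr 1; push_cast; field_simp; ring
  rw [e] at h
  rw [← h]
  congr 1; ext x
  rw [gauss, Complex.ofReal_exp, mul_comm]
  congr 2 <;> · push_cast; ring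

lemma sign_sq {u : ℝ} (hu : u ≠ 0) : Real.sign u * Real.sign u = 1 := by
  rcases Real.sign_apply_eq_of_ne_zero u hu with h | h <;> simp [h]

lemma sign_mul_pos {u : ℝ} (hu : u ≠ 0) : 0 < Real.sign u * u := Real.sign_mul_pos_of_ne_zero u hu

/-- A pole is a Laplace transform. The factor `sign u` records on which side of the contour the pole
lies and makes the exponential decay, because `sign u * u > 0`. -/
lemma inv_sub_eq_integral {u : ℝ} (hu : u ≠ 0) (y : ℝ) :
    ((y : ℂ) - Complex.I * u)⁻¹ = 2 * Real.pi * Complex.I * Real.sign u *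
      ∫ a in Ioi (0 : ℝ), Complex.exp (-(2 * Real.pi * Real.sign u * (u + Complex.I * y)) * a) := by
  have hs := sign_sq hu
  have hs' : (Real.sign u : ℂ) ≠ 0 := by
    intro h
    rw [Complex.ofReal_eq_zero] at h
    simp [h] at hs
  have hp : (Real.pi : ℂ) ≠ 0 := by exact_mod_cast Real.pi_ne_zero
  have hpos := sign_mul_pos hu
  have hre : (-(2 * Real.pi * Real.sign u * (u + Complex.I * y)) : ℂ).re < 0 := by
    have : (-(2 * Real.pi * Real.sign u * (u + Complex.I * y)) : ℂ).re =
        -(2 * Real.pi * (Real.sign u * u)) := by simp; ring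
    rw [this]
    have := Real.pi_pos
    have : 0 < 2 * Real.pi * (Real.sign u * u) := by positivity
    linarith
  have hne : (u + Complex.I * y : ℂ) ≠ 0 := by
    intro h
    have := congrArg Complex.re h
    simp at this
    exact hu this
  have hw : (y - Complex.I * u : ℂ) = -Complex.I * (u + Complex.I * y) := by
    linear_combination (y : ℂ) * Complex.I_sq
  rw [integral_exp_mul_complex_Ioi hre, hw]
  simp only [Complex.ofReal_zero, mul_zero, Complex.exp_zero]
  have hI := Complex.I_ne_zero
  field_simp
  linear_combination -Complex.I_sq

/-- With the pole written as a Laplace integral, Fubini leaves the Fourier transform of `gauss` in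
`x`, which is `gauss` again. -/
lemma integral_gauss_div {u : ℝ} (hu : u ≠ 0) (k r : ℝ) :
    ∫ x : ℝ, (gauss x : ℂ) * Complex.exp (2 * Real.pi * Complex.I * k * x) *
        ((x : ℂ) - r - Complex.I * u)⁻¹ =
      2 * Real.pi * Complex.I * Real.sign u * ∫ a in Ioi (0 : ℝ),
        Complex.exp (-(2 * Real.pi * Real.sign u * (u - Complex.I * r)) * a) *
          gauss (k - Real.sign u * a) := by
  have hpos := sign_mul_pos hu
  have hpi := Real.pi_pos
  have e1 : ∀ x : ℝ, (gauss x : ℂ) * Complex.exp (2 * Real.pi * Complex.I * k * x) *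
        ((x : ℂ) - r - Complex.I * u)⁻¹ = 2 * Real.pi * Complex.I * Real.sign u *
      ∫ a in Ioi (0 : ℝ), (gauss x : ℂ) * Complex.exp (2 * Real.pi * Complex.I * k * x) *
        Complex.exp (-(2 * Real.pi * Real.sign u * (u + Complex.I * (x - r : ℝ))) * a) := fun x => by
    have := inv_sub_eq_integral hu (x - r)
    rw [Complex.ofReal_sub] at this ⊢
    rw [this, integral_const_mul]
    ring
  simp only [e1]
  rw [integral_const_mul]
  congr 1
  have hint : Integrable (Function.uncurry fun (x a : ℝ) =>
      (gauss x : ℂ) * Complex.exp (2 * Real.pi * Complex.I * k * x) *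
        Complex.exp (-(2 * Real.pi * Real.sign u * (u + Complex.I * (x - r : ℝ))) * a))
      (volume.prod (volume.restrict (Ioi (0 : ℝ)))) := by
    have hb : Integrable (fun z : ℝ × ℝ => gauss z.1 *
        Real.exp (-(2 * Real.pi * (Real.sign u * u)) * z.2))
        (volume.prod (volume.restrict (Ioi (0 : ℝ)))) :=
      integrable_gauss.mul_prod (integrableOn_exp_mul_Ioi (by
        have : 0 < 2 * Real.pi * (Real.sign u * u) := by positivity
        linarith) 0)
    refine hb.mono' (Continuous.aestronglyMeasurable (by fun_prop))
      (Eventually.of_forall fun z => le_of_eq ?_)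
    simp only [Function.uncurry, norm_mul, Complex.norm_exp, Complex.norm_real, Real.norm_eq_abs,
      abs_of_pos (gauss_pos _)]
    rw [mul_assoc, ← Real.exp_add]
    congr 2
    simp only [Complex.mul_re, Complex.mul_im, Complex.neg_re, Complex.neg_im, Complex.add_re,
      Complex.add_im, Complex.ofReal_re, Complex.ofReal_im, Complex.I_re, Complex.I_im,
      Complex.re_ofNat, Complex.im_ofNat]
    ring
  rw [integral_integral_swap hint]
  refine integral_congr_ae (Eventually.of_forall fun a => ?_)
  simp only
  rw [← integral_gauss_mul_cexp, ← integral_const_mul]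
  congr 1; ext x
  rw [mul_assoc, ← Complex.exp_add, mul_left_comm, ← Complex.exp_add]
  congr 2
  push_cast
  ring

/-- The contours pass through the saddle point of the exponent, so the linear phases cancel and real
Gaussians remain. The exponential of frequency `0` equals `1`; it brings the `x₂` integral to the
form of `integral_gauss_div`. -/
lemma M2Integrand_shift (α u₁ u₂ x₁ x₂ : ℝ) :
    M2Integrand α u₁ u₂ (x₁ - Complex.I * u₁) (x₂ - Complex.I * u₂) =
      (gauss u₁ * gauss u₂ : ℝ) * ((gauss x₁ : ℂ) * ((x₁ : ℂ) - Complex.I * u₁)⁻¹ *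
        ((gauss x₂ : ℂ) * Complex.exp (2 * Real.pi * Complex.I * (0 : ℝ) * x₂) *
          ((x₂ : ℂ) - (α * x₁ : ℝ) - Complex.I * (u₂ - α * u₁ : ℝ))⁻¹)) := by
  have h1 : Complex.exp (-Real.pi * (x₁ - Complex.I * u₁) ^ 2 - Real.pi * (x₂ - Complex.I * u₂) ^ 2
      - 2 * Real.pi * Complex.I * (u₁ * (x₁ - Complex.I * u₁) + u₂ * (x₂ - Complex.I * u₂))) =
      (gauss u₁ * gauss u₂ : ℝ) * ((gauss x₁ : ℂ) * gauss x₂) := by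
    simp only [gauss, Complex.ofReal_mul, Complex.ofReal_exp, ← Complex.exp_add]
    congr 1
    push_cast
    linear_combination (Real.pi * (u₁ : ℂ) ^ 2 + Real.pi * (u₂ : ℂ) ^ 2) * Complex.I_sq
  have h2 : ((x₂ : ℂ) - Complex.I * u₂ - α * (x₁ - Complex.I * u₁)) =
      (x₂ : ℂ) - (α * x₁ : ℝ) - Complex.I * (u₂ - α * u₁ : ℝ) := by push_cast; ring
  rw [M2Integrand, h1, h2, div_eq_mul_inv, mul_inv]
  simp only [Complex.ofReal_zero, mul_zero, zero_mul, Complex.exp_zero, mul_one]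
  ring

lemma integral_Ioi_gauss_add_sign {ε : ℝ} (hε : ε = -1 ∨ ε = 1) (z : ℝ) :
    ∫ a in Ioi (0 : ℝ), gauss (z + ε * a) = (1 - ε * E1 z) / 2 := by
  have h : ∀ a, gauss (z + ε * a) = gauss (a - -(ε * z)) := fun a => by
    rcases hε with rfl | rfl
    · rw [← gauss_neg]; ring_nf
    · ring_nf
  simp only [h]
  rw [integral_Ioi_comp_sub, integral_Ioi_gauss]
  rcases hε with rfl | rfl <;> simp [E1_neg]

/-- Both poles become half-line integrals, with variables `a` and `b`. After the Gaussian integrals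
over `x₁, x₂`, the integral over `a` is an incomplete Gaussian integral, hence `(1 ∓ E1) / 2`, and
the one over `b` is left standing. -/
lemma M2_eq {α u₁ u₂ : ℝ} (h1 : u₁ ≠ 0) (h2 : u₂ - α * u₁ ≠ 0) :
    M2 α u₁ u₂ = ((2 * Real.sign u₁ * Real.sign (u₂ - α * u₁) * ∫ b in Ioi (0 : ℝ),
      gauss (u₂ + Real.sign (u₂ - α * u₁) * b) *
        (1 - Real.sign u₁ * E1 (u₁ - α * (Real.sign (u₂ - α * u₁) * b))) : ℝ) : ℂ) := by
  set v := u₂ - α * u₁ with hv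
  set ε₁ := Real.sign u₁
  set ε₂ := Real.sign v
  have hpi := Real.pi_pos
  have hpc : (Real.pi : ℂ) ≠ 0 := by exact_mod_cast Real.pi_ne_zero
  have hε₁ : ε₁ = -1 ∨ ε₁ = 1 := Real.sign_apply_eq_of_ne_zero u₁ h1
  have hε₂ : ε₂ = -1 ∨ ε₂ = 1 := Real.sign_apply_eq_of_ne_zero v h2
  have s1 : ε₁ ^ 2 = 1 := by rcases hε₁ with h | h <;> simp [h]
  have s2 : ε₂ ^ 2 = 1 := by rcases hε₂ with h | h <;> simp [h]
  -- integrate over `x₂` first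
  have e1 : ∀ x₁ : ℝ, ∫ x₂ : ℝ,
      M2Integrand α u₁ u₂ (x₁ - Complex.I * u₁) (x₂ - Complex.I * u₂) =
      (gauss u₁ * gauss u₂ : ℝ) * (2 * Real.pi * Complex.I * ε₂) *
        ∫ b in Ioi (0 : ℝ), (gauss x₁ : ℂ) * ((x₁ : ℂ) - Complex.I * u₁)⁻¹ *
          (Complex.exp (-(2 * Real.pi * ε₂ * (v - Complex.I * (α * x₁ : ℝ))) * b) *
          gauss (0 - ε₂ * b)) := fun x₁ => by
    simp only [M2Integrand_shift]
    rw [integral_const_mul, integral_const_mul, integral_gauss_div h2, integral_const_mul]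
    ring
  have hint : Integrable (Function.uncurry fun (x₁ b : ℝ) =>
      (gauss x₁ : ℂ) * ((x₁ : ℂ) - Complex.I * u₁)⁻¹ *
          (Complex.exp (-(2 * Real.pi * ε₂ * (v - Complex.I * (α * x₁ : ℝ))) * b) *
          gauss (0 - ε₂ * b)))
      (volume.prod (volume.restrict (Ioi (0 : ℝ)))) := by
    have hb : Integrable (fun z : ℝ × ℝ => (|u₁|⁻¹ * gauss z.1) * gauss z.2)
        (volume.prod (volume.restrict (Ioi (0 : ℝ)))) :=
      (integrable_gauss.const_mul _).mul_prod integrable_gauss.integrableOn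
    have hne : ∀ x : ℝ, (x - Complex.I * u₁ : ℂ) ≠ 0 := fun x h => by
      have := congrArg Complex.im h
      simp at this
      exact h1 this
    have hcont : Continuous (Function.uncurry fun (x₁ b : ℝ) =>
      (gauss x₁ : ℂ) * ((x₁ : ℂ) - Complex.I * u₁)⁻¹ *
          (Complex.exp (-(2 * Real.pi * ε₂ * (v - Complex.I * (α * x₁ : ℝ))) * b) *
          gauss (0 - ε₂ * b))) := by
      refine Continuous.mul (Continuous.mul (by fun_prop) ?_) (by fun_prop)
      exact Continuous.inv₀ (by fun_prop) fun z => hne z.1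
    refine hb.mono' hcont.aestronglyMeasurable ?_
    have hm : ∀ᵐ z : ℝ × ℝ ∂(volume.prod (volume.restrict (Ioi (0 : ℝ)))), 0 < z.2 :=
      Measure.quasiMeasurePreserving_snd.ae (ae_restrict_mem measurableSet_Ioi)
    filter_upwards [hm] with z hz
    have n1 : ‖((z.1 : ℂ) - Complex.I * u₁)⁻¹‖ ≤ |u₁|⁻¹ := by
      rw [norm_inv]
      refine inv_anti₀ (abs_pos.2 h1) ?_
      have := Complex.abs_im_le_norm ((z.1 : ℂ) - Complex.I * u₁)
      simpa using this
    have n2 : ‖Complex.exp (-(2 * Real.pi * ε₂ * (v - Complex.I * (α * z.1 : ℝ))) * z.2)‖ ≤ 1 := by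
      rw [Complex.norm_exp, Real.exp_le_one_iff]
      have hp : 0 < ε₂ * v := sign_mul_pos h2
      have : (-(2 * Real.pi * ε₂ * (v - Complex.I * (α * z.1 : ℝ))) * z.2 : ℂ).re =
          -(2 * Real.pi * (ε₂ * v) * z.2) := by
        simp only [Complex.mul_re, Complex.mul_im, Complex.neg_re, Complex.neg_im, Complex.sub_re,
          Complex.sub_im, Complex.ofReal_re, Complex.ofReal_im, Complex.I_re, Complex.I_im,
          Complex.re_ofNat, Complex.im_ofNat]
        ring
      rw [this]
      have : 0 < 2 * Real.pi * (ε₂ * v) * z.2 := by positivity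
      linarith
    have n3 : gauss (0 - ε₂ * z.2) = gauss z.2 := by
      rcases hε₂ with h | h <;> simp [h, gauss_neg]
    simp only [Function.uncurry, norm_mul, Complex.norm_real, Real.norm_eq_abs,
      abs_of_pos (gauss_pos _), n3]
    have p1 := gauss_pos z.1
    have p2 := gauss_pos z.2
    calc _ ≤ gauss z.1 * |u₁|⁻¹ * (1 * gauss z.2) := by gcongr
      _ = _ := by ring
  -- then over `x₁`
  have e2 : ∀ b : ℝ, ∫ x₁ : ℝ, (gauss x₁ : ℂ) * ((x₁ : ℂ) - Complex.I * u₁)⁻¹ *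
          (Complex.exp (-(2 * Real.pi * ε₂ * (v - Complex.I * (α * x₁ : ℝ))) * b) *
          gauss (0 - ε₂ * b)) =
      2 * Real.pi * Complex.I * ε₁ * (Complex.exp (-(2 * Real.pi * ε₂ * v) * b) *
        gauss (0 - ε₂ * b)) * ∫ a in Ioi (0 : ℝ),
          Complex.exp (-(2 * Real.pi * ε₁ * (u₁ - Complex.I * (0 : ℝ))) * a) *
            gauss (α * ε₂ * b - ε₁ * a) := fun b => by
    have := integral_gauss_div h1 (α * ε₂ * b) 0
    rw [mul_right_comm (2 * (Real.pi : ℂ) * Complex.I * ε₁), ← this, ← integral_mul_const]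
    congr 1; ext x₁
    have : Complex.exp (-(2 * Real.pi * ε₂ * (v - Complex.I * (α * x₁ : ℝ))) * b) =
        Complex.exp (-(2 * Real.pi * ε₂ * v) * b) *
          Complex.exp (2 * Real.pi * Complex.I * (α * ε₂ * b : ℝ) * x₁) := by
      rw [← Complex.exp_add]; congr 1; push_cast; ring
    rw [this, Complex.ofReal_zero, sub_zero]
    ring
  -- The prefactor from the shifted contours and the Laplace exponentials complete two squares.
  have e3 : ∀ b a : ℝ, ((gauss u₁ * gauss u₂ : ℝ) : ℂ) * (Complex.exp (-(2 * Real.pi * ε₂ * v) * b) *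
        gauss (0 - ε₂ * b)) * (Complex.exp (-(2 * Real.pi * ε₁ * (u₁ - Complex.I * (0 : ℝ))) * a) *
            gauss (α * ε₂ * b - ε₁ * a)) =
      ((gauss (u₂ + ε₂ * b) * gauss (u₁ - α * (ε₂ * b) + ε₁ * a) : ℝ) : ℂ) := fun b a => by
    simp only [gauss, ← Real.exp_add, Complex.ofReal_exp, ← Complex.exp_add]
    congr 1
    have s1' : (ε₁ : ℂ) ^ 2 = 1 := by exact_mod_cast s1
    have s2' : (ε₂ : ℂ) ^ 2 = 1 := by exact_mod_cast s2
    rw [hv]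
    push_cast
    ring
  rw [M2]
  simp only [e1]
  rw [integral_const_mul, integral_integral_swap hint]
  simp only [e2]
  have e4 : ∀ b : ℝ, ((gauss u₁ * gauss u₂ : ℝ) : ℂ) * (2 * Real.pi * Complex.I * ε₁ *
      (Complex.exp (-(2 * Real.pi * ε₂ * v) * b) * gauss (0 - ε₂ * b)) * ∫ a in Ioi (0 : ℝ),
          Complex.exp (-(2 * Real.pi * ε₁ * (u₁ - Complex.I * (0 : ℝ))) * a) *
            gauss (α * ε₂ * b - ε₁ * a)) = Real.pi * Complex.I * ε₁ *
      ((gauss (u₂ + ε₂ * b) * (1 - ε₁ * E1 (u₁ - α * (ε₂ * b))) : ℝ) : ℂ) := fun b => by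
    have := integral_Ioi_gauss_add_sign hε₁ (u₁ - α * (ε₂ * b))
    have h : (((gauss u₁ * gauss u₂ : ℝ) : ℂ) * (Complex.exp (-(2 * Real.pi * ε₂ * v) * b) *
        gauss (0 - ε₂ * b))) * ∫ a in Ioi (0 : ℝ),
          Complex.exp (-(2 * Real.pi * ε₁ * (u₁ - Complex.I * (0 : ℝ))) * a) *
            gauss (α * ε₂ * b - ε₁ * a) =
        ((gauss (u₂ + ε₂ * b) * ((1 - ε₁ * E1 (u₁ - α * (ε₂ * b))) / 2) : ℝ) : ℂ) := by
      rw [← integral_const_mul, ← this, ← integral_const_mul, ← integral_complex_ofReal]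
      simp only [e3]
    push_cast at h ⊢
    linear_combination (2 * Real.pi * Complex.I * ε₁) * h
  rw [mul_comm ((gauss u₁ * gauss u₂ : ℝ) : ℂ), mul_assoc, ← integral_const_mul]
  simp only [e4]
  rw [integral_const_mul, integral_complex_ofReal]
  generalize (∫ b in Ioi (0 : ℝ), gauss (u₂ + ε₂ * b) * (1 - ε₁ * E1 (u₁ - α * (ε₂ * b)))) = J
  push_cast
  field_simp
  linear_combination (-(ε₁ * ε₂ * J : ℂ)) * Complex.I_sq

lemma M1_eq (u : ℝ) : M1 u = E1 u - Real.sign u := by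
  have h : Real.sign u * E1 |u| = E1 u := by
    rcases lt_trichotomy u 0 with h | rfl | h
    · rw [Real.sign_of_neg h, abs_of_neg h, E1_neg]; ring
    · simp [E1_zero]
    · rw [Real.sign_of_pos h, abs_of_pos h, one_mul]
  rw [M1, erfc, ← h, E1]
  ring

/-- Equivalent to the vanishing of `(sign u₂ - sign (u₂ - α u₁)) (sign (u₁ + α u₂) - sign u₁)`. If
both factors were nonzero, `u₁ (u₁ + α u₂)` and `u₂ (u₂ - α u₁)` would be nonpositive, but their sum
is `u₁² + u₂² > 0`. -/
lemma sign_mul_sign_eq {α u₁ u₂ : ℝ} (h1 : u₁ ≠ 0) :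
    Real.sign u₂ * Real.sign (u₁ + α * u₂) =
      Real.sign (u₂ - α * u₁) * Real.sign (u₁ + α * u₂) + Real.sign u₁ * Real.sign u₂ -
        Real.sign u₁ * Real.sign (u₂ - α * u₁) := by
  have key : Real.sign (u₁ + α * u₂) = Real.sign u₁ ∨ Real.sign u₂ = Real.sign (u₂ - α * u₁) := by
    by_contra! h
    obtain ⟨ha, hb⟩ := h
    have h3 : (u₁ + α * u₂) * u₁ ≤ 0 := by
      by_contra! hc
      rcases pos_and_pos_or_neg_and_neg_of_mul_pos hc with ⟨p, q⟩ | ⟨p, q⟩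
      · exact ha (by rw [Real.sign_of_pos p, Real.sign_of_pos q])
      · exact ha (by rw [Real.sign_of_neg p, Real.sign_of_neg q])
    have h4 : u₂ * (u₂ - α * u₁) ≤ 0 := by
      by_contra! hc
      rcases pos_and_pos_or_neg_and_neg_of_mul_pos hc with ⟨p, q⟩ | ⟨p, q⟩
      · exact hb (by rw [Real.sign_of_pos p, Real.sign_of_pos q])
      · exact hb (by rw [Real.sign_of_neg p, Real.sign_of_neg q])
    have : 0 < u₁ ^ 2 := by positivity
    nlinarith [sq_nonneg u₂]
  rcases key with h | h <;> rw [h] <;> ring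

/-- `M2_eq` leaves an integral over one half-line, while `dblErf` is a difference of two. Their sum
is known from `integral_gauss_mul_E1`, so one half-line determines both. Writing `M1 = E1 - sign`,
the error functions match and the remaining signs cancel by `sign_mul_sign_eq`. -/
lemma E2Regular_eq {α : ℝ} {u : ℝ × ℝ} (hu : u ∈ regularSet α) :
    E2Regular α u = (dblErf α u.1 u.2 : ℂ) := by
  obtain ⟨u₁, u₂⟩ := u
  obtain ⟨h1, h2⟩ := hu
  simp only at h1 h2
  have h2' : u₂ - α * u₁ ≠ 0 := sub_ne_zero.2 h2
  set ε := Real.sign (u₂ - α * u₁) with hε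
  have hε' : ε = -1 ∨ ε = 1 := Real.sign_apply_eq_of_ne_zero _ h2'
  have hsgn : Real.sign ((u₁ + α * u₂) / √(1 + α ^ 2)) = Real.sign (u₁ + α * u₂) := by
    have hβ : 0 < √(1 + α ^ 2) := Real.sqrt_pos.2 (by positivity)
    rcases lt_trichotomy (u₁ + α * u₂) 0 with h | h | h
    · rw [Real.sign_of_neg h, Real.sign_of_neg (div_neg_of_neg_of_pos h hβ)]
    · simp [h]
    · rw [Real.sign_of_pos h, Real.sign_of_pos (div_pos h hβ)]
  have hi := integrable_gauss_mul_E1 α u₁ u₂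
  have hE := integral_gauss_mul_E1 α u₁ u₂
  have hH : dblErf α u₁ u₂ = (∫ y in Ioi 0, gauss (y - u₂) * E1 (u₁ + α * y)) -
      ∫ y in Iio 0, gauss (y - u₂) * E1 (u₁ + α * y) := by
    rw [← integral_sign_mul hi, dblErf]; simp only [mul_assoc]
  rw [← intervalIntegral.integral_Iic_add_Ioi (b := 0) hi.integrableOn hi.integrableOn,
    integral_Iic_eq_integral_Iio] at hE
  set J := ∫ b in Ioi (0 : ℝ), gauss (u₂ + ε * b) * E1 (u₁ - α * (ε * b)) with hJ
  -- `J` is the integral over the negative half-line if `ε = 1` and over the positive one if `ε =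
  -- -1`.
  have hJε : dblErf α u₁ u₂ = ε * (E1 ((u₁ + α * u₂) / √(1 + α ^ 2)) - 2 * J) := by
    rcases hε' with h | h
    · have : J = ∫ y in Ioi 0, gauss (y - u₂) * E1 (u₁ + α * y) := by
        rw [hJ, h]
        congr 1; ext b; rw [← gauss_neg]; ring_nf
      rw [this, hH, ← hE, h]; ring
    · have : J = ∫ y in Iio 0, gauss (y - u₂) * E1 (u₁ + α * y) := by
        have := integral_comp_neg_Ioi (0 : ℝ) (fun y => gauss (y - u₂) * E1 (u₁ + α * y))
        rw [neg_zero, integral_Iic_eq_integral_Iio] at this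
        rw [hJ, h, ← this]
        congr 1; ext b; rw [← gauss_neg]; ring_nf
      rw [this, hH, ← hE, h]; ring
  have hcalc : (2 * Real.sign u₁ * ε * ∫ b in Ioi (0 : ℝ),
      gauss (u₂ + ε * b) * (1 - Real.sign u₁ * E1 (u₁ - α * (ε * b)))) =
      Real.sign u₁ * ε - Real.sign u₁ * E1 u₂ - 2 * ε * J := by
    have i1 : IntegrableOn (fun b => gauss (u₂ + ε * b)) (Ioi 0) := by
      refine Integrable.integrableOn ?_
      rcases hε' with h | h
      · exact (integrable_gauss_sub u₂).congr (Eventually.of_forall fun b => by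
          simp only [h]; rw [← gauss_neg]; ring_nf)
      · exact (integrable_gauss_sub (-u₂)).congr (Eventually.of_forall fun b => by
          simp only [h]; ring_nf)
    have i2 : IntegrableOn (fun b => Real.sign u₁ *
        (gauss (u₂ + ε * b) * E1 (u₁ - α * (ε * b)))) (Ioi 0) :=
      Integrable.const_mul (i1.mul_bdd (c := 1) (Continuous.aestronglyMeasurable (by fun_prop))
        (Eventually.of_forall fun b => abs_E1_le_one _)) _
    have e : ∀ b, gauss (u₂ + ε * b) * (1 - Real.sign u₁ * E1 (u₁ - α * (ε * b))) =
        gauss (u₂ + ε * b) - Real.sign u₁ * (gauss (u₂ + ε * b) * E1 (u₁ - α * (ε * b))) :=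
      fun b => by ring
    simp only [e]
    rw [integral_sub i1 i2, integral_Ioi_gauss_add_sign hε', integral_const_mul, ← hJ]
    have s1 := sign_sq h1
    have s2 : ε * ε = 1 := sign_sq h2'
    linear_combination (-2 * ε * J) * s1 - Real.sign u₁ * E1 u₂ * s2
  rw [E2Regular]
  simp only
  rw [M2_eq h1 h2', hcalc, M1_eq, M1_eq, hsgn, hJε, sign_mul_sign_eq h1, ← hε]
  push_cast
  ring

lemma dense_regularSet (α : ℝ) : Dense (regularSet α) := by
  have h1 : Dense {u : ℝ × ℝ | u.1 ≠ 0} :=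
    (dense_compl_singleton (0 : ℝ)).preimage isOpenMap_fst
  let f : ℝ × ℝ →L[ℝ] ℝ := ContinuousLinearMap.snd ℝ ℝ ℝ - α • ContinuousLinearMap.fst ℝ ℝ ℝ
  have hf : Function.Surjective f := fun t => ⟨(0, t), by simp [f]⟩
  have h2 : Dense {u : ℝ × ℝ | u.2 ≠ α * u.1} := by
    have := (dense_compl_singleton (0 : ℝ)).preimage (f.isOpenMap hf)
    have e : {u : ℝ × ℝ | u.2 ≠ α * u.1} = f ⁻¹' {0}ᶜ := by ext u; simp [f, sub_eq_zero]
    rwa [e]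
  exact h1.inter_of_isOpen_left h2 (isOpen_ne_fun continuous_fst continuous_const)

/-- Continuity of `dblErf` and density of the regular set identify the extension; in particular the
limits defining it exist. -/
lemma E2_eq (α u₁ u₂ : ℝ) : E2 α u₁ u₂ = (dblErf α u₁ u₂ : ℂ) := by
  refine extendFrom_eq (dense_regularSet α _) ?_
  have hc : Continuous fun u : ℝ × ℝ => (dblErf α u.1 u.2 : ℂ) :=
    Complex.continuous_ofReal.comp (contDiff_dblErf α).continuous
  have := hc.continuousAt (x := (u₁, u₂)).continuousWithinAt (s := regularSet α)
  exact this.tendsto.congr' (eventually_nhdsWithin_of_forall fun u hu => (E2Regular_eq hu).symm)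

end IndefTheta

end

noncomputable section

namespace IndefTheta

open MeasureTheory Filter Topology Set

/-! ### The boosted double error function -/

lemma sqrt_one_add_sq_div {A₁ A₂ c : ℝ} (h1 : 0 < A₁) (h2 : 0 < A₂) (hΔ : 0 < A₁ * A₂ - c ^ 2) :
    √(1 + (c / √(A₁ * A₂ - c ^ 2)) ^ 2) = √A₁ * √A₂ / √(A₁ * A₂ - c ^ 2) := by
  rw [← Real.sqrt_mul h1.le, ← Real.sqrt_div (by positivity), div_pow, Real.sq_sqrt hΔ.le]
  congr 1
  field_simp
  ring

/-- Read `A₁, A₂, c` as Gram entries of `C₁, C₂`, and `x, y` as pairings with a vector. With `α = c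
/ √Δ`, the linear forms occurring in `gauss_mul_gauss` change the orthonormal frame `(C_{1⊥2}, C₂)`
into `(C₁, C_{2⊥1})`. This lemma gives the first coordinate, `rotate_snd` the second. -/
lemma rotate_fst {A₁ A₂ c : ℝ} (h1 : 0 < A₁) (h2 : 0 < A₂) (hΔ : 0 < A₁ * A₂ - c ^ 2) (x y : ℝ) :
    ((x - c / A₂ * y) / √((A₁ * A₂ - c ^ 2) / A₂) + c / √(A₁ * A₂ - c ^ 2) * (y / √A₂)) /
      √(1 + (c / √(A₁ * A₂ - c ^ 2)) ^ 2) = x / √A₁ := by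
  rw [sqrt_one_add_sq_div h1 h2 hΔ, Real.sqrt_div hΔ.le]
  have p1 := Real.sqrt_pos.2 h1
  have p2 := Real.sqrt_pos.2 h2
  have p3 := Real.sqrt_pos.2 hΔ
  have e2 : A₂ = √A₂ ^ 2 := (Real.sq_sqrt h2.le).symm
  generalize √(A₁ * A₂ - c ^ 2) = d at *
  generalize √A₂ = b at *
  subst e2
  field_simp
  ring

lemma rotate_snd {A₁ A₂ c : ℝ} (h1 : 0 < A₁) (h2 : 0 < A₂) (hΔ : 0 < A₁ * A₂ - c ^ 2) (x y : ℝ) :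
    (y / √A₂ - c / √(A₁ * A₂ - c ^ 2) * ((x - c / A₂ * y) / √((A₁ * A₂ - c ^ 2) / A₂))) /
      √(1 + (c / √(A₁ * A₂ - c ^ 2)) ^ 2) = (y - c / A₁ * x) / √((A₁ * A₂ - c ^ 2) / A₁) := by
  rw [sqrt_one_add_sq_div h1 h2 hΔ, Real.sqrt_div hΔ.le, Real.sqrt_div hΔ.le]
  have p1 := Real.sqrt_pos.2 h1
  have p2 := Real.sqrt_pos.2 h2
  have p3 := Real.sqrt_pos.2 hΔ
  have e1 : A₁ = √A₁ ^ 2 := (Real.sq_sqrt h1.le).symm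
  have e2 : A₂ = √A₂ ^ 2 := (Real.sq_sqrt h2.le).symm
  have e3 := Real.sq_sqrt hΔ.le
  generalize √(A₁ * A₂ - c ^ 2) = d at *
  generalize √A₂ = b at *
  generalize √A₁ = a at *
  subst e2 e1
  field_simp
  linear_combination y * e3

lemma hasDerivAt_div_sqrt {y q : ℝ → ℝ} {y' q' t : ℝ} (hy : HasDerivAt y y' t)
    (hq : HasDerivAt q q' t) (h : 0 < q t) :
    HasDerivAt (fun t => y t / √(q t)) ((y' - q' / (2 * q t) * y t) / √(q t)) t := by
  have p := Real.sqrt_pos.2 h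
  refine (hy.div (hq.sqrt h.ne') p.ne').congr_deriv ?_
  have e := Real.sq_sqrt h.le
  field_simp
  rw [e]
  ring

/-- Variation of the double error function with the first vector, in terms of Gram entries. -/
lemma hasDerivAt_dblErf_gram {p A c : ℝ → ℝ} {p' A' c' s A₂ y : ℝ} (hp : HasDerivAt p p' s)
    (hA : HasDerivAt A A' s) (hc : HasDerivAt c c' s) (h1 : 0 < A s) (h2 : 0 < A₂)
    (hΔ : 0 < A s * A₂ - c s ^ 2) :
    HasDerivAt (fun s => dblErf (c s / √(A s * A₂ - c s ^ 2))
        ((p s - c s / A₂ * y) / √((A s * A₂ - c s ^ 2) / A₂)) (y / √A₂))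
      (2 * ((p' - A' / (2 * A s) * p s) / √(A s)) * gauss (p s / √(A s)) *
          E1 ((y - c s / A s * p s) / √((A s * A₂ - c s ^ 2) / A s)) +
        2 / Real.pi * ((c' - A' / (2 * A s) * c s) / √(A s * A₂ - c s ^ 2)) * gauss (p s / √(A s)) *
          gauss ((y - c s / A s * p s) / √((A s * A₂ - c s ^ 2) / A s))) s := by
  have hΔ' : HasDerivAt (fun s => A s * A₂ - c s ^ 2) (A' * A₂ - 2 * c s * c') s :=
    ((hA.mul_const A₂).fun_sub (hc.fun_pow 2)).congr_deriv (by simp)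
  have hα := hasDerivAt_div_sqrt hc hΔ' hΔ
  have hu := hasDerivAt_div_sqrt (hp.fun_sub ((hc.div_const A₂).mul_const y)) (hΔ'.div_const A₂)
    (div_pos hΔ h2)
  refine (hasDerivAt_dblErf_left (y / √A₂) hu hα).congr_deriv ?_
  rw [rotate_fst h1 h2 hΔ, rotate_snd h1 h2 hΔ, sqrt_one_add_sq_div h1 h2 hΔ]
  have hpi := Real.pi_ne_zero
  generalize E1 _ = E
  generalize gauss ((y - c s / A s * p s) / _) = G
  generalize gauss (p s / √(A s)) = G'
  rw [Real.sqrt_div hΔ.le, Real.sqrt_div hΔ.le]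
  have p1 := Real.sqrt_pos.2 h1
  have p2 := Real.sqrt_pos.2 h2
  have p3 := Real.sqrt_pos.2 hΔ
  have e1 := (Real.sq_sqrt h1.le).symm
  have e2 := (Real.sq_sqrt h2.le).symm
  have e3 := Real.sq_sqrt hΔ.le
  generalize √(A s * A₂ - c s ^ 2) = d at *
  generalize √A₂ = b at *
  generalize √(A s) = a at *
  generalize A s = As at *
  generalize c s = cs at *
  generalize p s = ps at *
  subst e1 e2
  -- The derivative of `c / √Δ` is a multiple of `c' - A' c / (2 A)`, which is the pairing of `C₂`
  -- with the part of the motion orthogonal to `C₁`.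
  have hα' : (c' - (A' * b ^ 2 - 2 * cs * c') / (2 * (a ^ 2 * b ^ 2 - cs ^ 2)) * cs) =
      (c' - A' / (2 * a ^ 2) * cs) * (a ^ 2 * b ^ 2) / d ^ 2 := by
    rw [← e3]; field_simp; linear_combination 2 * c' * e3
  rw [hα', ← e3]
  field_simp
  linear_combination G' * E * Real.pi * (b ^ 2 * A' * ps - 2 * a ^ 2 * c' * y) * e3

section Boost

variable {V : Type*} [AddCommGroup V] [Module ℝ V] {B : LinearMap.BilinForm ℝ V}

lemma gramDet_two (hB : B.IsSymm) (C₁ C₂ : V) :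
    gramDet B ![C₁, C₂] = B C₁ C₁ * B C₂ C₂ - B C₁ C₂ ^ 2 := by
  simp [gramDet, Matrix.det_fin_two, hB.eq C₂ C₁]
  ring

lemma perp_apply_left (C D x : V) : B (perp B C D) x = B C x - B C D / B D D * B D x := by
  simp [perp]

lemma perp_apply_right (C D x : V) : B x (perp B C D) = B x C - B C D / B D D * B x D := by
  simp [perp]

lemma perp_apply_self (hB : B.IsSymm) (C : V) {D : V} (hD : B D D ≠ 0) : B D (perp B C D) = 0 := by
  rw [perp_apply_right, hB.eq D C]
  field_simp
  ring

lemma perp_sq (hB : B.IsSymm) (C : V) {D : V} (hD : B D D ≠ 0) :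
    B (perp B C D) (perp B C D) = (B C C * B D D - B C D ^ 2) / B D D := by
  rw [perp_apply_left, perp_apply_self hB C hD, perp_apply_right]
  field_simp
  ring

lemma perp_add_smul (C C' D : V) (t : ℝ) :
    perp B (C + t • C') D = perp B C D + t • perp B C' D := by
  simp only [perp, map_add, map_smul, LinearMap.add_apply, LinearMap.smul_apply, smul_eq_mul,
    add_div, add_smul, smul_sub, smul_smul, mul_div_assoc]
  abel

/-- `C₁, C₂` span a positive definite plane. -/
structure PosPair (B : LinearMap.BilinForm ℝ V) (C₁ C₂ : V) : Prop where
  fst : 0 < B C₁ C₁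
  snd : 0 < B C₂ C₂
  gram : 0 < B C₁ C₁ * B C₂ C₂ - B C₁ C₂ ^ 2

lemma PosPair.symm (hB : B.IsSymm) {C₁ C₂ : V} (h : PosPair B C₁ C₂) : PosPair B C₂ C₁ :=
  ⟨h.snd, h.fst, by rw [hB.eq C₂ C₁, mul_comm]; exact h.gram⟩

lemma PosPair.perp_pos (hB : B.IsSymm) {C₁ C₂ : V} (h : PosPair B C₁ C₂) :
    0 < B (perp B C₂ C₁) (perp B C₂ C₁) := by
  rw [perp_sq hB _ h.fst.ne', hB.eq C₂ C₁, mul_comm]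
  exact div_pos h.gram h.fst

/-- The boosted double error function as a real number. -/
def e2Boost (B : LinearMap.BilinForm ℝ V) (C₁ C₂ x : V) : ℝ :=
  dblErf (B C₁ C₂ / √(gramDet B ![C₁, C₂])) (unitForm B (perp B C₁ C₂) x) (unitForm B C₂ x)

lemma E2Boost_eq (C₁ C₂ x : V) : E2Boost B C₁ C₂ x = (e2Boost B C₁ C₂ x : ℂ) := E2_eq _ _ _

lemma e2Boost_eq (hB : B.IsSymm) (C₁ : V) {C₂ : V} (h2 : 0 < B C₂ C₂) (x : V) :
    e2Boost B C₁ C₂ x = dblErf (B C₁ C₂ / √(B C₁ C₁ * B C₂ C₂ - B C₁ C₂ ^ 2))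
      ((B C₁ x - B C₁ C₂ / B C₂ C₂ * B C₂ x) / √((B C₁ C₁ * B C₂ C₂ - B C₁ C₂ ^ 2) / B C₂ C₂))
      (B C₂ x / √(B C₂ C₂)) := by
  rw [e2Boost, gramDet_two hB, unitForm, unitForm, perp_sq hB _ h2.ne', perp_apply_left]

/-- The derivative of `E₂(C₁, C₂; x)` as `C₁` moves in the direction `D`. -/
def e2BoostDeriv (B : LinearMap.BilinForm ℝ V) (C₁ C₂ D x : V) : ℝ :=
  2 * (B (perp B D C₁) x / √(B C₁ C₁)) * gauss (unitForm B C₁ x) * E1Boost B (perp B C₂ C₁) x +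
    2 / Real.pi * (unitForm B (perp B C₂ C₁) (perp B D C₁) / √(B C₁ C₁)) * gauss (unitForm B C₁ x) *
      gauss (unitForm B (perp B C₂ C₁) x)

/-- The mixed second derivative of `E₂(C₁, C₂; x)` as `C₁`, `C₂` move in the directions
`D`, `D'`: a Gaussian times a quadratic polynomial. -/
def mixedKernel (B : LinearMap.BilinForm ℝ V) (C₁ C₂ D D' x : V) : ℝ :=
  let e := perp B C₂ C₁
  let v := perp B (perp B D C₁) e
  let v' := perp B (perp B D' C₁) e
  4 / (√(B C₁ C₁) * √(B e e)) * gauss (unitForm B C₁ x) * gauss (unitForm B e x) *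
    (B v x * B v' x + B v v' / (2 * Real.pi))

lemma hasDerivAt_bilin_line (C D x : V) (s : ℝ) :
    HasDerivAt (fun s : ℝ => B (C + s • D) x) (B D x) s := by
  have : (fun s : ℝ => B (C + s • D) x) = fun s => B C x + s * B D x := by ext; simp
  rw [this]
  exact ((hasDerivAt_id s).mul_const (B D x)).const_add (B C x) |>.congr_deriv (by simp)

lemma hasDerivAt_bilin_line_self (hB : B.IsSymm) (C D : V) (s : ℝ) :
    HasDerivAt (fun s : ℝ => B (C + s • D) (C + s • D)) (2 * B D (C + s • D)) s := by
  have : (fun s : ℝ => B (C + s • D) (C + s • D)) =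
      fun s => B C C + s * (2 * B D C) + s ^ 2 * B D D := by
    ext s
    simp [hB.eq C D]
    ring
  rw [this]
  refine ((((hasDerivAt_id s).mul_const (2 * B D C)).const_add (B C C)).add
    ((hasDerivAt_pow 2 s).mul_const (B D D))).congr_deriv ?_
  simp
  ring

lemma hasDerivAt_e2Boost (hB : B.IsSymm) {C₁ C₂ D : V} (x : V) {s : ℝ}
    (h : PosPair B (C₁ + s • D) C₂) :
    HasDerivAt (fun s : ℝ => e2Boost B (C₁ + s • D) C₂ x) (e2BoostDeriv B (C₁ + s • D) C₂ D x) s := by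
  have h0 := hasDerivAt_dblErf_gram (y := B C₂ x) (hasDerivAt_bilin_line (B := B) C₁ D x s)
    (hasDerivAt_bilin_line_self hB C₁ D s) (hasDerivAt_bilin_line C₁ D C₂ s) h.fst h.snd h.gram
  have e : (fun s : ℝ => e2Boost B (C₁ + s • D) C₂ x) = _ :=
    funext fun s => e2Boost_eq hB (C₁ + s • D) h.snd x
  rw [e]
  refine h0.congr_deriv ?_
  generalize C₁ + s • D = C at *
  have hA := h.fst
  have hsq : B (perp B C₂ C) (perp B C₂ C) = (B C C * B C₂ C₂ - B C C₂ ^ 2) / B C C := by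
    rw [perp_sq hB _ hA.ne', hB.eq C₂ C, mul_comm]
  have hr : √(B C C * B C₂ C₂ - B C C₂ ^ 2) =
      √((B C C * B C₂ C₂ - B C C₂ ^ 2) / B C C) * √(B C C) := by
    rw [← Real.sqrt_mul (div_pos h.gram hA).le, div_mul_cancel₀ _ hA.ne']
  have e1 : B (perp B D C) x = B D x - 2 * B D C / (2 * B C C) * B C x := by
    rw [perp_apply_left]; field_simp
  have e2 : B (perp B C₂ C) (perp B D C) = B D C₂ - 2 * B D C / (2 * B C C) * B C C₂ := by
    rw [perp_apply_left, perp_apply_self hB _ hA.ne', perp_apply_right, hB.eq C₂ D, hB.eq C₂ C]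
    field_simp
    ring
  rw [e2BoostDeriv, E1Boost, unitForm, unitForm, unitForm, hsq, e1, e2, hr, perp_apply_left,
    hB.eq C₂ C]
  rw [div_div]

/-- The second vector enters only through its component orthogonal to `C₁`, which also moves on a
straight line. The remaining error function is differentiated into a Gaussian, so every term carries
the same product of two Gaussians. -/
lemma hasDerivAt_e2BoostDeriv (hB : B.IsSymm) {C₁ C₂ D D' : V} (x : V) {t : ℝ}
    (h : PosPair B C₁ (C₂ + t • D')) :
    HasDerivAt (fun t : ℝ => e2BoostDeriv B C₁ (C₂ + t • D') D x)
      (mixedKernel B C₁ (C₂ + t • D') D D' x) t := by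
  have hA := h.fst
  have hp := h.perp_pos hB
  simp only [e2BoostDeriv, E1Boost, unitForm, mixedKernel, perp_add_smul] at *
  set v := perp B D C₁
  set w := perp B D' C₁
  set e₀ := perp B C₂ C₁
  have d1 := hasDerivAt_div_sqrt (hasDerivAt_bilin_line (B := B) e₀ w x t)
    (hasDerivAt_bilin_line_self hB e₀ w t) hp
  have d2 := hasDerivAt_div_sqrt (hasDerivAt_bilin_line (B := B) e₀ w v t)
    (hasDerivAt_bilin_line_self hB e₀ w t) hp
  have d3 := (hasDerivAt_E1 _).comp t d1
  have d4 := (hasDerivAt_gauss _).comp t d1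
  refine ((d3.const_mul (2 * (B v x / √(B C₁ C₁)) * gauss (B C₁ x / √(B C₁ C₁)))).add
    ((((d2.div_const (√(B C₁ C₁))).const_mul (2 / Real.pi)).mul_const
      (gauss (B C₁ x / √(B C₁ C₁)))).mul d4)).congr_deriv ?_
  generalize gauss (B C₁ x / √(B C₁ C₁)) = g₁
  have pA := Real.sqrt_pos.2 hA
  have pE := Real.sqrt_pos.2 hp
  have eE := Real.sq_sqrt hp.le
  have hpi := Real.pi_ne_zero
  simp only [Function.comp, perp_apply_left, perp_apply_right]
  generalize e₀ + t • w = e at *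
  generalize gauss (B e x / √(B e e)) = g₂
  rw [hB.eq e w, hB.eq e v, hB.eq w v]
  generalize B e x = ex
  generalize B v x = vx
  generalize B w x = wx
  generalize B w e = we
  generalize B v e = ve
  generalize B v w = vw
  generalize B e e = E at *
  generalize √(B C₁ C₁) = a at *
  generalize √E = r at *
  subst eE
  field_simp
  ring

end Boost

end IndefTheta

end

noncomputable section

namespace IndefTheta

open MeasureTheory Filter Topology Set

/-! ### Signature `(2, n - 2)` and positive planes -/

section Signature

variable {V : Type*} [AddCommGroup V] [Module ℝ V] {B : LinearMap.BilinForm ℝ V}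

/-- The form is nondegenerate with exactly two positive directions: no vector orthogonal to a
positive plane has nonnegative square. -/
def HasTwoPositive (B : LinearMap.BilinForm ℝ V) : Prop :=
  ∀ ⦃C₁ C₂ x : V⦄, PosPair B C₁ C₂ → B C₁ x = 0 → B C₂ x = 0 → x ≠ 0 → B x x < 0

/-- The two signature indices already add up to the dimension, which leaves no room for a radical.
-/
lemma eq_zero_of_sig [FiniteDimensional ℝ V] (hB : B.IsSymm)
    (hpos : sigPos (LinearMap.BilinMap.toQuadraticMap B) = 2)
    (hneg : sigNeg (LinearMap.BilinMap.toQuadraticMap B) + 2 = Module.finrank ℝ V) {x : V}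
    (hx : ∀ y, B x y = 0) : x = 0 := by
  have h := QuadraticForm.sigPos_add_sigNeg_add_radical (Q := LinearMap.BilinMap.toQuadraticMap B)
  have h0 : Module.finrank ℝ (LinearMap.BilinMap.toQuadraticMap B).radical = 0 := by omega
  rw [Submodule.finrank_eq_zero] at h0
  have : x ∈ (LinearMap.BilinMap.toQuadraticMap B).radical := by
    rw [QuadraticMap.mem_radical_iff']
    refine ⟨by simp [hx], fun y => ?_⟩
    simp [hx, hB.eq y x]
  rwa [h0, Submodule.mem_bot] at this

/-- Otherwise `C₁`, the component of `C₂` orthogonal to it, and `x` would be an orthogonal basis of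
a three-dimensional positive definite subspace. -/
lemma not_three_positive [FiniteDimensional ℝ V] (hB : B.IsSymm)
    (hpos : sigPos (LinearMap.BilinMap.toQuadraticMap B) = 2) {C₁ C₂ x : V}
    (h : PosPair B C₁ C₂) (h1 : B C₁ x = 0) (h2 : B C₂ x = 0) : B x x ≤ 0 := by
  by_contra! hx
  set e := perp B C₂ C₁ with he
  have he0 : 0 < B e e := h.perp_pos hB
  have h1e : B C₁ e = 0 := perp_apply_self hB C₂ h.fst.ne'
  have hex : B e x = 0 := by rw [he, perp_apply_left, h1, h2]; ring
  let f : (Fin 3 → ℝ) →ₗ[ℝ] V := Fintype.linearCombination ℝ ![C₁, e, x]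
  have hf : ∀ a, f a = a 0 • C₁ + a 1 • e + a 2 • x := fun a => by
    simp [f, Fintype.linearCombination_apply, Fin.sum_univ_three]
  have hQ : ∀ a, B (f a) (f a) = a 0 ^ 2 * B C₁ C₁ + a 1 ^ 2 * B e e + a 2 ^ 2 * B x x := fun a => by
    rw [hf]
    simp [h1e, hex, h1, hB.eq e C₁, hB.eq x C₁, hB.eq x e]
    ring
  have hpos' : ∀ a, a ≠ 0 → 0 < B (f a) (f a) := fun a ha => by
    rw [hQ]
    have hA := h.fst
    obtain ⟨i, hi⟩ := Function.ne_iff.1 ha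
    have hi2 : 0 < a i ^ 2 := by have : a i ≠ 0 := hi; positivity
    fin_cases i
    · have := mul_pos hi2 hA; simp at this; positivity
    · have := mul_pos hi2 he0; simp at this; positivity
    · have := mul_pos hi2 hx; simp at this; positivity
  have hinj : Function.Injective f := by
    rw [← LinearMap.ker_eq_bot, LinearMap.ker_eq_bot']
    intro a ha
    by_contra hne
    have := hpos' a hne
    simp [ha] at this
  have hdim : Module.finrank ℝ (LinearMap.range f) = 3 := by
    rw [LinearMap.finrank_range_of_inj hinj]; simp
  have hpd : ((LinearMap.BilinMap.toQuadraticMap B).restrict (LinearMap.range f)).PosDef := by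
    rintro ⟨y, a, rfl⟩ hy
    refine hpos' a ?_
    rintro rfl
    exact hy (by simp)
  have := le_sigPos_of_posDef _ hpd
  omega

lemma hasTwoPositive_of_sig [FiniteDimensional ℝ V] (hB : B.IsSymm)
    (hpos : sigPos (LinearMap.BilinMap.toQuadraticMap B) = 2)
    (hneg : sigNeg (LinearMap.BilinMap.toQuadraticMap B) + 2 = Module.finrank ℝ V) :
    HasTwoPositive B := by
  intro C₁ C₂ x h h1 h2 hx
  refine lt_of_le_of_ne (not_three_positive hB hpos h h1 h2) fun h0 => hx ?_
  refine eq_zero_of_sig hB hpos hneg fun y => ?_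
  -- for `y` orthogonal to the plane, `Q (y + r x) ≤ 0` for all `r` forces `B x y = 0`
  set e := perp B C₂ C₁ with he
  have he0 : 0 < B e e := h.perp_pos hB
  have h1e : B C₁ e = 0 := perp_apply_self hB C₂ h.fst.ne'
  have hex : B e x = 0 := by rw [he, perp_apply_left, h1, h2]; ring
  set w := perp B (perp B y C₁) e with hw
  have w1 : B C₁ w = 0 := by
    rw [hw, perp_apply_right, h1e, perp_apply_self hB y h.fst.ne']; ring
  have we : B e w = 0 := perp_apply_self hB _ he0.ne'
  have w2 : B C₂ w = 0 := by
    have : B e w = B C₂ w - B C₂ C₁ / B C₁ C₁ * B C₁ w := by rw [he, perp_apply_left]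
    rw [we, w1] at this
    linarith
  have hxw : B x w = B x y := by
    rw [hw, perp_apply_right, perp_apply_right, hB.eq x e, hex, hB.eq x C₁, h1]; ring
  have key : ∀ r : ℝ, B w w + 2 * r * B x w ≤ 0 := fun r => by
    have := not_three_positive hB hpos h (x := w + r • x) (by simp [w1, h1]) (by simp [w2, h2])
    have e1 : B (w + r • x) (w + r • x) = B w w + 2 * r * B x w := by
      simp [h0, hB.eq w x]; ring
    linarith
  rw [← hxw]
  by_contra hne
  -- This value of `r` makes the nonpositive affine function equal to `1`.
  have := key ((1 - B w w) / (2 * B x w))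
  have e1 : 2 * ((1 - B w w) / (2 * B x w)) * B x w = 1 - B w w := by field_simp
  linarith

/-- The square of a vector in terms of its components along a positive plane. -/
lemma sq_eq_add_perp_sq (hB : B.IsSymm) {C₁ C₂ : V} (h : PosPair B C₁ C₂) (x : V) :
    B x x = unitForm B C₁ x ^ 2 + unitForm B (perp B C₂ C₁) x ^ 2 +
      B (perp B (perp B x C₁) (perp B C₂ C₁)) (perp B (perp B x C₁) (perp B C₂ C₁)) := by
  have he0 := h.perp_pos hB
  have h1e : B C₁ (perp B C₂ C₁) = 0 := perp_apply_self hB C₂ h.fst.ne'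
  set e := perp B C₂ C₁
  have hA := h.fst
  rw [perp_sq hB _ he0.ne', perp_sq hB _ hA.ne', perp_apply_left x, h1e, unitForm, unitForm, div_pow,
    div_pow, Real.sq_sqrt he0.le, Real.sq_sqrt hA.le, hB.eq x e, hB.eq x C₁]
  field_simp
  ring

lemma perp_perp_fst (hB : B.IsSymm) {C₁ C₂ : V} (h : PosPair B C₁ C₂) (x : V) :
    B C₁ (perp B (perp B x C₁) (perp B C₂ C₁)) = 0 := by
  rw [perp_apply_right, perp_apply_self hB x h.fst.ne', perp_apply_self hB _ h.fst.ne']; ring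

lemma perp_perp_snd (hB : B.IsSymm) {C₁ C₂ : V} (h : PosPair B C₁ C₂) (x : V) :
    B C₂ (perp B (perp B x C₁) (perp B C₂ C₁)) = 0 := by
  have h1 := perp_perp_fst hB h x
  have h2 : B (perp B C₂ C₁) (perp B (perp B x C₁) (perp B C₂ C₁)) = 0 :=
    perp_apply_self hB _ (h.perp_pos hB).ne'
  rw [perp_apply_left, h1] at h2
  linarith

/-- The majorant of `-Q` attached to a positive plane is positive definite. -/
lemma majorant_pos (hB : B.IsSymm) (hsig : HasTwoPositive B) {C₁ C₂ : V} (h : PosPair B C₁ C₂)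
    {x : V} (hx : x ≠ 0) :
    0 < 2 * (unitForm B C₁ x ^ 2 + unitForm B (perp B C₂ C₁) x ^ 2) - B x x := by
  have hsq := sq_eq_add_perp_sq hB h x
  set y := perp B (perp B x C₁) (perp B C₂ C₁) with hy
  by_cases hy0 : y = 0
  · rw [hy0] at hsq
    simp only [map_zero, add_zero] at hsq
    rw [hsq]
    have hne : unitForm B C₁ x ≠ 0 ∨ unitForm B (perp B C₂ C₁) x ≠ 0 := by
      by_contra! hc
      obtain ⟨c1, c2⟩ := hc
      have hA := (Real.sqrt_pos.2 h.fst).ne'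
      have hE := (Real.sqrt_pos.2 (h.perp_pos hB)).ne'
      rw [unitForm, div_eq_zero_iff, or_iff_left hA] at c1
      rw [unitForm, div_eq_zero_iff, or_iff_left hE] at c2
      have : perp B x C₁ = x := by simp [perp, hB.eq x C₁, c1]
      rw [this] at hy
      rw [perp, hB.eq x, c2, hy0] at hy
      simp at hy
      exact hx hy.symm
    rcases hne with hne | hne
    · have : 0 < unitForm B C₁ x ^ 2 := by positivity
      nlinarith [sq_nonneg (unitForm B (perp B C₂ C₁) x)]
    · have : 0 < unitForm B (perp B C₂ C₁) x ^ 2 := by positivity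
      nlinarith [sq_nonneg (unitForm B C₁ x)]
  · have := hsig h (perp_perp_fst hB h x) (perp_perp_snd hB h x) hy0
    rw [← hy] at this
    nlinarith [sq_nonneg (unitForm B C₁ x), sq_nonneg (unitForm B (perp B C₂ C₁) x)]

/-! ### Consequences of the convergence conditions -/

lemma gramMatrix_mulVec {ι : Type*} [Fintype ι] (C : ι → V) (c : ι → ℝ) (i : ι) :
    ((Matrix.of fun i j => B (C i) (C j)).mulVec c) i = B (C i) (∑ j, c j • C j) := by
  simp [Matrix.mulVec, dotProduct, mul_comm]

/-- Under the convergence conditions `Q` is negative on the cone where the sign functions of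
both pairs of vectors may differ. -/
lemma ConvergenceConditions.neg (hB : B.IsSymm) (hsig : HasTwoPositive B) {C₁ C₁' C₂ C₂' : V}
    (hc : ConvergenceConditions B C₁ C₁' C₂ C₂') (h12 : PosPair B C₁ C₂) {x : V} (hx : x ≠ 0)
    (h1 : B C₁ x * B C₁' x ≤ 0) (h2 : B C₂ x * B C₂' x ≤ 0) : B x x < 0 := by
  set C : Fin 4 → V := ![C₁, C₁', C₂, C₂'] with hC
  set G : Matrix (Fin 4) (Fin 4) ℝ := Matrix.of fun i j => B (C i) (C j) with hG
  have hdet : 0 < G.det := hc.gram_pos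
  have hGs : G.transpose = G := by ext i j; simp [hG, hB.eq (C i) (C j)]
  have hadjs : ∀ i j, G.adjugate i j = G.adjugate j i := fun i j => by
    have := congrFun (congrFun (Matrix.adjugate_transpose G) i) j
    rw [hGs] at this
    exact this.symm
  set ξ : Fin 4 → ℝ := fun i => B (C i) x with hξ
  -- By Cramer's rule these are the coefficients of the orthogonal projection `y` of `x` to the span
  -- of the four vectors.
  set c : Fin 4 → ℝ := G.det⁻¹ • G.adjugate.mulVec ξ with hcdef
  have hGc : G.mulVec c = ξ := by
    rw [hcdef, Matrix.mulVec_smul, Matrix.mulVec_mulVec, Matrix.mul_adjugate, Matrix.smul_mulVec,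
      Matrix.one_mulVec, smul_smul, inv_mul_cancel₀ hdet.ne', one_smul]
  set y := ∑ j, c j • C j with hy
  have hyC : ∀ i, B (C i) y = ξ i := fun i => by
    rw [hy, ← gramMatrix_mulVec, ← hG, hGc]
  have hxy : ∀ i, B (C i) (x - y) = 0 := fun i => by rw [map_sub, hyC]; simp [hξ]
  have hyz : B y (x - y) = 0 := by
    rw [hy, map_sum, LinearMap.sum_apply]
    exact Finset.sum_eq_zero fun i _ => by rw [map_smul, LinearMap.smul_apply, ← hy, hxy, smul_zero]
  have hQ : B x x = B y y + B (x - y) (x - y) := by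
    have e1 : B x x = B (y + (x - y)) (y + (x - y)) := by simp
    rw [e1, map_add, map_add, LinearMap.add_apply, LinearMap.add_apply, hyz, hB.eq (x - y) y, hyz]
    ring
  have hQy : G.det * B y y = ∑ i, ∑ j, ξ i * G.adjugate i j * ξ j := by
    have : B y y = ∑ i, c i * ξ i := by
      conv_lhs => rw [hy, map_sum]
      refine Finset.sum_congr rfl fun i _ => ?_
      rw [map_smul, ← hy, hB.eq y, hyC, smul_eq_mul]
    rw [this, Finset.mul_sum]
    refine Finset.sum_congr rfl fun i _ => ?_
    rw [hcdef, Pi.smul_apply, smul_eq_mul, ← mul_assoc, ← mul_assoc, mul_inv_cancel₀ hdet.ne',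
      one_mul, Matrix.mulVec, dotProduct, Finset.sum_mul]
    exact Finset.sum_congr rfl fun j _ => by ring
  -- `matM` is the cofactor matrix with the entries `D_{11'}` and `D_{22'}` deleted. These reappear
  -- with the products `ξ₀ ξ₁` and `ξ₂ ξ₃`, whose signs are the assumptions on `x`.
  have hM : G.det * B y y = ξ ⬝ᵥ (matM B C₁ C₁' C₂ C₂').mulVec ξ +
      2 * (gramCofactor B C₁ C₁' C₂ C₂' 0 1 * (ξ 0 * ξ 1)) +
      2 * (gramCofactor B C₁ C₁' C₂ C₂' 2 3 * (ξ 2 * ξ 3)) := by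
    have hcof : ∀ i j, gramCofactor B C₁ C₁' C₂ C₂' i j = G.adjugate i j := fun i j => rfl
    have d0 : gramDet B ![C₁', C₂, C₂'] = G.adjugate 0 0 := by
      rw [Matrix.adjugate_fin_succ_eq_det_submatrix, gramDet]
      simp only [Fin.val_zero, add_zero, pow_zero, one_mul]
      congr 1
    have d1 : gramDet B ![C₁, C₂, C₂'] = G.adjugate 1 1 := by
      rw [Matrix.adjugate_fin_succ_eq_det_submatrix, gramDet]
      simp only [Fin.val_one, Even.neg_pow (show Even (1 + 1) by decide), one_pow, one_mul]
      congr 1; ext i j; fin_cases i <;> fin_cases j <;> rfl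
    have d2 : gramDet B ![C₁, C₁', C₂'] = G.adjugate 2 2 := by
      rw [Matrix.adjugate_fin_succ_eq_det_submatrix, gramDet]
      simp only [Fin.val_two, Even.neg_pow (show Even (2 + 2) by decide), one_pow, one_mul]
      congr 1; ext i j; fin_cases i <;> fin_cases j <;> rfl
    have d3 : gramDet B ![C₁, C₁', C₂] = G.adjugate 3 3 := by
      rw [Matrix.adjugate_fin_succ_eq_det_submatrix, gramDet]
      simp only [show ((3 : Fin 4) : ℕ) = 3 from rfl, Even.neg_pow (show Even (3 + 3) by decide),
        one_pow, one_mul]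
      congr 1; ext i j; fin_cases i <;> fin_cases j <;> rfl
    rw [hQy]
    simp only [matM, hcof, d0, d1, d2, d3, Fin.sum_univ_four, Matrix.mulVec, dotProduct]
    rw [hadjs 1 0, hadjs 2 0, hadjs 3 0, hadjs 2 1, hadjs 3 1, hadjs 3 2]
    simp
    ring
  have hcof := hc.cofactor_nonneg
  have p1 : gramCofactor B C₁ C₁' C₂ C₂' 0 1 * (ξ 0 * ξ 1) ≤ 0 :=
    mul_nonpos_of_nonneg_of_nonpos hcof.1 h1
  have p2 : gramCofactor B C₁ C₁' C₂ C₂' 2 3 * (ξ 2 * ξ 3) ≤ 0 :=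
    mul_nonpos_of_nonneg_of_nonpos hcof.2 h2
  have hz : x - y ≠ 0 → B (x - y) (x - y) < 0 := fun h => hsig h12 (hxy 0) (hxy 2) h
  -- If all four pairings vanish, the projection is zero and negativity comes from the signature
  -- alone, `x` being orthogonal to the positive plane of `C₁, C₂`.
  by_cases hξ0 : ξ = 0
  · have hy0 : y = 0 := by rw [hy, hcdef, hξ0]; simp
    have := hz (by rwa [hy0, sub_zero])
    rw [hQ, hy0] at *
    simpa using this
  · have hMneg : ξ ⬝ᵥ (matM B C₁ C₁' C₂ C₂').mulVec ξ < 0 := by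
      have := hc.matM_negDef.dotProduct_mulVec_pos hξ0
      simpa [Matrix.neg_mulVec] using this
    have hyneg : B y y < 0 := by
      by_contra! hcon
      have := mul_nonneg hdet.le hcon
      linarith
    by_cases h0 : x - y = 0
    · rw [hQ, h0]; simpa using hyneg
    · have := hz h0
      linarith

/-- A vector in the kernel of a singular Gram matrix gives an isotropic `z` orthogonal to convex
combinations of `C₁, C₁'` and of `C₂, C₂'`. Its pairings with the members of each pair cannot have
the same strict sign, so `ConvergenceConditions.neg` forces `B z z < 0`, a contradiction. A Gram
determinant that never vanishes keeps its sign from the corner `(C₁, C₂)`. -/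
lemma ConvergenceConditions.posPair (hB : B.IsSymm) (hsig : HasTwoPositive B) {C₁ C₁' C₂ C₂' : V}
    (hc : ConvergenceConditions B C₁ C₁' C₂ C₂') (h12 : PosPair B C₁ C₂) {s t : ℝ}
    (hs : s ∈ Icc (0 : ℝ) 1) (ht : t ∈ Icc (0 : ℝ) 1) :
    PosPair B (C₁ + s • (C₁' - C₁)) (C₂ + t • (C₂' - C₂)) := by
  -- the Gram matrix of the moving pair is nonsingular
  have hne : ∀ s ∈ Icc (0 : ℝ) 1, ∀ t ∈ Icc (0 : ℝ) 1,
      B (C₁ + s • (C₁' - C₁)) (C₁ + s • (C₁' - C₁)) * B (C₂ + t • (C₂' - C₂)) (C₂ + t • (C₂' - C₂)) -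
        B (C₁ + s • (C₁' - C₁)) (C₂ + t • (C₂' - C₂)) ^ 2 ≠ 0 := by
    intro s hs t ht h0
    set X := C₁ + s • (C₁' - C₁) with hX
    set Y := C₂ + t • (C₂' - C₂) with hY
    have hdet : (!![B X X, B X Y; B X Y, B Y Y]).det = 0 := by
      rw [Matrix.det_fin_two_of, ← h0]; ring
    obtain ⟨a, ha, ha0⟩ := Matrix.exists_mulVec_eq_zero_iff.2 hdet
    set z := a 0 • X + a 1 • Y with hz
    have z1 : B X z = 0 := by
      have := congrFun ha0 0
      simp [Matrix.mulVec, dotProduct, Fin.sum_univ_two] at this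
      rw [hz]; simp; linarith
    have z2 : B Y z = 0 := by
      have := congrFun ha0 1
      simp [Matrix.mulVec, dotProduct, Fin.sum_univ_two] at this
      rw [hz]; simp [hB.eq Y X]; linarith
    have hzz : B z z = 0 := by
      rw [hz, map_add, map_smul, map_smul, ← hz, hB.eq z X, hB.eq z Y, z1, z2]
      simp
    have hzne : z ≠ 0 := by
      -- The four vectors are linearly independent because their Gram determinant is nonzero, so the
      -- coefficients of `z` in them would all vanish, and with them `a 0` and `a 1`.
      intro hz0
      have hG : (Matrix.of fun i j => B (![C₁, C₁', C₂, C₂'] i) (![C₁, C₁', C₂, C₂'] j)).mulVec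
          ![a 0 * (1 - s), a 0 * s, a 1 * (1 - t), a 1 * t] = 0 := by
        ext i
        rw [gramMatrix_mulVec]
        have : ∑ j, (![a 0 * (1 - s), a 0 * s, a 1 * (1 - t), a 1 * t] j) •
            ![C₁, C₁', C₂, C₂'] j = z := by
          rw [Fin.sum_univ_four, hz, hX, hY]
          simp
          module
        rw [this, hz0]; simp
      have := Matrix.eq_zero_of_mulVec_eq_zero hc.gram_pos.ne' hG
      have q0 : a 0 * (1 - s) = 0 := congrFun this 0
      have q1 : a 0 * s = 0 := congrFun this 1
      have q2 : a 1 * (1 - t) = 0 := congrFun this 2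
      have q3 : a 1 * t = 0 := congrFun this 3
      refine ha (funext fun i => ?_)
      fin_cases i
      · simp; linarith
      · simp; linarith
    have o1 : (1 - s) * B C₁ z + s * B C₁' z = 0 := by
      rw [← z1, hX]; simp; ring
    have o2 : (1 - t) * B C₂ z + t * B C₂' z = 0 := by
      rw [← z2, hY]; simp; ring
    have aux : ∀ {s p q : ℝ}, s ∈ Icc (0 : ℝ) 1 → (1 - s) * p + s * q = 0 → p * q ≤ 0 := by
      intro s p q hs h
      by_contra! hpq
      have h1s : 0 ≤ 1 - s := by linarith [hs.2]
      have e1 : (1 - s) * p ^ 2 + s * (p * q) = 0 := by linear_combination p * h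
      have e2 : (1 - s) * (p * q) + s * q ^ 2 = 0 := by linear_combination q * h
      have f1 := mul_nonneg h1s (sq_nonneg p)
      have f2 := mul_nonneg hs.1 (sq_nonneg q)
      have f3 := mul_nonneg hs.1 hpq.le
      have f4 := mul_nonneg h1s hpq.le
      have : p * q = 0 := by linarith
      linarith
    have := hc.neg hB hsig h12 hzne (aux hs o1) (aux ht o2)
    linarith
  -- positivity propagates from the corner along a segment
  have hposG : ∀ s ∈ Icc (0 : ℝ) 1, ∀ t ∈ Icc (0 : ℝ) 1, 0 <
      B (C₁ + s • (C₁' - C₁)) (C₁ + s • (C₁' - C₁)) * B (C₂ + t • (C₂' - C₂)) (C₂ + t • (C₂' - C₂)) -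
        B (C₁ + s • (C₁' - C₁)) (C₂ + t • (C₂' - C₂)) ^ 2 := by
    intro s hs t ht
    by_contra! hcon
    set f : ℝ → ℝ := fun r => B (C₁ + (r * s) • (C₁' - C₁)) (C₁ + (r * s) • (C₁' - C₁)) *
      B (C₂ + (r * t) • (C₂' - C₂)) (C₂ + (r * t) • (C₂' - C₂)) -
        B (C₁ + (r * s) • (C₁' - C₁)) (C₂ + (r * t) • (C₂' - C₂)) ^ 2 with hf
    have hcont : Continuous f := by
      simp only [hf, map_add, map_smul, LinearMap.add_apply, LinearMap.smul_apply, smul_eq_mul]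
      fun_prop
    have h0 : 0 < f 0 := by simpa [hf] using h12.gram
    have h1 : f 1 ≤ 0 := by simpa [hf] using hcon
    obtain ⟨r, hr, hr0⟩ := intermediate_value_Icc' zero_le_one hcont.continuousOn ⟨h1, h0.le⟩
    refine hne (r * s) ⟨mul_nonneg hr.1 hs.1, mul_le_one₀ hr.2 hs.1 hs.2⟩ (r * t)
      ⟨mul_nonneg hr.1 ht.1, mul_le_one₀ hr.2 ht.1 ht.2⟩ hr0
  have hA : ∀ s ∈ Icc (0 : ℝ) 1, 0 < B (C₁ + s • (C₁' - C₁)) (C₁ + s • (C₁' - C₁)) := by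
    intro s hs
    -- At `t = 0` the product of the two squares exceeds a square and the factor `B C₂ C₂` is
    -- positive, so the other factor is positive too.
    have := hposG s hs 0 (by simp)
    have h2 := h12.snd
    simp only [zero_smul, add_zero] at this
    by_contra! hcon
    nlinarith [sq_nonneg (B (C₁ + s • (C₁' - C₁)) C₂)]
  have hG := hposG s hs t ht
  refine ⟨hA s hs, ?_, hG⟩
  by_contra! hcon
  nlinarith [sq_nonneg (B (C₁ + s • (C₁' - C₁)) (C₂ + t • (C₂' - C₂))), hA s hs]

end Signature

end IndefTheta

end

noncomputable section

namespace IndefTheta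

open MeasureTheory Filter Topology Set

/-! ### Continuity and Gaussian bounds -/

section Bounds

variable {V : Type*} [NormedAddCommGroup V] [NormedSpace ℝ V] [FiniteDimensional ℝ V]
  {B : LinearMap.BilinForm ℝ V}

/-- A bilinear form on a finite-dimensional space as a continuous bilinear map. -/
def bilinCLM (B : LinearMap.BilinForm ℝ V) : V →L[ℝ] V →L[ℝ] ℝ :=
  LinearMap.toContinuousLinearMap
    ((LinearMap.toContinuousLinearMap (𝕜 := ℝ) (E := V) (F' := ℝ)).toLinearMap ∘ₗ B)

lemma ContinuousOn.bilin {X : Type*} [TopologicalSpace X] {f g : X → V} {S : Set X}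
    (hf : ContinuousOn f S) (hg : ContinuousOn g S) : ContinuousOn (fun z => B (f z) (g z)) S :=
  ((bilinCLM B).continuous.comp_continuousOn hf).clm_apply hg

lemma Continuous.bilin {X : Type*} [TopologicalSpace X] {f g : X → V}
    (hf : Continuous f) (hg : Continuous g) : Continuous (fun z => B (f z) (g z)) :=
  ((bilinCLM B).continuous.comp hf).clm_apply hg

lemma exists_bilin_bound (B : LinearMap.BilinForm ℝ V) :
    ∃ M, 0 < M ∧ ∀ x y, |B x y| ≤ M * ‖x‖ * ‖y‖ :=
  ⟨‖bilinCLM B‖ + 1, by positivity, fun x y => by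
    refine ((bilinCLM B).le_opNorm₂ x y).trans ?_
    gcongr
    linarith⟩

lemma ContinuousOn.perp {X : Type*} [TopologicalSpace X] {f g : X → V} {S : Set X}
    (hf : ContinuousOn f S) (hg : ContinuousOn g S) (h : ∀ z ∈ S, B (g z) (g z) ≠ 0) :
    ContinuousOn (fun z => perp B (f z) (g z)) S :=
  hf.sub (((hf.bilin hg).div (hg.bilin hg) h).smul hg)

lemma ContinuousOn.unitForm {X : Type*} [TopologicalSpace X] {f g : X → V} {S : Set X}
    (hf : ContinuousOn f S) (hg : ContinuousOn g S) (h : ∀ z ∈ S, 0 < B (f z) (f z)) :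
    ContinuousOn (fun z => unitForm B (f z) (g z)) S :=
  (hf.bilin hg).div (hf.bilin hf).sqrt fun z hz => (Real.sqrt_pos.2 (h z hz)).ne'

section Family

variable {X : Type*} [TopologicalSpace X] {f₁ f₂ g : X → V} {S : Set X}

lemma continuousOn_perp_pair (h₁ : ContinuousOn f₁ S) (h₂ : ContinuousOn f₂ S)
    (h : ∀ z ∈ S, PosPair B (f₁ z) (f₂ z)) : ContinuousOn (fun z => perp B (f₂ z) (f₁ z)) S :=
  h₂.perp h₁ fun z hz => (h z hz).fst.ne'

lemma continuousOn_perp_perp (hB : B.IsSymm) (h₁ : ContinuousOn f₁ S) (h₂ : ContinuousOn f₂ S)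
    (h : ∀ z ∈ S, PosPair B (f₁ z) (f₂ z)) (D : V) :
    ContinuousOn (fun z => perp B (perp B D (f₁ z)) (perp B (f₂ z) (f₁ z))) S :=
  (continuousOn_const.perp h₁ fun z hz => (h z hz).fst.ne').perp (continuousOn_perp_pair h₁ h₂ h)
    fun z hz => ((h z hz).perp_pos hB).ne'

lemma continuousOn_e2BoostDeriv (hB : B.IsSymm) (h₁ : ContinuousOn f₁ S) (h₂ : ContinuousOn f₂ S)
    (hg : ContinuousOn g S) (h : ∀ z ∈ S, PosPair B (f₁ z) (f₂ z)) (D : V) :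
    ContinuousOn (fun z => e2BoostDeriv B (f₁ z) (f₂ z) D (g z)) S := by
  have hD : ContinuousOn (fun z => perp B D (f₁ z)) S :=
    continuousOn_const.perp h₁ fun z hz => (h z hz).fst.ne'
  have hA : ContinuousOn (fun z => √(B (f₁ z) (f₁ z))) S := (h₁.bilin h₁).sqrt
  have hA0 : ∀ z ∈ S, √(B (f₁ z) (f₁ z)) ≠ 0 := fun z hz => (Real.sqrt_pos.2 (h z hz).fst).ne'
  have he := continuousOn_perp_pair h₁ h₂ h
  have hu := h₁.unitForm hg fun z hz => (h z hz).fst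
  have hue := he.unitForm hg fun z hz => (h z hz).perp_pos hB
  have huD := he.unitForm hD fun z hz => (h z hz).perp_pos hB
  have gu := continuous_gauss.comp_continuousOn hu
  have gue := continuous_gauss.comp_continuousOn hue
  have eu := continuous_E1.comp_continuousOn hue
  unfold e2BoostDeriv E1Boost
  exact (((continuousOn_const.mul ((hD.bilin hg).div hA hA0)).mul gu).mul eu).add
    (((continuousOn_const.mul (huD.div hA hA0)).mul gu).mul gue)

lemma continuousOn_mixedKernel (hB : B.IsSymm) (h₁ : ContinuousOn f₁ S) (h₂ : ContinuousOn f₂ S)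
    (hg : ContinuousOn g S) (h : ∀ z ∈ S, PosPair B (f₁ z) (f₂ z)) (D D' : V) :
    ContinuousOn (fun z => mixedKernel B (f₁ z) (f₂ z) D D' (g z)) S := by
  have hA : ContinuousOn (fun z => √(B (f₁ z) (f₁ z))) S := (h₁.bilin h₁).sqrt
  have he := continuousOn_perp_pair h₁ h₂ h
  have hE := (he.bilin he (B := B)).sqrt
  have hu := h₁.unitForm hg fun z hz => (h z hz).fst
  have hue := he.unitForm hg fun z hz => (h z hz).perp_pos hB
  have gu := continuous_gauss.comp_continuousOn hu
  have gue := continuous_gauss.comp_continuousOn hue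
  have hv := continuousOn_perp_perp hB h₁ h₂ h D
  have hv' := continuousOn_perp_perp hB h₁ h₂ h D'
  unfold mixedKernel
  refine ((((continuousOn_const.div (hA.mul hE) fun z hz => ?_)).mul gu).mul gue).mul
    (((hv.bilin hg).mul (hv'.bilin hg)).add ((hv.bilin hv').div_const _))
  exact (mul_pos (Real.sqrt_pos.2 (h z hz).fst) (Real.sqrt_pos.2 ((h z hz).perp_pos hB))).ne'

/-- Over a compact family of positive planes the majorants are uniformly positive. -/
lemma exists_majorant_bound (hB : B.IsSymm) (hsig : HasTwoPositive B) (hS : IsCompact S)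
    (h₁ : ContinuousOn f₁ S) (h₂ : ContinuousOn f₂ S) (h : ∀ z ∈ S, PosPair B (f₁ z) (f₂ z)) :
    ∃ δ, 0 < δ ∧ ∀ z ∈ S, ∀ x, δ * ‖x‖ ^ 2 ≤
      2 * (unitForm B (f₁ z) x ^ 2 + unitForm B (perp B (f₂ z) (f₁ z)) x ^ 2) - B x x := by
  set m : X × V → ℝ := fun w => 2 * (unitForm B (f₁ w.1) w.2 ^ 2 +
    unitForm B (perp B (f₂ w.1) (f₁ w.1)) w.2 ^ 2) - B w.2 w.2 with hm
  set K : Set (X × V) := S ×ˢ Metric.sphere (0 : V) 1 with hK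
  have hKc : IsCompact K := hS.prod (isCompact_sphere 0 1)
  have hmap : MapsTo Prod.fst K S := fun w hw => hw.1
  have c₁ : ContinuousOn (fun w : X × V => f₁ w.1) K := h₁.comp continuousOn_fst hmap
  have c₂ : ContinuousOn (fun w : X × V => f₂ w.1) K := h₂.comp continuousOn_fst hmap
  have hp : ∀ w ∈ K, PosPair B (f₁ w.1) (f₂ w.1) := fun w hw => h _ hw.1
  have hmc : ContinuousOn m K :=
    (continuousOn_const.mul
      (((c₁.unitForm continuousOn_snd fun w hw => (hp w hw).fst).pow 2).add
      (((continuousOn_perp_pair c₁ c₂ hp).unitForm continuousOn_snd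
        fun w hw => (hp w hw).perp_pos hB).pow 2))).sub (continuousOn_snd.bilin continuousOn_snd)
  have hmpos : ∀ w ∈ K, 0 < m w := fun w hw => by
    refine majorant_pos hB hsig (hp w hw) ?_
    have : ‖w.2‖ = 1 := by simpa using hw.2
    intro h0; simp [h0] at this
  -- The minimum over the compact set of planes and unit vectors; homogeneity of degree two extends
  -- it to all `x`. If `S` is empty or `V` is zero there is nothing to minimize and any constant
  -- serves.
  obtain ⟨δ, hδ, hδm⟩ : ∃ δ, 0 < δ ∧ ∀ w ∈ K, δ ≤ m w := by
    rcases K.eq_empty_or_nonempty with hE | hne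
    · exact ⟨1, one_pos, fun w hw => by simp [hE] at hw⟩
    · obtain ⟨w₀, hw₀, hmin⟩ := hKc.exists_isMinOn hne hmc
      exact ⟨m w₀, hmpos w₀ hw₀, fun w hw => hmin hw⟩
  refine ⟨δ, hδ, fun z hz x => ?_⟩
  by_cases hx : x = 0
  · simp [hx, IndefTheta.unitForm]
  · have hn : ‖x‖ ≠ 0 := norm_ne_zero_iff.2 hx
    have := hδm (z, ‖x‖⁻¹ • x) ⟨hz, by simp [norm_smul, hn]⟩
    have e : m (z, ‖x‖⁻¹ • x) = (‖x‖ ^ 2)⁻¹ * (2 * (IndefTheta.unitForm B (f₁ z) x ^ 2 +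
        IndefTheta.unitForm B (IndefTheta.perp B (f₂ z) (f₁ z)) x ^ 2) - B x x) := by
      simp only [hm, IndefTheta.unitForm, map_smul, smul_eq_mul, LinearMap.smul_apply]
      ring
    rw [e] at this
    have h2 : 0 < ‖x‖ ^ 2 := by positivity
    rw [inv_mul_eq_div, le_div_iff₀ h2] at this
    exact this

/-- With `a, b` the coordinates of a vector along the plane and `q` its square, the exponent is
`-π/2` times the majorant. The factor `exp(πq/2)` is what `e(-τQ/2)` contributes in absolute value
after the scaling by `√(2 Im τ)`. -/
lemma gauss_mul_gauss_mul_exp (a b q : ℝ) :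
    gauss a * gauss b * Real.exp (Real.pi * q / 2) =
      Real.exp (-(Real.pi / 2 * (2 * (a ^ 2 + b ^ 2) - q))) := by
  rw [gauss, gauss, ← Real.exp_add, ← Real.exp_add]
  congr 1; ring

lemma exists_poly_le_exp {δ : ℝ} (hδ : 0 < δ) :
    ∃ M, 0 < M ∧ ∀ r : ℝ, (1 + r ^ 2) * Real.exp (-(2 * δ * r ^ 2)) ≤ M * Real.exp (-(δ * r ^ 2)) := by
  refine ⟨1 + 1 / δ, by positivity, fun r => ?_⟩
  have h1 : 1 + r ^ 2 ≤ (1 + 1 / δ) * Real.exp (δ * r ^ 2) := by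
    have h := Real.add_one_le_exp (δ * r ^ 2)
    have h2 : 0 ≤ 1 + 1 / δ := by positivity
    calc 1 + r ^ 2 ≤ (1 + 1 / δ) * (δ * r ^ 2 + 1) := by
          have : (1 + 1 / δ) * (δ * r ^ 2 + 1) = 1 + r ^ 2 + (δ * r ^ 2 + 1 / δ) := by
            field_simp; ring
          rw [this]
          have : 0 ≤ δ * r ^ 2 + 1 / δ := by positivity
          linarith
      _ ≤ _ := by gcongr
  calc (1 + r ^ 2) * Real.exp (-(2 * δ * r ^ 2))
      ≤ ((1 + 1 / δ) * Real.exp (δ * r ^ 2)) * Real.exp (-(2 * δ * r ^ 2)) := by gcongr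
    _ = _ := by rw [mul_assoc, ← Real.exp_add]; ring_nf

/-- Uniform Gaussian decay of the mixed kernels over a compact family of positive planes. -/
lemma exists_mixedKernel_bound (hB : B.IsSymm) (hsig : HasTwoPositive B) (hS : IsCompact S)
    (h₁ : ContinuousOn f₁ S) (h₂ : ContinuousOn f₂ S) (h : ∀ z ∈ S, PosPair B (f₁ z) (f₂ z))
    (D D' : V) :
    ∃ C δ, 0 < C ∧ 0 < δ ∧ ∀ z ∈ S, ∀ x, |mixedKernel B (f₁ z) (f₂ z) D D' x| *
      Real.exp (Real.pi * B x x / 2) ≤ C * Real.exp (-(δ * ‖x‖ ^ 2)) := by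
  obtain ⟨δ, hδ, hm⟩ := exists_majorant_bound hB hsig hS h₁ h₂ h
  obtain ⟨M, hM0, hM⟩ := exists_bilin_bound B
  obtain ⟨R, hR⟩ := hS.exists_bound_of_continuousOn (continuousOn_perp_perp hB h₁ h₂ h D)
  obtain ⟨R', hR'⟩ := hS.exists_bound_of_continuousOn (continuousOn_perp_perp hB h₁ h₂ h D')
  have hA : ContinuousOn (fun z => 4 / (√(B (f₁ z) (f₁ z)) *
      √(B (IndefTheta.perp B (f₂ z) (f₁ z)) (IndefTheta.perp B (f₂ z) (f₁ z))))) S := by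
    have he := continuousOn_perp_pair h₁ h₂ h
    exact continuousOn_const.div ((h₁.bilin h₁).sqrt.mul (he.bilin he (B := B)).sqrt) fun z hz =>
      (mul_pos (Real.sqrt_pos.2 (h z hz).fst) (Real.sqrt_pos.2 ((h z hz).perp_pos hB))).ne'
  obtain ⟨P, hP⟩ := hS.exists_bound_of_continuousOn hA
  -- The majorant gives the rate `π δ / 2`. Half of it is spent on the quadratic polynomial, which
  -- leaves `π δ / 4`.
  obtain ⟨N, hN0, hN⟩ := exists_poly_le_exp (δ := Real.pi / 4 * δ) (by have := Real.pi_pos; positivity)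
  have hpi := Real.pi_pos
  -- The summand `1` keeps the constant positive when one of the bounds `P, R, R'` is zero.
  refine ⟨(|P| * (M * |R| * (M * |R'|) + M * |R| * |R'|)) * N + 1, Real.pi / 4 * δ, by positivity,
    by positivity, fun z hz x => ?_⟩
  have hv : ‖IndefTheta.perp B (IndefTheta.perp B D (f₁ z)) (IndefTheta.perp B (f₂ z) (f₁ z))‖ ≤ |R| :=
    (hR z hz).trans (le_abs_self _)
  have hv' : ‖IndefTheta.perp B (IndefTheta.perp B D' (f₁ z)) (IndefTheta.perp B (f₂ z) (f₁ z))‖ ≤ |R'| :=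
    (hR' z hz).trans (le_abs_self _)
  have hPz := (hP z hz).trans (le_abs_self _)
  have hmz := hm z hz x
  rw [Real.norm_eq_abs] at hPz
  simp only [mixedKernel]
  set v := IndefTheta.perp B (IndefTheta.perp B D (f₁ z)) (IndefTheta.perp B (f₂ z) (f₁ z))
  set v' := IndefTheta.perp B (IndefTheta.perp B D' (f₁ z)) (IndefTheta.perp B (f₂ z) (f₁ z))
  set a := IndefTheta.unitForm B (f₁ z) x
  set b := IndefTheta.unitForm B (IndefTheta.perp B (f₂ z) (f₁ z)) x
  have hpoly : |B v x * B v' x + B v v' / (2 * Real.pi)| ≤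
      (M * |R| * (M * |R'|) + M * |R| * |R'|) * (1 + ‖x‖ ^ 2) := by
    have t1 : |B v x| ≤ M * |R| * ‖x‖ := (hM v x).trans (by gcongr)
    have t2 : |B v' x| ≤ M * |R'| * ‖x‖ := (hM v' x).trans (by gcongr)
    have t3 : |B v v' / (2 * Real.pi)| ≤ M * |R| * |R'| := by
      rw [abs_div, abs_of_pos (show 0 < 2 * Real.pi by positivity)]
      refine (div_le_self (abs_nonneg _) (by linarith [Real.pi_gt_three])).trans
        ((hM v v').trans (by gcongr))
    calc _ ≤ |B v x| * |B v' x| + |B v v' / (2 * Real.pi)| := by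
          rw [← abs_mul]; exact abs_add_le _ _
      _ ≤ (M * |R| * ‖x‖) * (M * |R'| * ‖x‖) + M * |R| * |R'| := by gcongr
      _ ≤ _ := by
          have q1 : 0 ≤ M * |R| * (M * |R'|) := by positivity
          have q2 : 0 ≤ M * |R| * |R'| * ‖x‖ ^ 2 := by positivity
          nlinarith
  have hexp : gauss a * gauss b * Real.exp (Real.pi * B x x / 2) ≤
      Real.exp (-(2 * (Real.pi / 4 * δ) * ‖x‖ ^ 2)) := by
    rw [gauss_mul_gauss_mul_exp, Real.exp_le_exp]
    nlinarith
  rw [abs_mul, abs_mul, abs_mul, abs_of_pos (gauss_pos a), abs_of_pos (gauss_pos b)]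
  have ga := gauss_pos a
  have gb := gauss_pos b
  set p := |4 / (√(B (f₁ z) (f₁ z)) *
      √(B (IndefTheta.perp B (f₂ z) (f₁ z)) (IndefTheta.perp B (f₂ z) (f₁ z))))|
  set k := |B v x * B v' x + B v v' / (2 * Real.pi)|
  calc p * gauss a * gauss b * k * Real.exp (Real.pi * B x x / 2)
      = p * k * (gauss a * gauss b * Real.exp (Real.pi * B x x / 2)) := by ring
    _ ≤ |P| * ((M * |R| * (M * |R'|) + M * |R| * |R'|) * (1 + ‖x‖ ^ 2)) *
        Real.exp (-(2 * (Real.pi / 4 * δ) * ‖x‖ ^ 2)) := by gcongr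
    _ = (|P| * (M * |R| * (M * |R'|) + M * |R| * |R'|)) * ((1 + ‖x‖ ^ 2) *
        Real.exp (-(2 * (Real.pi / 4 * δ) * ‖x‖ ^ 2))) := by ring
    _ ≤ (|P| * (M * |R| * (M * |R'|) + M * |R| * |R'|)) * (N * Real.exp (-(Real.pi / 4 * δ * ‖x‖ ^ 2))) := by
        exact mul_le_mul_of_nonneg_left (hN ‖x‖) (by positivity)
    _ ≤ _ := by
        have := Real.exp_pos (-(Real.pi / 4 * δ * ‖x‖ ^ 2))
        nlinarith

end Family

end Bounds

end IndefTheta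

end

noncomputable section

namespace IndefTheta

open MeasureTheory Filter Topology Set

set_option linter.unusedSectionVars false

/-! ### The completed kernel as an integral over a square of positive planes -/

section Square

variable {V : Type*} [NormedAddCommGroup V] [NormedSpace ℝ V] [FiniteDimensional ℝ V]
  {B : LinearMap.BilinForm ℝ V}

/-- The unit square. -/
def unitSq : Set (ℝ × ℝ) := Icc 0 1 ×ˢ Icc 0 1

lemma isCompact_unitSq : IsCompact unitSq := isCompact_Icc.prod isCompact_Icc

lemma measurableSet_unitSq : MeasurableSet unitSq := measurableSet_Icc.prod measurableSet_Icc

/-- All the planes spanned by points of the segments `[C₁, C₁']` and `[C₂, C₂']` are positive. -/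
def PosSquare (B : LinearMap.BilinForm ℝ V) (C₁ C₁' C₂ C₂' : V) : Prop :=
  ∀ z ∈ unitSq, PosPair B (C₁ + z.1 • (C₁' - C₁)) (C₂ + z.2 • (C₂' - C₂))

/-- The mixed kernel at a point of the square. -/
def sqKernel (B : LinearMap.BilinForm ℝ V) (C₁ C₁' C₂ C₂' : V) (z : ℝ × ℝ) (x : V) : ℝ :=
  mixedKernel B (C₁ + z.1 • (C₁' - C₁)) (C₂ + z.2 • (C₂' - C₂)) (C₁' - C₁) (C₂' - C₂) x

/-- The completed kernel as a real-valued function. -/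
def phiReal (B : LinearMap.BilinForm ℝ V) (C₁ C₁' C₂ C₂' x : V) : ℝ :=
  1 / 4 * (e2Boost B C₁ C₂ x - e2Boost B C₁ C₂' x - e2Boost B C₁' C₂ x + e2Boost B C₁' C₂' x)

/-- The real-valued function with `Ψ₂ = (i / 4) psiReal`. -/
def psiReal (B : LinearMap.BilinForm ℝ V) (C₁ C₁' C₂ C₂' x : V) : ℝ :=
  1 / 2 * (gaussFactor B C₁ x * (E1Boost B (perp B C₂ C₁) x - E1Boost B (perp B C₂' C₁) x)
      + gaussFactor B C₂ x * (E1Boost B (perp B C₁ C₂) x - E1Boost B (perp B C₁' C₂) x)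
      + gaussFactor B C₁' x * (E1Boost B (perp B C₂' C₁') x - E1Boost B (perp B C₂ C₁') x)
      + gaussFactor B C₂' x *
          (E1Boost B (perp B C₁' C₂') x - E1Boost B (perp B C₁ C₂') x))

lemma hatPhi2_eq (C₁ C₁' C₂ C₂' x : V) :
    hatPhi2 B C₁ C₁' C₂ C₂' x = (phiReal B C₁ C₁' C₂ C₂' x : ℂ) := by
  simp [hatPhi2, phiReal, E2Boost_eq]

lemma Psi2_eq (C₁ C₁' C₂ C₂' x : V) :
    Psi2 B C₁ C₁' C₂ C₂' x = Complex.I / 4 * (psiReal B C₁ C₁' C₂ C₂' x : ℂ) := by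
  rw [Psi2, psiReal]
  push_cast
  ring

variable {C₁ C₁' C₂ C₂' : V}

lemma continuous_segment_fst (C D : V) : Continuous fun z : ℝ × ℝ => C + z.1 • D :=
  continuous_const.add (continuous_fst.smul continuous_const)

lemma continuous_segment_snd (C D : V) : Continuous fun z : ℝ × ℝ => C + z.2 • D :=
  continuous_const.add (continuous_snd.smul continuous_const)

lemma PosSquare.continuousOn_sqKernel (hB : B.IsSymm) (h : PosSquare B C₁ C₁' C₂ C₂') :
    ContinuousOn (fun w : (ℝ × ℝ) × V => sqKernel B C₁ C₁' C₂ C₂' w.1 w.2) (unitSq ×ˢ univ) :=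
  continuousOn_mixedKernel hB ((continuous_segment_fst _ _).comp continuous_fst).continuousOn
    ((continuous_segment_snd _ _).comp continuous_fst).continuousOn continuousOn_snd
    (fun w hw => h w.1 hw.1) _ _

lemma integral_mixedKernel (hB : B.IsSymm) {D D' : V} (x : V)
    (h : ∀ t ∈ Icc (0 : ℝ) 1, PosPair B C₁ (C₂ + t • D')) :
    ∫ t in Icc (0 : ℝ) 1, mixedKernel B C₁ (C₂ + t • D') D D' x =
      e2BoostDeriv B C₁ (C₂ + D') D x - e2BoostDeriv B C₁ C₂ D x := by
  rw [integral_Icc_eq_integral_Ioc, ← intervalIntegral.integral_of_le zero_le_one]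
  have hu : uIcc (0 : ℝ) 1 = Icc 0 1 := uIcc_of_le zero_le_one
  rw [intervalIntegral.integral_eq_sub_of_hasDerivAt
    (f := fun t => e2BoostDeriv B C₁ (C₂ + t • D') D x)]
  · simp only [one_smul, zero_smul, add_zero]
  · intro t ht
    exact hasDerivAt_e2BoostDeriv hB x (h t (hu ▸ ht))
  · refine (continuousOn_mixedKernel hB continuousOn_const (Continuous.continuousOn (by fun_prop))
      continuousOn_const (fun t ht => h t (hu ▸ ht)) D D').intervalIntegrable

lemma integral_e2BoostDeriv (hB : B.IsSymm) {D : V} (x : V)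
    (h : ∀ s ∈ Icc (0 : ℝ) 1, PosPair B (C₁ + s • D) C₂) :
    IntegrableOn (fun s : ℝ => e2BoostDeriv B (C₁ + s • D) C₂ D x) (Icc 0 1) ∧
    ∫ s in Icc (0 : ℝ) 1, e2BoostDeriv B (C₁ + s • D) C₂ D x =
      e2Boost B (C₁ + D) C₂ x - e2Boost B C₁ C₂ x := by
  have hu : uIcc (0 : ℝ) 1 = Icc 0 1 := uIcc_of_le zero_le_one
  have hc : ContinuousOn (fun s : ℝ => e2BoostDeriv B (C₁ + s • D) C₂ D x) (Icc 0 1) :=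
    continuousOn_e2BoostDeriv hB (Continuous.continuousOn (by fun_prop)) continuousOn_const
      continuousOn_const h D
  refine ⟨hc.integrableOn_Icc, ?_⟩
  rw [integral_Icc_eq_integral_Ioc, ← intervalIntegral.integral_of_le zero_le_one]
  rw [intervalIntegral.integral_eq_sub_of_hasDerivAt (f := fun s => e2Boost B (C₁ + s • D) C₂ x)]
  · simp only [one_smul, zero_smul, add_zero]
  · intro t ht
    exact hasDerivAt_e2Boost hB x (h t (hu ▸ ht))
  · exact ContinuousOn.intervalIntegrable (hu ▸ hc)

/-- The alternating sum over the corners is the double integral of the mixed derivative, by the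
fundamental theorem of calculus in `t` and then in `s`. Error functions that do not decay are thus
replaced by Gaussians that do. -/
lemma PosSquare.phiReal_eq (hB : B.IsSymm) (h : PosSquare B C₁ C₁' C₂ C₂') (x : V) :
    phiReal B C₁ C₁' C₂ C₂' x = 1 / 4 * ∫ z in unitSq, sqKernel B C₁ C₁' C₂ C₂' z x := by
  have m0 : (0 : ℝ) ∈ Icc (0 : ℝ) 1 := by simp
  have m1 : (1 : ℝ) ∈ Icc (0 : ℝ) 1 := by simp
  have hcont : ContinuousOn (fun z : ℝ × ℝ => sqKernel B C₁ C₁' C₂ C₂' z x) unitSq :=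
    ContinuousOn.comp (h.continuousOn_sqKernel hB) (f := fun z : ℝ × ℝ => (z, x))
      (Continuous.continuousOn (by fun_prop)) fun z hz => ⟨hz, mem_univ x⟩
  have hI : IntegrableOn (fun z : ℝ × ℝ => sqKernel B C₁ C₁' C₂ C₂' z x) unitSq
      (volume.prod volume) := hcont.integrableOn_compact isCompact_unitSq
  have inner : ∀ s ∈ Icc (0 : ℝ) 1, ∫ t in Icc (0 : ℝ) 1, sqKernel B C₁ C₁' C₂ C₂' (s, t) x =
      e2BoostDeriv B (C₁ + s • (C₁' - C₁)) C₂' (C₁' - C₁) x -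
        e2BoostDeriv B (C₁ + s • (C₁' - C₁)) C₂ (C₁' - C₁) x := by
    intro s hs
    have := integral_mixedKernel hB (C₁ := C₁ + s • (C₁' - C₁)) (C₂ := C₂) (D := C₁' - C₁)
      (D' := C₂' - C₂) x fun t ht => h (s, t) ⟨hs, ht⟩
    rw [add_sub_cancel] at this
    exact this
  have o1 := integral_e2BoostDeriv hB (C₁ := C₁) (C₂ := C₂) (D := C₁' - C₁) x
    fun s hs => by simpa using h (s, 0) ⟨hs, m0⟩
  have o2 := integral_e2BoostDeriv hB (C₁ := C₁) (C₂ := C₂') (D := C₁' - C₁) x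
    fun s hs => by simpa using h (s, 1) ⟨hs, m1⟩
  have fub : ∫ z in unitSq, sqKernel B C₁ C₁' C₂ C₂' z x =
      ∫ s in Icc (0 : ℝ) 1, ∫ t in Icc (0 : ℝ) 1, sqKernel B C₁ C₁' C₂ C₂' (s, t) x :=
    setIntegral_prod _ hI
  rw [fub, setIntegral_congr_fun measurableSet_Icc inner, integral_sub o2.1 o1.1, o1.2, o2.2,
    add_sub_cancel, phiReal]
  ring

lemma PosSquare.exists_sqKernel_bound (hB : B.IsSymm) (hsig : HasTwoPositive B)
    (h : PosSquare B C₁ C₁' C₂ C₂') :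
    ∃ C δ, 0 < C ∧ 0 < δ ∧ ∀ z ∈ unitSq, ∀ x, |sqKernel B C₁ C₁' C₂ C₂' z x| *
      Real.exp (Real.pi * B x x / 2) ≤ C * Real.exp (-(δ * ‖x‖ ^ 2)) :=
  exists_mixedKernel_bound hB hsig isCompact_unitSq (continuous_segment_fst _ _).continuousOn
    (continuous_segment_snd _ _).continuousOn h _ _

lemma PosSquare.exists_phiReal_bound (hB : B.IsSymm) (hsig : HasTwoPositive B)
    (h : PosSquare B C₁ C₁' C₂ C₂') :
    ∃ C δ, 0 < C ∧ 0 < δ ∧ ∀ x, |phiReal B C₁ C₁' C₂ C₂' x| *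
      Real.exp (Real.pi * B x x / 2) ≤ C * Real.exp (-(δ * ‖x‖ ^ 2)) := by
  obtain ⟨C, δ, hC, hδ, hb⟩ := h.exists_sqKernel_bound hB hsig
  refine ⟨C, δ, hC, hδ, fun x => ?_⟩
  have hvol : volume unitSq = 1 := by
    rw [unitSq, Measure.volume_eq_prod, Measure.prod_prod]; simp
  have h1 : ‖∫ z in unitSq, sqKernel B C₁ C₁' C₂ C₂' z x‖ ≤
      (C * Real.exp (-(δ * ‖x‖ ^ 2)) * Real.exp (-(Real.pi * B x x / 2))) * volume.real unitSq := by
    refine norm_setIntegral_le_of_norm_le_const (by simp [hvol]) fun z hz => ?_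
    have := hb z hz x
    rw [Real.norm_eq_abs, Real.exp_neg (Real.pi * B x x / 2), ← div_eq_mul_inv, le_div_iff₀ (Real.exp_pos _)]
    exact this
  have hv : volume.real unitSq = 1 := by simp [Measure.real, hvol]
  rw [hv, mul_one, Real.exp_neg (Real.pi * B x x / 2), ← div_eq_mul_inv,
    le_div_iff₀ (Real.exp_pos _), Real.norm_eq_abs] at h1
  rw [h.phiReal_eq hB, abs_mul, abs_of_pos (by norm_num : (0 : ℝ) < 1 / 4)]
  have : 0 ≤ |∫ z in unitSq, sqKernel B C₁ C₁' C₂ C₂' z x| * Real.exp (Real.pi * B x x / 2) := by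
    positivity
  linarith

/-! ### Decay of the shadow kernel, edge by edge. -/

lemma gaussFactor_eq {C : V} (hC : 0 < B C C) (x : V) :
    gaussFactor B C x = unitForm B C x * gauss (unitForm B C x) := by
  rw [gaussFactor, gauss, unitForm, div_pow, Real.sq_sqrt hC.le, mul_div_assoc]

lemma hasDerivAt_E1Boost_perp (hB : B.IsSymm) {C A D : V} (x : V) {t : ℝ}
    (h : PosPair B C (A + t • D)) :
    HasDerivAt (fun t : ℝ => E1Boost B (perp B (A + t • D) C) x)
      (2 * gauss (unitForm B (perp B (A + t • D) C) x) *
        (B (perp B (perp B D C) (perp B (A + t • D) C)) x /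
          √(B (perp B (A + t • D) C) (perp B (A + t • D) C)))) t := by
  have hp := h.perp_pos hB
  simp only [E1Boost, unitForm, perp_add_smul] at *
  have d1 := hasDerivAt_div_sqrt (hasDerivAt_bilin_line (B := B) (perp B A C) (perp B D C) x t)
    (hasDerivAt_bilin_line_self hB (perp B A C) (perp B D C) t) hp
  refine ((hasDerivAt_E1 _).comp t d1).congr_deriv ?_
  rw [perp_apply_left (perp B D C)]
  congr 2
  field_simp

/-- Gaussian decay of the edge terms of the shadow kernel. -/
lemma exists_edge_bound (hB : B.IsSymm) (hsig : HasTwoPositive B) {C A A' : V}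
    (h : ∀ t ∈ Icc (0 : ℝ) 1, PosPair B C (A + t • (A' - A))) :
    ∃ K δ, 0 < K ∧ 0 < δ ∧ ∀ x,
      |gaussFactor B C x * (E1Boost B (perp B A C) x - E1Boost B (perp B A' C) x)| *
        Real.exp (Real.pi * B x x / 2) ≤ K * Real.exp (-(δ * ‖x‖ ^ 2)) := by
  set D := A' - A with hD
  have cA : ContinuousOn (fun t : ℝ => A + t • D) (Icc 0 1) := by fun_prop
  have cC : ContinuousOn (fun _ : ℝ => C) (Icc 0 1) := continuousOn_const
  obtain ⟨δ, hδ, hm⟩ := exists_majorant_bound hB hsig isCompact_Icc cC cA h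
  obtain ⟨M, hM0, hM⟩ := exists_bilin_bound B
  have hv := continuousOn_perp_perp hB cC cA h D
  have he := continuousOn_perp_pair cC cA h
  have hq : ContinuousOn (fun t : ℝ => (√(B (IndefTheta.perp B (A + t • D) C)
      (IndefTheta.perp B (A + t • D) C)))⁻¹ •
      IndefTheta.perp B (IndefTheta.perp B D C) (IndefTheta.perp B (A + t • D) C)) (Icc 0 1) :=
    ((he.bilin he (B := B)).sqrt.inv₀ fun t ht =>
      (Real.sqrt_pos.2 ((h t ht).perp_pos hB)).ne').smul hv
  obtain ⟨R, hR⟩ := isCompact_Icc.exists_bound_of_continuousOn hq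
  have hpi := Real.pi_pos
  obtain ⟨N, hN0, hN⟩ := exists_poly_le_exp (δ := Real.pi / 4 * δ) (by positivity)
  have hC0 : 0 < B C C := (h 0 (by simp)).fst
  have sC := Real.sqrt_pos.2 hC0
  refine ⟨2 * (M * ‖C‖ / √(B C C)) * (M * |R|) * N + 1, Real.pi / 4 * δ, by positivity,
    by positivity, fun x => ?_⟩
  have hE := Real.exp_pos (Real.pi * B x x / 2)
  -- Along the edge from `A` to `A'` the derivative of `E1` supplies the second Gaussian factor of
  -- the plane of `C` and `A + t D`. The mean value inequality then bounds the difference at the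
  -- ends.
  have key : ∀ t ∈ Icc (0 : ℝ) 1, ‖gaussFactor B C x * (2 * gauss (unitForm B (perp B (A + t • D) C) x) *
        (B (perp B (perp B D C) (perp B (A + t • D) C)) x /
          √(B (perp B (A + t • D) C) (perp B (A + t • D) C))))‖ ≤
      (2 * (M * ‖C‖ / √(B C C)) * (M * |R|) * N + 1) * Real.exp (-(Real.pi / 4 * δ * ‖x‖ ^ 2)) /
        Real.exp (Real.pi * B x x / 2) := by
    intro t ht
    rw [le_div_iff₀ hE]
    have hexp : gauss (unitForm B C x) * gauss (unitForm B (perp B (A + t • D) C) x) *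
        Real.exp (Real.pi * B x x / 2) ≤ Real.exp (-(2 * (Real.pi / 4 * δ) * ‖x‖ ^ 2)) := by
      rw [gauss_mul_gauss_mul_exp, Real.exp_le_exp]
      nlinarith [hm t ht x]
    have r1 : |unitForm B C x| ≤ M * ‖C‖ / √(B C C) * ‖x‖ := by
      rw [unitForm, abs_div, abs_of_pos sC, div_mul_eq_mul_div]
      gcongr
      exact hM C x
    have r2 : |B (perp B (perp B D C) (perp B (A + t • D) C)) x /
          √(B (perp B (A + t • D) C) (perp B (A + t • D) C))| ≤ M * |R| * ‖x‖ := by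
      have h1 := (hR t ht).trans (le_abs_self R)
      have h2 := hM ((√(B (perp B (A + t • D) C) (perp B (A + t • D) C)))⁻¹ •
        perp B (perp B D C) (perp B (A + t • D) C)) x
      rw [map_smul, LinearMap.smul_apply, smul_eq_mul, inv_mul_eq_div] at h2
      refine h2.trans ?_
      gcongr
    rw [gaussFactor_eq hC0, Real.norm_eq_abs]
    set a := unitForm B C x
    set b := unitForm B (perp B (A + t • D) C) x
    set k := B (perp B (perp B D C) (perp B (A + t • D) C)) x /
          √(B (perp B (A + t • D) C) (perp B (A + t • D) C))
    rw [show a * gauss a * (2 * gauss b * k) = 2 * (a * k) * (gauss a * gauss b) by ring, abs_mul,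
      abs_mul, abs_mul, abs_of_pos (mul_pos (gauss_pos a) (gauss_pos b)), abs_two]
    calc 2 * (|a| * |k|) * (gauss a * gauss b) * Real.exp (Real.pi * B x x / 2)
        = 2 * (|a| * |k|) * (gauss a * gauss b * Real.exp (Real.pi * B x x / 2)) := by ring
      _ ≤ 2 * ((M * ‖C‖ / √(B C C) * ‖x‖) * (M * |R| * ‖x‖)) *
          Real.exp (-(2 * (Real.pi / 4 * δ) * ‖x‖ ^ 2)) := by
            gcongr
            exact mul_nonneg (mul_nonneg (gauss_pos a).le (gauss_pos b).le) hE.le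
      _ = 2 * (M * ‖C‖ / √(B C C)) * (M * |R|) * (‖x‖ ^ 2 *
          Real.exp (-(2 * (Real.pi / 4 * δ) * ‖x‖ ^ 2))) := by ring
      _ ≤ 2 * (M * ‖C‖ / √(B C C)) * (M * |R|) * (N * Real.exp (-(Real.pi / 4 * δ * ‖x‖ ^ 2))) := by
          refine mul_le_mul_of_nonneg_left ((?_ : _ ≤ _).trans (hN ‖x‖)) (by positivity)
          gcongr
          linarith
      _ ≤ _ := by
        have := Real.exp_pos (-(Real.pi / 4 * δ * ‖x‖ ^ 2))
        nlinarith
  have mv := (convex_Icc (0 : ℝ) 1).norm_image_sub_le_of_norm_hasDerivWithin_le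
    (f := fun t : ℝ => gaussFactor B C x * E1Boost B (perp B (A + t • D) C) x)
    (fun t ht => ((hasDerivAt_E1Boost_perp hB x (h t ht)).const_mul
      (gaussFactor B C x)).hasDerivWithinAt) key (x := 1) (y := 0) (by simp) (by simp)
  simp only [zero_smul, add_zero, one_smul, hD, add_sub_cancel, zero_sub, norm_neg, norm_one,
    mul_one, ← mul_sub] at mv
  rw [← le_div_iff₀ hE]
  simpa [hD] using mv

lemma PosSquare.left (h : PosSquare B C₁ C₁' C₂ C₂') {t : ℝ} (ht : t ∈ Icc (0 : ℝ) 1) :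
    PosPair B C₁ (C₂ + t • (C₂' - C₂)) := by
  simpa using h (0, t) ⟨by simp, ht⟩

/-- With `PosSquare.swap`, this symmetry reduces all four edges of the square to the edge treated in
`PosSquare.left`. -/
lemma PosSquare.flip (hB : B.IsSymm) (h : PosSquare B C₁ C₁' C₂ C₂') :
    PosSquare B C₂ C₂' C₁ C₁' :=
  fun z hz => (h (z.2, z.1) ⟨hz.2, hz.1⟩).symm hB

lemma PosSquare.swap (h : PosSquare B C₁ C₁' C₂ C₂') : PosSquare B C₁' C₁ C₂' C₂ := by
  intro z hz
  have := h (1 - z.1, 1 - z.2) ⟨⟨by linarith [hz.1.2], by linarith [hz.1.1]⟩,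
    ⟨by linarith [hz.2.2], by linarith [hz.2.1]⟩⟩
  have e : ∀ (C C' : V) (s : ℝ), C + (1 - s) • (C' - C) = C' + s • (C - C') := by
    intro C C' s
    module
  simpa [e] using this

lemma exists_gaussian_bound_add {f g : V → ℝ}
    (hf : ∃ K δ, 0 < K ∧ 0 < δ ∧ ∀ x, |f x| * Real.exp (Real.pi * B x x / 2) ≤
      K * Real.exp (-(δ * ‖x‖ ^ 2)))
    (hg : ∃ K δ, 0 < K ∧ 0 < δ ∧ ∀ x, |g x| * Real.exp (Real.pi * B x x / 2) ≤
      K * Real.exp (-(δ * ‖x‖ ^ 2))) :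
    ∃ K δ, 0 < K ∧ 0 < δ ∧ ∀ x, |f x + g x| * Real.exp (Real.pi * B x x / 2) ≤
      K * Real.exp (-(δ * ‖x‖ ^ 2)) := by
  obtain ⟨K, δ, hK, hδ, h1⟩ := hf
  obtain ⟨K', δ', hK', hδ', h2⟩ := hg
  refine ⟨K + K', min δ δ', by positivity, lt_min hδ hδ', fun x => ?_⟩
  calc _ ≤ (|f x| + |g x|) * Real.exp (Real.pi * B x x / 2) := by gcongr; exact abs_add_le _ _
    _ ≤ K * Real.exp (-(δ * ‖x‖ ^ 2)) + K' * Real.exp (-(δ' * ‖x‖ ^ 2)) := by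
        rw [add_mul]; exact add_le_add (h1 x) (h2 x)
    _ ≤ K * Real.exp (-(min δ δ' * ‖x‖ ^ 2)) + K' * Real.exp (-(min δ δ' * ‖x‖ ^ 2)) := by
        gcongr
        · exact min_le_left _ _
        · exact min_le_right _ _
    _ = _ := by ring

lemma PosSquare.exists_psiReal_bound (hB : B.IsSymm) (hsig : HasTwoPositive B)
    (h : PosSquare B C₁ C₁' C₂ C₂') :
    ∃ K δ, 0 < K ∧ 0 < δ ∧ ∀ x, |psiReal B C₁ C₁' C₂ C₂' x| *
      Real.exp (Real.pi * B x x / 2) ≤ K * Real.exp (-(δ * ‖x‖ ^ 2)) := by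
  have b1 := exists_edge_bound hB hsig fun t ht => h.left ht
  have b2 := exists_edge_bound hB hsig fun t ht => (h.flip hB).left ht
  have b3 := exists_edge_bound hB hsig fun t ht => h.swap.left ht
  have b4 := exists_edge_bound hB hsig fun t ht => (h.flip hB).swap.left ht
  obtain ⟨K, δ, hK, hδ, hb⟩ := exists_gaussian_bound_add
    (exists_gaussian_bound_add (exists_gaussian_bound_add b1 b2) b3) b4
  refine ⟨K, δ, hK, hδ, fun x => ?_⟩
  rw [psiReal, abs_mul, abs_of_pos (by norm_num : (0 : ℝ) < 1 / 2)]
  have := hb x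
  have : ∀ y : ℝ, 0 ≤ |y| * Real.exp (Real.pi * B x x / 2) := fun y => by positivity
  nlinarith [hb x, this (gaussFactor B C₁ x * (E1Boost B (perp B C₂ C₁) x - E1Boost B (perp B C₂' C₁) x)
      + gaussFactor B C₂ x * (E1Boost B (perp B C₁ C₂) x - E1Boost B (perp B C₁' C₂) x)
      + gaussFactor B C₁' x * (E1Boost B (perp B C₂' C₁') x - E1Boost B (perp B C₂ C₁') x)
      + gaussFactor B C₂' x *
          (E1Boost B (perp B C₁' C₂') x - E1Boost B (perp B C₁ C₂') x))]

end Square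

end IndefTheta

end

noncomputable section

namespace IndefTheta

open MeasureTheory Filter Topology Set

set_option linter.unusedSectionVars false

/-! ### Smoothness and the radial derivative of the completed kernel -/

section Radial

variable {V : Type*} [NormedAddCommGroup V] [NormedSpace ℝ V] [FiniteDimensional ℝ V]
  {B : LinearMap.BilinForm ℝ V} {C₁ C₁' C₂ C₂' : V}

lemma contDiff_unitForm (C : V) : ContDiff ℝ ∞ (unitForm B C) :=
  ((bilinCLM B C).contDiff).div_const _

lemma contDiff_e2Boost (C₁ C₂ : V) : ContDiff ℝ ∞ (e2Boost B C₁ C₂) :=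
  (contDiff_dblErf _).comp ((contDiff_unitForm (perp B C₁ C₂)).prodMk (contDiff_unitForm C₂))

lemma contDiff_phiReal (C₁ C₁' C₂ C₂' : V) : ContDiff ℝ ∞ (phiReal B C₁ C₁' C₂ C₂') :=
  contDiff_const.mul ((((contDiff_e2Boost _ _).sub (contDiff_e2Boost _ _)).sub
    (contDiff_e2Boost _ _)).add (contDiff_e2Boost _ _))

lemma contDiff_hatPhi2 (C₁ C₁' C₂ C₂' : V) : ContDiff ℝ ∞ (hatPhi2 B C₁ C₁' C₂ C₂') := by
  have : hatPhi2 B C₁ C₁' C₂ C₂' = fun x => Complex.ofRealCLM (phiReal B C₁ C₁' C₂ C₂' x) :=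
    funext fun x => hatPhi2_eq _ _ _ _ _
  rw [this]
  exact Complex.ofRealCLM.contDiff.comp (contDiff_phiReal _ _ _ _)

lemma unitForm_smul (C y : V) (r : ℝ) : unitForm B C (r • y) = r * unitForm B C y := by
  simp [unitForm, mul_div_assoc]

/-- Contract the gradient of `dblErf` with the direction `(a, b)`. The multiple of `dblErfLeft` is
`a + α b`, which after the rotation of frames is a multiple of the form of `C₁`; this makes the
result symmetric in the two vectors. -/
lemma hasDerivAt_e2Boost_radial (hB : B.IsSymm) (h : PosPair B C₁ C₂) (y : V) (r : ℝ) :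
    HasDerivAt (fun r : ℝ => e2Boost B C₁ C₂ (r • y))
      (2 * unitForm B C₁ y * gauss (unitForm B C₁ (r • y)) * E1Boost B (perp B C₂ C₁) (r • y) +
        2 * unitForm B C₂ y * gauss (unitForm B C₂ (r • y)) * E1Boost B (perp B C₁ C₂) (r • y))
      r := by
  set a := unitForm B (perp B C₁ C₂) y with ha
  set b := unitForm B C₂ y with hb
  set α := B C₁ C₂ / √(gramDet B ![C₁, C₂]) with hα
  have e : (fun r : ℝ => e2Boost B C₁ C₂ (r • y)) =
      (fun u : ℝ × ℝ => dblErf α u.1 u.2) ∘ fun r : ℝ => (r * a, r * b) := by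
    ext r; simp only [e2Boost, unitForm_smul, Function.comp]; rfl
  have hl : HasDerivAt (fun r : ℝ => (r * a, r * b)) (a, b) r :=
    (hasDerivAt_mul_const a).prodMk (hasDerivAt_mul_const b)
  rw [e]
  refine ((hasStrictFDerivAt_dblErf α (r * a, r * b)).hasFDerivAt.comp_hasDerivAt r hl).congr_deriv ?_
  have hA := gramDet_two hB C₁ C₂
  have f1 : (a + α * b) / √(1 + α ^ 2) = unitForm B C₁ y := by
    rw [ha, hb, hα, hA, unitForm, unitForm, unitForm, perp_sq hB _ h.snd.ne', perp_apply_left,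
      rotate_fst h.fst h.snd h.gram]
  have f2 : (b - α * a) / √(1 + α ^ 2) = unitForm B (perp B C₂ C₁) y := by
    rw [ha, hb, hα, hA, unitForm, unitForm, unitForm, perp_sq hB C₁ h.snd.ne', perp_apply_left,
      rotate_snd h.fst h.snd h.gram, perp_sq hB _ h.fst.ne', perp_apply_left, hB.eq C₂ C₁,
      mul_comm (B C₂ C₂)]
  have g1 : (r * a + α * (r * b)) / √(1 + α ^ 2) = r * unitForm B C₁ y := by
    rw [← f1]; ring
  have g2 : (r * b - α * (r * a)) / √(1 + α ^ 2) = r * unitForm B (perp B C₂ C₁) y := by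
    rw [← f2]; ring
  simp only [ContinuousLinearMap.coprod_apply, smul_apply,
    ContinuousLinearMap.id_apply, smul_eq_mul, dblErfLeft, dblErfRight, E1Boost, unitForm_smul,
    g1, g2]
  rw [← f1]
  ring

/-- The shadow kernel is the Euler derivative of the completed kernel: collecting the corner terms
by their Gaussian factor produces the four brackets of `psiReal`. -/
lemma hasDerivAt_phiReal_radial (hB : B.IsSymm) (h : PosSquare B C₁ C₁' C₂ C₂') (y : V) {r : ℝ}
    (hr : r ≠ 0) :
    HasDerivAt (fun r : ℝ => phiReal B C₁ C₁' C₂ C₂' (r • y))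
      (psiReal B C₁ C₁' C₂ C₂' (r • y) / r) r := by
  have h12 : PosPair B C₁ C₂ := by simpa using h (0, 0) (by simp [unitSq])
  have h12' : PosPair B C₁ C₂' := by simpa using h (0, 1) (by simp [unitSq])
  have h1'2 : PosPair B C₁' C₂ := by simpa using h (1, 0) (by simp [unitSq])
  have h1'2' : PosPair B C₁' C₂' := by simpa using h (1, 1) (by simp [unitSq])
  refine (((((hasDerivAt_e2Boost_radial hB h12 y r).sub
    (hasDerivAt_e2Boost_radial hB h12' y r)).sub (hasDerivAt_e2Boost_radial hB h1'2 y r)).add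
    (hasDerivAt_e2Boost_radial hB h1'2' y r)).const_mul (1 / 4)).congr_deriv ?_
  rw [psiReal, gaussFactor_eq h12.fst, gaussFactor_eq h12.snd, gaussFactor_eq h1'2.fst,
    gaussFactor_eq h12'.snd]
  simp only [unitForm_smul]
  field_simp
  ring

end Radial

end IndefTheta

end

noncomputable section

namespace IndefTheta

open MeasureTheory Filter Topology Set

set_option linter.unusedSectionVars false

/-! ### Poisson summation in several variables -/

section PoissonPi

variable {ι : Type*} [Fintype ι]

lemma e_add (z w : ℂ) : e (z + w) = e z * e w := by
  rw [e, e, e, ← Complex.exp_add]; ring_nf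

lemma e_intCast (m : ℤ) : e (m : ℂ) = 1 := by
  rw [e, mul_comm]; exact Complex.exp_int_mul_two_pi_mul_I m

lemma norm_e_ofReal (x : ℝ) : ‖e (x : ℂ)‖ = 1 := by
  rw [e, show 2 * (Real.pi : ℂ) * Complex.I * x = ((2 * Real.pi * x : ℝ) : ℂ) * Complex.I by
    push_cast; ring, Complex.norm_exp_ofReal_mul_I]

lemma continuous_e : Continuous e := by unfold e; fun_prop

/-- The projection of `ℝ^ι` onto the torus. -/
def toTorus (x : ι → ℝ) : UnitAddTorus ι := fun i => (x i : UnitAddCircle)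

lemma isOpenQuotientMap_toTorus : IsOpenQuotientMap (toTorus (ι := ι)) :=
  IsOpenQuotientMap.piMap fun _ => QuotientAddGroup.isOpenQuotientMap_mk

lemma mFourier_toTorus (m : ι → ℤ) (x : ι → ℝ) :
    UnitAddTorus.mFourier m (toTorus x) = e ((∑ i, m i * x i : ℝ) : ℂ) := by
  simp only [UnitAddTorus.mFourier, toTorus, ContinuousMap.coe_mk, fourier_coe_apply, e]
  rw [← Complex.exp_sum]
  congr 1
  push_cast
  rw [Finset.mul_sum]
  exact Finset.sum_congr rfl fun i _ => by simp; ring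

/-- The half-open unit cube with lower corner `l`. -/
def unitCube (l : ι → ℤ) : Set (ι → ℝ) := {x | ∀ i, x i ∈ Ioc (l i : ℝ) (l i + 1)}

lemma measurableSet_unitCube (l : ι → ℤ) : MeasurableSet (unitCube l) :=
  MeasurableSet.univ_pi' fun _ => measurableSet_Ioc

lemma pairwise_disjoint_unitCube : Pairwise (Function.onFun Disjoint (unitCube (ι := ι))) := by
  intro l l' h
  refine Set.disjoint_left.2 fun x hx hx' => h (funext fun i => ?_)
  have a := hx i
  have b := hx' i
  have h1 : (l i : ℝ) < l' i + 1 := a.1.trans_le b.2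
  have h2 : (l' i : ℝ) < l i + 1 := b.1.trans_le a.2
  have : l i < l' i + 1 := by exact_mod_cast h1
  have : l' i < l i + 1 := by exact_mod_cast h2
  omega

lemma iUnion_unitCube : ⋃ l : ι → ℤ, unitCube l = univ := by
  refine eq_univ_of_forall fun x => mem_iUnion.2 ⟨fun i => ⌈x i⌉ - 1, fun i => ?_⟩
  push_cast
  exact ⟨by linarith [Int.ceil_lt_add_one (x i)], by linarith [Int.le_ceil (x i)]⟩

lemma setIntegral_unitCube (G : (ι → ℝ) → ℂ) (l : ι → ℤ) :
    ∫ x in unitCube l, G x = ∫ x in unitCube 0, G (x + fun i => (l i : ℝ)) := by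
  have hp : (fun x : ι → ℝ => x + fun i => (l i : ℝ)) ⁻¹' unitCube l = unitCube 0 := by
    ext x
    simp only [unitCube, mem_preimage, mem_ofPred_eq, mem_Ioc, Pi.add_apply, Pi.zero_apply,
      Int.cast_zero]
    refine forall_congr' fun i => ?_
    constructor <;> rintro ⟨h1, h2⟩ <;> constructor <;> linarith
  rw [← hp, (measurePreserving_add_right volume _).setIntegral_preimage_emb
    (measurableEmbedding_addRight _)]

/-- **Poisson summation** for the lattice `ℤ^ι` in `ℝ^ι`. -/
theorem tsum_eq_tsum_integral_pi {f : (ι → ℝ) → ℂ} (hf : Continuous f) (hi : Integrable f)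
    (hu : ∀ R : ℝ, ∃ u : (ι → ℤ) → ℝ, Summable u ∧
      ∀ x : ι → ℝ, ‖x‖ ≤ R → ∀ l : ι → ℤ, ‖f (x + fun i => (l i : ℝ))‖ ≤ u l)
    (hs : Summable fun m : ι → ℤ => ∫ y, f y * e (-((∑ i, m i * y i : ℝ) : ℂ)))
    (x : ι → ℝ) :
    ∑' l : ι → ℤ, f (x + fun i => (l i : ℝ)) =
      ∑' m : ι → ℤ, (∫ y, f y * e (-((∑ i, m i * y i : ℝ) : ℂ))) *
        e ((∑ i, m i * x i : ℝ) : ℂ) := by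
  -- The periodization. Locally uniform summability makes it continuous, and it descends to the
  -- torus as `F₀` through representatives in `[0, 1)`.
  set P : (ι → ℝ) → ℂ := fun x => ∑' l : ι → ℤ, f (x + fun i => (l i : ℝ)) with hP
  have hPc : Continuous P := by
    rw [continuous_iff_continuousAt]
    intro x₀
    obtain ⟨u, hu1, hu2⟩ := hu (‖x₀‖ + 1)
    have : ContinuousOn P (Metric.closedBall x₀ 1) :=
      continuousOn_tsum (fun l => Continuous.continuousOn (by fun_prop)) hu1 fun l y hy =>
        hu2 y (by
          have := norm_le_norm_add_norm_sub x₀ y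
          rw [Metric.mem_closedBall, dist_comm, dist_eq_norm] at hy
          linarith) l
    exact this.continuousAt (Metric.closedBall_mem_nhds x₀ one_pos)
  have hPp : ∀ (x : ι → ℝ) (k : ι → ℤ), P (x + fun i => (k i : ℝ)) = P x := by
    intro x k
    rw [hP]
    simp only
    rw [← (Equiv.addLeft k).tsum_eq fun l : ι → ℤ => f (x + fun i => (l i : ℝ))]
    refine tsum_congr fun l => congrArg f ?_
    ext i
    simp [add_assoc]
  set F₀ : UnitAddTorus ι → ℂ := fun θ => P fun i => (AddCircle.equivIco (1 : ℝ) 0 (θ i) : ℝ) with hF₀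
  have hF : ∀ x, F₀ (toTorus x) = P x := by
    intro x
    have : x = (fun i => Int.fract (x i)) + fun i => ((⌊x i⌋ : ℤ) : ℝ) := by
      ext i; simp
    conv_rhs => rw [this, hPp (fun i => Int.fract (x i)) fun i => ⌊x i⌋]
    simp only [hF₀, toTorus]
    congr 1
    ext i
    rw [AddCircle.coe_equivIco_mk_apply]
    simp
  have hFc : Continuous F₀ := by
    rw [isOpenQuotientMap_toTorus.isQuotientMap.continuous_iff]
    exact hPc.congr fun x => (hF x).symm
  set F : C(UnitAddTorus ι, ℂ) := ⟨F₀, hFc⟩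
  -- Unfolding: the unit cubes tile the space, and the character is invariant under integer
  -- translations.
  have hcoef : ∀ m : ι → ℤ, UnitAddTorus.mFourierCoeff F m =
      ∫ y, f y * e (-((∑ i, m i * y i : ℝ) : ℂ)) := by
    intro m
    set G : (ι → ℝ) → ℂ := fun y => f y * e (-((∑ i, m i * y i : ℝ) : ℂ)) with hG
    have hnorm : ∀ y, ‖G y‖ = ‖f y‖ := fun y => by
      rw [hG]; simp only
      rw [norm_mul, ← Complex.ofReal_neg, norm_e_ofReal, mul_one]
    have hGc : Continuous G := hf.mul (continuous_e.comp (by fun_prop))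
    have hGi : Integrable G := hi.mono hGc.aestronglyMeasurable (.of_forall fun y => (hnorm y).le)
    have hsplit : HasSum (fun l => ∫ x in unitCube l, G x) (∫ y, G y) := by
      have := hasSum_integral_iUnion (f := G) (μ := volume) (s := unitCube (ι := ι))
        measurableSet_unitCube pairwise_disjoint_unitCube hGi.integrableOn
      rwa [iUnion_unitCube, setIntegral_univ] at this
    have hvol : volume (unitCube (0 : ι → ℤ)) < ⊤ := by
      have : unitCube (0 : ι → ℤ) = Set.univ.pi fun _ => Ioc (0 : ℝ) 1 := by
        ext x; simp [unitCube, Set.mem_pi]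
      rw [this, Real.volume_pi_Ioc]
      simp
    obtain ⟨u, hu1, hu2⟩ := hu 1
    have hb : ∀ l : ι → ℤ, ∀ x ∈ unitCube (0 : ι → ℤ), ‖G (x + fun i => (l i : ℝ))‖ ≤ u l := by
      intro l x hx
      rw [hnorm]
      refine hu2 x ((pi_norm_le_iff_of_nonneg zero_le_one).2 fun i => ?_) l
      have := hx i
      simp only [Pi.zero_apply, Int.cast_zero, zero_add, mem_Ioc] at this
      rw [Real.norm_eq_abs, abs_le]
      constructor <;> linarith
    have hGl : ∀ l : ι → ℤ, IntegrableOn (fun x => G (x + fun i => (l i : ℝ))) (unitCube 0) :=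
      fun l => (hGi.comp_add_right _).integrableOn
    have hswap := integral_tsum_of_summable_integral_norm
      (F := fun (l : ι → ℤ) x => G (x + fun i => (l i : ℝ)))
      (μ := volume.restrict (unitCube (0 : ι → ℤ))) hGl (by
        refine Summable.of_norm_bounded (hu1.mul_right (volume.real (unitCube (0 : ι → ℤ))))
          fun l => ?_
        refine norm_setIntegral_le_of_norm_le_const hvol fun x hx => ?_
        rw [norm_norm]; exact hb l x hx)
    rw [UnitAddTorus.mFourierCoeff_eq_integral (F : UnitAddTorus ι → ℂ) m 0, ← hsplit.tsum_eq]
    simp_rw [setIntegral_unitCube G]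
    rw [hswap]
    have hset : {x : ι → ℝ | ∀ i, x i ∈ Ioc ((0 : ι → ℝ) i) ((0 : ι → ℝ) i + 1)} =
        unitCube (0 : ι → ℤ) := by
      ext x; simp [unitCube]
    rw [hset]
    congr 1
    ext x
    change UnitAddTorus.mFourier (-m) (toTorus x) • F₀ (toTorus x) = _
    rw [hF, mFourier_toTorus, smul_eq_mul, hP]
    simp only
    rw [← tsum_mul_left]
    refine tsum_congr fun l => ?_
    rw [hG]
    simp only
    rw [mul_comm]
    congr 1
    have : (-((∑ i, (m i : ℝ) * (x + fun i => (l i : ℝ)) i : ℝ) : ℂ)) =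
        ((∑ i, ((-m) i : ℤ) * x i : ℝ) : ℂ) + ((-∑ i, m i * l i : ℤ) : ℂ) := by
      push_cast
      simp [mul_add, Finset.sum_add_distrib]
      ring
    rw [this, e_add, e_intCast, mul_one]
  -- Summable coefficients make the Fourier series converge to the continuous function `F` at every
  -- point, not only in mean square.
  have hmain := UnitAddTorus.hasSum_mFourier_series_apply_of_summable (f := F)
    (by simpa only [funext hcoef] using hs) (toTorus x)
  have : F (toTorus x) = P x := hF x
  rw [this] at hmain
  refine hmain.tsum_eq.symm.trans (tsum_congr fun m => ?_)
  rw [hcoef, mFourier_toTorus, smul_eq_mul]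

end PoissonPi

end IndefTheta

end

noncomputable section

namespace IndefTheta

open MeasureTheory Filter Topology Set Module

set_option linter.unusedSectionVars false

/-! ### Gaussian sums over lattices and Poisson summation for a lattice and its dual -/

section Lattice

variable {V : Type*} [NormedAddCommGroup V] [NormedSpace ℝ V] [FiniteDimensional ℝ V]

lemma exp_neg_le_factorial_mul_inv_pow {x : ℝ} (hx : 0 < x) (m : ℕ) :
    Real.exp (-x) ≤ m.factorial * x⁻¹ ^ m := by
  rw [Real.exp_neg, inv_pow, ← div_eq_mul_inv, le_div_iff₀ (by positivity),
    inv_mul_le_iff₀ (Real.exp_pos x), ← div_le_iff₀ (by positivity)]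
  exact Real.pow_div_factorial_le_exp x hx.le m

lemma summable_exp_neg_sq (L : Submodule ℤ V) [DiscreteTopology L] {δ : ℝ} (hδ : 0 < δ) :
    Summable fun z : L => Real.exp (-(δ * ‖(z : V)‖ ^ 2)) := by
  -- Comparison with `‖z‖` to the power `-2m`, which is summable because `2m` exceeds the rank. The
  -- point `z = 0` is the only one where the comparison may fail.
  set m := Module.finrank ℤ L + 1 with hm
  have h1 := (ZLattice.summable_norm_pow_inv L (2 * m) (by omega)).mul_left
    (m.factorial * δ⁻¹ ^ m : ℝ)
  refine Summable.of_norm_bounded_eventually h1 ?_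
  have : {z : L | ¬ ‖Real.exp (-(δ * ‖(z : V)‖ ^ 2))‖ ≤ m.factorial * δ⁻¹ ^ m * ‖z‖⁻¹ ^ (2 * m)} ⊆
      {0} := by
    intro z hz
    by_contra hz0
    apply hz
    have hz1 : 0 < ‖(z : V)‖ := norm_pos_iff.2 (by simpa using hz0)
    rw [Real.norm_eq_abs, abs_of_pos (Real.exp_pos _)]
    refine (exp_neg_le_factorial_mul_inv_pow (by positivity) m).trans (le_of_eq ?_)
    rw [mul_inv, mul_pow, pow_mul, inv_pow ‖z‖, mul_assoc]
    rfl
  exact (Set.finite_singleton (0 : L)).subset this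

lemma exp_neg_sq_add_le (z x : V) {δ : ℝ} (hδ : 0 < δ) :
    Real.exp (-(δ * ‖x + z‖ ^ 2)) ≤
      Real.exp (δ * ‖x‖ ^ 2) * Real.exp (-(δ / 2 * ‖z‖ ^ 2)) := by
  rw [← Real.exp_add, Real.exp_le_exp]
  have h : ‖z‖ ≤ ‖x + z‖ + ‖x‖ := by
    have := norm_sub_le (x + z) x
    simpa using this
  have h2 : ‖z‖ ^ 2 ≤ 2 * ‖x + z‖ ^ 2 + 2 * ‖x‖ ^ 2 := by
    nlinarith [norm_nonneg z, sq_nonneg (‖x + z‖ - ‖x‖)]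
  nlinarith

variable {ι : Type*} [Fintype ι]

/-- Integer vectors as points of the lattice spanned by a basis. -/
def spanEquiv (b : Basis ι ℝ V) {L : Submodule ℤ V} (hb : Submodule.span ℤ (range b) = L) :
    (ι → ℤ) ≃ L :=
  (b.restrictScalars ℤ).equivFun.symm.toEquiv.trans (LinearEquiv.ofEq _ _ hb).toEquiv

lemma coe_spanEquiv (b : Basis ι ℝ V) {L : Submodule ℤ V} (hb : Submodule.span ℤ (range b) = L)
    (m : ι → ℤ) : (spanEquiv b hb m : V) = b.equivFun.symm fun i => (m i : ℝ) := by
  simp [spanEquiv, Basis.equivFun_symm_apply, Int.cast_smul_eq_zsmul]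

lemma integrable_exp_neg_sq_pi {δ : ℝ} (hδ : 0 < δ) :
    Integrable fun y : ι → ℝ => Real.exp (-(δ * ∑ i, y i ^ 2)) := by
  have : (fun y : ι → ℝ => Real.exp (-(δ * ∑ i, y i ^ 2))) =
      fun y => ∏ i, Real.exp (-δ * y i ^ 2) := by
    ext y; rw [← Real.exp_sum, Finset.mul_sum, ← Finset.sum_neg_distrib]; simp
  rw [this]
  exact Integrable.fintype_prod fun _ => integrable_exp_neg_mul_sq hδ

lemma exists_sum_sq_le (b : Basis ι ℝ V) :
    ∃ K, 0 < K ∧ ∀ y : ι → ℝ, K * ∑ i, y i ^ 2 ≤ ‖b.equivFun.symm y‖ ^ 2 := by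
  obtain ⟨M, hM, hb⟩ := (b.equivFunL.toContinuousLinearMap).bound
  -- Each coordinate is bounded by `M` times the norm. The added `1` keeps the constant positive for
  -- an empty index set.
  refine ⟨((Fintype.card ι + 1) * M ^ 2)⁻¹, by positivity, fun y => ?_⟩
  rw [inv_mul_le_iff₀ (by positivity)]
  have h1 : ‖y‖ ≤ M * ‖b.equivFun.symm y‖ := by
    have := hb (b.equivFun.symm y)
    have e1 : b.equivFunL.toContinuousLinearMap (b.equivFun.symm y) = y :=
      b.equivFun.apply_symm_apply y
    rwa [e1] at this
  have h2 : ∀ i, y i ^ 2 ≤ M ^ 2 * ‖b.equivFun.symm y‖ ^ 2 := fun i => by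
    rw [← mul_pow, ← sq_abs]
    exact pow_le_pow_left₀ (abs_nonneg _) ((norm_le_pi_norm y i).trans h1) 2
  calc ∑ i, y i ^ 2 ≤ ∑ _i : ι, M ^ 2 * ‖b.equivFun.symm y‖ ^ 2 := Finset.sum_le_sum fun i _ => h2 i
    _ = Fintype.card ι * (M ^ 2 * ‖b.equivFun.symm y‖ ^ 2) := by simp
    _ ≤ _ := by
      have : 0 ≤ M ^ 2 * ‖b.equivFun.symm y‖ ^ 2 := by positivity
      nlinarith

lemma continuous_equivFun_symm (b : Basis ι ℝ V) : Continuous b.equivFun.symm :=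
  b.equivFunL.symm.continuous

lemma integrable_of_gaussian_bound (b : Basis ι ℝ V) {f : V → ℂ} (hf : Continuous f) {C δ : ℝ}
    (hδ : 0 < δ) (h : ∀ y, ‖f y‖ ≤ C * Real.exp (-(δ * ‖y‖ ^ 2))) :
    Integrable fun y : ι → ℝ => f (b.equivFun.symm y) := by
  obtain ⟨K, hK, hb⟩ := exists_sum_sq_le b
  have hC : 0 ≤ C := by simpa using (norm_nonneg _).trans (h 0)
  refine ((integrable_exp_neg_sq_pi (ι := ι) (mul_pos hδ hK)).const_mul C).mono'
    (hf.comp (continuous_equivFun_symm b)).aestronglyMeasurable (.of_forall fun y => ?_)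
  refine (h _).trans ?_
  refine mul_le_mul_of_nonneg_left (Real.exp_le_exp.2 ?_) hC
  nlinarith [hb y]

variable {B : LinearMap.BilinForm ℝ V}

/-- The Fourier transform with respect to `B`, for the Lebesgue measure of a basis. -/
def fourierB (B : LinearMap.BilinForm ℝ V) (b : Basis ι ℝ V) (f : V → ℂ) (w : V) : ℂ :=
  ∫ y : ι → ℝ, f (b.equivFun.symm y) * e (-(B w (b.equivFun.symm y) : ℂ))

lemma summable_lattice_of_gaussian_bound (L : Submodule ℤ V) [DiscreteTopology L] {f : V → ℂ}
    {C δ : ℝ} (hδ : 0 < δ) (h : ∀ y, ‖f y‖ ≤ C * Real.exp (-(δ * ‖y‖ ^ 2))) (x : V) :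
    Summable fun l : L => ‖f (x + l)‖ := by
  have hC : 0 ≤ C := by simpa using (norm_nonneg _).trans (h 0)
  refine Summable.of_nonneg_of_le (fun _ => norm_nonneg _) (fun l => ?_)
    ((summable_exp_neg_sq L (half_pos hδ)).mul_left (C * Real.exp (δ * ‖x‖ ^ 2)))
  refine (h _).trans ?_
  rw [mul_assoc]
  gcongr
  exact exp_neg_sq_add_le _ _ hδ

lemma discreteTopology_span (b : Basis ι ℝ V) {L : Submodule ℤ V}
    (hb : Submodule.span ℤ (range b) = L) : DiscreteTopology L := by
  subst hb; infer_instance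

/-- **Poisson summation** for a lattice and its dual with respect to a nondegenerate form. -/
theorem tsum_lattice_eq_tsum_dual (hN : B.Nondegenerate) (b : Basis ι ℝ V)
    {Λ : Submodule ℤ V} (hb : Submodule.span ℤ (range b) = Λ) {f : V → ℂ} (hf : Continuous f)
    {C δ C' δ' : ℝ} (hδ : 0 < δ) (hδ' : 0 < δ')
    (h : ∀ y, ‖f y‖ ≤ C * Real.exp (-(δ * ‖y‖ ^ 2)))
    (h' : ∀ w, ‖fourierB B b f w‖ ≤ C' * Real.exp (-(δ' * ‖w‖ ^ 2))) (x : V) :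
    ∑' l : Λ, f (x + l) = ∑' w : B.dualSubmodule Λ, fourierB B b f w * e (B w x : ℂ) := by
  classical
  have hC : 0 ≤ C := by simpa using (norm_nonneg _).trans (h 0)
  -- In the bases `b` of `V` and `b'` of the dual lattice, the pairing by `B` is the standard dot
  -- product, so the statement becomes Poisson summation for `ℤ^ι`.
  set b' := B.dualBasis hN b with hb'
  have hd : Submodule.span ℤ (range b') = B.dualSubmodule Λ := by
    rw [← hb, LinearMap.BilinForm.dualSubmodule_span_of_basis B hN]
  have := discreteTopology_span b hb
  have := discreteTopology_span b' hd
  have hpair : ∀ (m : ι → ℤ) (y : ι → ℝ),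
      B (b'.equivFun.symm fun i => (m i : ℝ)) (b.equivFun.symm y) = ∑ i, m i * y i := by
    intro m y
    simp only [Basis.equivFun_symm_apply, map_sum, map_smul, LinearMap.sum_apply,
      LinearMap.smul_apply, smul_eq_mul, hb', LinearMap.BilinForm.apply_dualBasis_left]
    simp [mul_comm]
  have hfou : ∀ m : ι → ℤ, fourierB B b f (b'.equivFun.symm fun i => (m i : ℝ)) =
      ∫ y : ι → ℝ, f (b.equivFun.symm y) * e (-((∑ i, m i * y i : ℝ) : ℂ)) := by
    intro m
    simp only [fourierB, hpair]
  have hmain := tsum_eq_tsum_integral_pi (f := fun y => f (b.equivFun.symm y))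
    (hf.comp (continuous_equivFun_symm b)) (integrable_of_gaussian_bound b hf hδ h)
    (by
      intro R
      obtain ⟨M, hM, hMb⟩ := (b.equivFunL.symm.toContinuousLinearMap).bound
      have hs := (summable_exp_neg_sq Λ (half_pos hδ)).mul_left (C * Real.exp (δ * (M * R) ^ 2))
      refine ⟨_, (spanEquiv b hb).summable_iff.2 hs, fun y hy l => ?_⟩
      have e1 : b.equivFun.symm (y + fun i => (l i : ℝ)) =
          b.equivFun.symm y + (spanEquiv b hb l : V) := by
        rw [map_add, coe_spanEquiv]
      simp only [e1, Function.comp]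
      refine (h _).trans ?_
      rw [mul_assoc]
      refine mul_le_mul_of_nonneg_left ((exp_neg_sq_add_le _ _ hδ).trans ?_) hC
      have h3 : ‖b.equivFun.symm y‖ ≤ M * R :=
        (hMb y).trans (mul_le_mul_of_nonneg_left hy hM.le)
      gcongr)
    (by
      simp_rw [← hfou]
      have := summable_lattice_of_gaussian_bound (B.dualSubmodule Λ) hδ' h' 0
      simp only [zero_add] at this
      refine Summable.of_norm (((spanEquiv b' hd).summable_iff.2 this).congr fun m => ?_)
      rw [Function.comp, coe_spanEquiv])
    (b.equivFun x)
  rw [← (spanEquiv b hb).tsum_eq, ← (spanEquiv b' hd).tsum_eq]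
  refine Eq.trans (tsum_congr fun l => ?_) (hmain.trans (tsum_congr fun m => ?_))
  · rw [coe_spanEquiv, map_add, LinearEquiv.symm_apply_apply]
  · rw [coe_spanEquiv, hfou]
    congr 2
    have := hpair m (b.equivFun x)
    rw [LinearEquiv.symm_apply_apply] at this
    rw [this]

end Lattice

end IndefTheta

end

noncomputable section

namespace IndefTheta

open MeasureTheory Filter Topology Set Module

set_option linter.unusedSectionVars false

/-! ### Bases adapted to a positive plane; Gaussian integrals -/

section Adapted

variable {V : Type*} [NormedAddCommGroup V] [NormedSpace ℝ V] [FiniteDimensional ℝ V]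
  {B : LinearMap.BilinForm ℝ V} {ι : Type*} [Fintype ι] [DecidableEq ι]

lemma integral_basis_change (b c : Basis ι ℝ V) {F : V → ℂ} (hF : Continuous F) :
    ∫ y : ι → ℝ, F (b.equivFun.symm y) =
      (|(c.toMatrix b).det|⁻¹ : ℝ) * ∫ y : ι → ℝ, F (c.equivFun.symm y) := by
  have hdet : (c.toMatrix b).det ≠ 0 := by
    have h := congrArg Matrix.det (c.toMatrix_mul_toMatrix_flip b)
    rw [Matrix.det_mul, Matrix.det_one] at h
    exact left_ne_zero_of_mul_eq_one h
  have hT : ∀ y : ι → ℝ, b.equivFun.symm y =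
      c.equivFun.symm (Matrix.toLin' (c.toMatrix b) y) := by
    intro y
    apply c.equivFun.injective
    rw [LinearEquiv.apply_symm_apply, Matrix.toLin'_apply]
    have := Basis.toMatrix_mulVec_repr b c (b.equivFun.symm y)
    ext i
    rw [Basis.equivFun_apply, ← this]
    congr 2
    ext j
    rw [← Basis.equivFun_apply, LinearEquiv.apply_symm_apply]
  simp_rw [hT]
  have hmap := Real.map_matrix_volume_pi_eq_smul_volume_pi hdet
  have hcont : Continuous (Matrix.toLin' (c.toMatrix b)) := LinearMap.continuous_on_pi _
  have hm := integral_map (μ := volume) (f := fun y => F (c.equivFun.symm y))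
    (φ := Matrix.toLin' (c.toMatrix b)) hcont.measurable.aemeasurable
    ((hF.comp (continuous_equivFun_symm c)).aestronglyMeasurable)
  rw [← hm, hmap, integral_smul_measure, ENNReal.toReal_ofReal (abs_nonneg _), abs_inv,
    Complex.real_smul]

/-- A basis diagonalizing `B` with entries `1` on the positive plane spanned by `C₁, C₂` and `-1`
on its orthogonal complement. -/
structure IsAdapted (B : LinearMap.BilinForm ℝ V) (C₁ C₂ : V) (c : Basis ι ℝ V) (I : Finset ι) :
    Prop where
  card : I.card = 2
  ortho : ∀ i j, i ≠ j → B (c i) (c j) = 0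
  sq_of_mem : ∀ i ∈ I, B (c i) (c i) = 1
  sq_of_notMem : ∀ i ∉ I, B (c i) (c i) = -1
  plane : ∀ y, unitForm B C₁ y ^ 2 + unitForm B (perp B C₂ C₁) y ^ 2 = ∑ i ∈ I, c.equivFun y i ^ 2

variable {C₁ C₂ : V}

/-- In the adapted basis the Gram determinant is a product of signs, so in `b` it is, up to sign,
the square of the change-of-basis determinant. This relates the Jacobian to the discriminant. -/
lemma IsAdapted.sqrt_abs_det {c : Basis ι ℝ V} {I : Finset ι} (h : IsAdapted B C₁ C₂ c I)
    (b : Basis ι ℝ V) :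
    √|(LinearMap.BilinForm.toMatrix b B).det| = |(c.toMatrix b).det| := by
  have h1 := congrArg Matrix.det (LinearMap.BilinForm.toMatrix_mul_basis_toMatrix c b B)
  have h2 : LinearMap.BilinForm.toMatrix c B = Matrix.diagonal fun i => B (c i) (c i) := by
    ext i j
    rw [LinearMap.BilinForm.toMatrix_apply, Matrix.diagonal_apply]
    split_ifs with hij
    · rw [hij]
    · exact h.ortho i j hij
  have h3 : |∏ i, B (c i) (c i)| = 1 := by
    rw [Finset.abs_prod]
    refine Finset.prod_eq_one fun i _ => ?_
    by_cases hi : i ∈ I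
    · rw [h.sq_of_mem i hi]; simp
    · rw [h.sq_of_notMem i hi]; simp
  rw [Matrix.det_mul, Matrix.det_mul, Matrix.det_transpose, h2, Matrix.det_diagonal] at h1
  rw [← h1, abs_mul, abs_mul, h3, mul_one, ← sq, Real.sqrt_sq (abs_nonneg _)]

lemma IsAdapted.bilin_eq {c : Basis ι ℝ V} {I : Finset ι} (h : IsAdapted B C₁ C₂ c I) (w y : V) :
    B w y = ∑ i, (if i ∈ I then 1 else -1) * (c.equivFun w i * c.equivFun y i) := by
  conv_lhs => rw [← c.sum_equivFun w, ← c.sum_equivFun y]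
  simp only [map_sum, map_smul, LinearMap.sum_apply, LinearMap.smul_apply, smul_eq_mul]
  refine Finset.sum_congr rfl fun i _ => ?_
  rw [Finset.sum_eq_single i]
  · split_ifs with hi
    · rw [h.sq_of_mem i hi]; ring
    · rw [h.sq_of_notMem i hi]; ring
  · intro j _ hj
    rw [h.ortho j i hj]; ring
  · simp

/-- Normalize `C₁` and the component of `C₂` orthogonal to it. The complement of the plane is
negative definite, so an orthogonal basis of it can be normalized to squares `-1`. -/
lemma exists_isAdapted (hB : B.IsSymm) (hsig : HasTwoPositive B) (h : PosPair B C₁ C₂)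
    (b : Basis ι ℝ V) : ∃ (c : Basis ι ℝ V) (I : Finset ι), IsAdapted B C₁ C₂ c I := by
  set f := perp B C₂ C₁ with hf
  have hf0 : 0 < B f f := h.perp_pos hB
  have hC := h.fst
  have hCf : B C₁ f = 0 := perp_apply_self hB _ hC.ne'
  have hfC : B f C₁ = 0 := by rw [hB.eq]; exact hCf
  -- the orthogonal complement of the plane and an orthogonal basis of it
  set W : Submodule ℝ V := LinearMap.ker (B C₁) ⊓ LinearMap.ker (B f) with hW
  have hWmem : ∀ {x}, x ∈ W ↔ B C₁ x = 0 ∧ B f x = 0 := by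
    intro x; simp [hW]
  have hWneg : ∀ x ∈ W, x ≠ 0 → B x x < 0 := by
    intro x hx hx0
    obtain ⟨h1, h2⟩ := hWmem.1 hx
    refine hsig h h1 ?_ hx0
    rw [hf, perp_apply_left, h1] at h2
    linarith
  obtain ⟨m, v, hv⟩ : ∃ (m : ℕ) (v : Basis (Fin m) ℝ W), LinearMap.IsOrthoᵢ (B.restrict W) v :=
    ⟨_, LinearMap.BilinForm.exists_orthogonal_basis
      (LinearMap.BilinForm.isSymm_iff.1 (LinearMap.BilinForm.IsSymm.restrict hB W))⟩
  have hvo : ∀ i j, i ≠ j → B (v i) (v j) = 0 := fun i j hij => hv hij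
  have hvn : ∀ i, B (v i) (v i) < 0 := fun i =>
    hWneg _ (v i).2 (by simpa using v.ne_zero i)
  set u : Bool ⊕ Fin m → V := Sum.elim
    (fun t => cond t ((√(B C₁ C₁))⁻¹ • C₁) ((√(B f f))⁻¹ • f))
    (fun j => (√(-B (v j) (v j)))⁻¹ • (v j : V)) with hu
  have uo : ∀ i j, i ≠ j → B (u i) (u j) = 0 := by
    have a1 : ∀ j, B C₁ (v j) = 0 := fun j => (hWmem.1 (v j).2).1
    have a2 : ∀ j, B f (v j) = 0 := fun j => (hWmem.1 (v j).2).2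
    have a3 : ∀ j, B (v j) C₁ = 0 := fun j => by rw [hB.eq]; exact a1 j
    have a4 : ∀ j, B (v j) f = 0 := fun j => by rw [hB.eq]; exact a2 j
    rintro (i | i) (j | j) hij
    · cases i <;> cases j <;> simp_all
    · cases i <;> simp [hu, a1, a2]
    · cases j <;> simp [hu, a3, a4]
    · simp [hu, hvo i j (by simpa using hij)]
  have up : ∀ t, B (u (Sum.inl t)) (u (Sum.inl t)) = 1 := by
    intro t
    have q1 := Real.sq_sqrt hC.le
    have q2 := Real.sq_sqrt hf0.le
    have p1 := Real.sqrt_pos.2 hC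
    have p2 := Real.sqrt_pos.2 hf0
    cases t
    · simp only [hu, Sum.elim_inl, cond_false, map_smul, LinearMap.smul_apply, smul_eq_mul]
      field_simp
      exact q2.symm
    · simp only [hu, Sum.elim_inl, cond_true, map_smul, LinearMap.smul_apply, smul_eq_mul]
      field_simp
      exact q1.symm
  have un : ∀ j, B (u (Sum.inr j)) (u (Sum.inr j)) = -1 := by
    intro j
    have hj : 0 < -B (v j) (v j) := by linarith [hvn j]
    have q := Real.sq_sqrt hj.le
    have p := Real.sqrt_pos.2 hj
    simp only [hu, Sum.elim_inr, map_smul, LinearMap.smul_apply, smul_eq_mul]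
    field_simp
    rw [q]; ring
  have us : ∀ i, B (u i) (u i) ≠ 0 := by
    rintro (t | j)
    · rw [up]; norm_num
    · rw [un]; norm_num
  have hli : LinearIndependent ℝ u := by
    rw [Fintype.linearIndependent_iff]
    intro g hg i
    have := congrArg (B (u i)) hg
    rw [map_sum, Finset.sum_eq_single i, map_zero, map_smul, smul_eq_mul] at this
    · exact (mul_eq_zero.1 this).resolve_right (us i)
    · intro j _ hj
      rw [map_smul, uo i j hj.symm, smul_zero]
    · simp
  have hsp : ⊤ ≤ Submodule.span ℝ (range u) := by
    intro y _
    have m1 : C₁ ∈ Submodule.span ℝ (range u) := by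
      have : C₁ = √(B C₁ C₁) • u (Sum.inl true) := by
        simp [hu, smul_smul, (Real.sqrt_pos.2 hC).ne']
      rw [this]
      exact Submodule.smul_mem _ _ (Submodule.subset_span ⟨_, rfl⟩)
    have m2 : f ∈ Submodule.span ℝ (range u) := by
      have : f = √(B f f) • u (Sum.inl false) := by
        simp [hu, smul_smul, (Real.sqrt_pos.2 hf0).ne']
      rw [this]
      exact Submodule.smul_mem _ _ (Submodule.subset_span ⟨_, rfl⟩)
    have m3 : ∀ x ∈ W, x ∈ Submodule.span ℝ (range u) := by
      intro x hx
      have e1 := congrArg Subtype.val (v.sum_repr ⟨x, hx⟩)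
      change _ = x at e1
      rw [← e1]
      simp only [AddSubmonoidClass.coe_finsetSum, Submodule.coe_smul]
      refine Submodule.sum_mem _ fun j _ => Submodule.smul_mem _ _ ?_
      have : (v j : V) = √(-B (v j) (v j)) • u (Sum.inr j) := by
        have hj : 0 < -B (v j) (v j) := by linarith [hvn j]
        simp [hu, smul_smul, (Real.sqrt_pos.2 hj).ne']
      rw [this]
      exact Submodule.smul_mem _ _ (Submodule.subset_span ⟨_, rfl⟩)
    have hw : perp B (perp B y C₁) f ∈ W :=
      hWmem.2 ⟨perp_perp_fst hB h y, perp_apply_self hB _ hf0.ne'⟩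
    have : y = perp B (perp B y C₁) f + (B (perp B y C₁) f / B f f) • f +
        (B y C₁ / B C₁ C₁) • C₁ := by
      simp [perp]
    rw [this]
    exact add_mem (add_mem (m3 _ hw) (Submodule.smul_mem _ _ m2)) (Submodule.smul_mem _ _ m1)
  set c₀ : Basis (Bool ⊕ Fin m) ℝ V := Basis.mk hli hsp with hc₀
  set σ := c₀.indexEquiv b
  have hc : ∀ i, (c₀.reindex σ) i = u (σ.symm i) := fun i => by
    rw [Basis.reindex_apply, hc₀, Basis.mk_apply]
  refine ⟨c₀.reindex σ, Finset.univ.map (Function.Embedding.inl.trans σ.toEmbedding), ?_, ?_, ?_,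
    ?_, ?_⟩
  · simp
  · intro i j hij
    rw [hc, hc]
    exact uo _ _ (by simpa using hij)
  · intro i hi
    obtain ⟨t, -, rfl⟩ := Finset.mem_map.1 hi
    rw [hc]
    simpa using up t
  · intro i hi
    rw [hc]
    rcases hs : σ.symm i with t | j
    · exfalso
      apply hi
      refine Finset.mem_map.2 ⟨t, Finset.mem_univ _, ?_⟩
      simp [← hs]
    · exact un j
  · intro y
    rw [Finset.sum_map]
    have hrep : ∀ t, (c₀.reindex σ).equivFun y (σ (Sum.inl t)) = B (u (Sum.inl t)) y := by
      intro t
      rw [Basis.equivFun_apply, Basis.repr_reindex_apply, Equiv.symm_apply_apply]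
      conv_rhs => rw [← c₀.sum_repr y]
      rw [map_sum, Finset.sum_eq_single (Sum.inl t)]
      · rw [map_smul, hc₀, Basis.mk_apply, up]; simp
      · intro j _ hj
        rw [map_smul, hc₀, Basis.mk_apply, uo _ _ hj.symm, smul_zero]
      · simp
    have : ∀ t, (c₀.reindex σ).equivFun y
        ((Function.Embedding.inl.trans σ.toEmbedding) t) = B (u (Sum.inl t)) y := hrep
    simp_rw [this]
    rw [Fintype.sum_bool]
    simp [hu, unitForm, div_eq_inv_mul, ← hf]

end Adapted

end IndefTheta

end

noncomputable section

namespace IndefTheta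

open MeasureTheory Filter Topology Set Module

set_option linter.unusedSectionVars false

/-! ### Fourier transforms of Gaussians attached to a positive plane -/

section FourierGauss

variable {V : Type*} [NormedAddCommGroup V] [NormedSpace ℝ V] [FiniteDimensional ℝ V]
  {B : LinearMap.BilinForm ℝ V} {C₁ C₂ : V}

/-- The form `Q` on the plane spanned by `C₁, C₂`, composed with the orthogonal projection. -/
def planeSq (B : LinearMap.BilinForm ℝ V) (C₁ C₂ y : V) : ℝ :=
  unitForm B C₁ y ^ 2 + unitForm B (perp B C₂ C₁) y ^ 2

/-- The Gaussian with parameter `α` on the plane spanned by `C₁, C₂` and `β` on its orthogonal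
complement. -/
def planeGauss (B : LinearMap.BilinForm ℝ V) (C₁ C₂ : V) (α β : ℂ) (y : V) : ℂ :=
  Complex.exp (-(Real.pi * (α * (planeSq B C₁ C₂ y : ℂ) +
    β * ((planeSq B C₁ C₂ y - B y y : ℝ) : ℂ))))

lemma continuous_planeSq (C₁ C₂ : V) : Continuous (planeSq B C₁ C₂) :=
  ((contDiff_unitForm C₁).continuous.pow 2).add ((contDiff_unitForm _).continuous.pow 2)

lemma continuous_quadratic : Continuous fun y : V => B y y :=
  continuous_id.bilin continuous_id

lemma continuous_planeGauss (C₁ C₂ : V) (α β : ℂ) : Continuous (planeGauss B C₁ C₂ α β) := by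
  have h1 := continuous_planeSq (B := B) C₁ C₂
  have h2 := continuous_quadratic (B := B)
  exact Complex.continuous_exp.comp ((continuous_const.mul ((continuous_const.mul
    (Complex.continuous_ofReal.comp h1)).add (continuous_const.mul
      (Complex.continuous_ofReal.comp (h1.sub h2))))).neg)

lemma planeSq_sub_nonneg (hB : B.IsSymm) (hsig : HasTwoPositive B) (h : PosPair B C₁ C₂) (y : V) :
    0 ≤ planeSq B C₁ C₂ y - B y y := by
  have h1 := sq_eq_add_perp_sq hB h y
  have h2 := perp_perp_fst hB h y
  have h3 := perp_perp_snd hB h y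
  set u := perp B (perp B y C₁) (perp B C₂ C₁)
  have : B u u ≤ 0 := by
    by_cases hu : u = 0
    · simp [hu]
    · exact (hsig h h2 h3 hu).le
  rw [planeSq]
  linarith

lemma norm_planeGauss (C₁ C₂ : V) (α β : ℂ) (y : V) : ‖planeGauss B C₁ C₂ α β y‖ =
    Real.exp (-(Real.pi * (α.re * planeSq B C₁ C₂ y +
      β.re * (planeSq B C₁ C₂ y - B y y)))) := by
  rw [planeGauss, Complex.norm_exp]
  congr 1
  simp [Complex.mul_re, Complex.add_re]

lemma exists_planeGauss_bound (hB : B.IsSymm) (hsig : HasTwoPositive B) (h : PosPair B C₁ C₂)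
    {α β : ℂ} (hα : 0 < α.re) (hβ : 0 < β.re) :
    ∃ δ, 0 < δ ∧ ∀ y, ‖planeGauss B C₁ C₂ α β y‖ ≤ Real.exp (-(δ * ‖y‖ ^ 2)) := by
  obtain ⟨δ, hδ, hm⟩ := exists_majorant_bound (X := Unit) (S := univ) (f₁ := fun _ => C₁)
    (f₂ := fun _ => C₂) hB hsig isCompact_univ continuousOn_const continuousOn_const
    fun _ _ => h
  have hpi := Real.pi_pos
  set r := min α.re β.re with hr
  have hr0 : 0 < r := lt_min hα hβ
  refine ⟨Real.pi * (r * δ), by positivity, fun y => ?_⟩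
  rw [norm_planeGauss, Real.exp_le_exp, neg_le_neg_iff, mul_assoc]
  refine mul_le_mul_of_nonneg_left ?_ hpi.le
  have h1 := hm () (mem_univ _) y
  have h2 := planeSq_sub_nonneg hB hsig h y
  have h3 : 0 ≤ planeSq B C₁ C₂ y := by unfold planeSq; positivity
  have h4 : δ * ‖y‖ ^ 2 ≤ planeSq B C₁ C₂ y + (planeSq B C₁ C₂ y - B y y) := by
    unfold planeSq; linarith
  calc r * δ * ‖y‖ ^ 2 = r * (δ * ‖y‖ ^ 2) := by ring
    _ ≤ r * planeSq B C₁ C₂ y + r * (planeSq B C₁ C₂ y - B y y) := by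
        rw [← mul_add]; exact mul_le_mul_of_nonneg_left h4 hr0.le
    _ ≤ _ := add_le_add (mul_le_mul_of_nonneg_right (min_le_left _ _) h3)
        (mul_le_mul_of_nonneg_right (min_le_right _ _) h2)

variable {ι : Type*} [Fintype ι] [DecidableEq ι]

/-- The Fourier transform of a Gaussian attached to a positive plane. -/
lemma fourierB_planeGauss (hB : B.IsSymm) (hsig : HasTwoPositive B) (h : PosPair B C₁ C₂)
    (b : Basis ι ℝ V) {α β : ℂ} (hα : 0 < α.re) (hβ : 0 < β.re) (w : V) :
    fourierB B b (planeGauss B C₁ C₂ α⁻¹ β⁻¹) w =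
      ((√|(LinearMap.BilinForm.toMatrix b B).det|)⁻¹ : ℝ) *
        (α * (β ^ (1 / 2 : ℂ)) ^ (Fintype.card ι - 2) * planeGauss B C₁ C₂ α β w) := by
  obtain ⟨c, I, hc⟩ := exists_isAdapted hB hsig h b
  have hα0 : α ≠ 0 := fun h0 => by simp [h0] at hα
  have hβ0 : β ≠ 0 := fun h0 => by simp [h0] at hβ
  have hpi : (Real.pi : ℂ) ≠ 0 := by exact_mod_cast Real.pi_ne_zero
  have hre : ∀ z : ℂ, 0 < z.re → 0 < (z⁻¹).re := fun z hz => by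
    rw [Complex.inv_re]
    exact div_pos hz (Complex.normSq_pos.2 fun h0 => by simp [h0] at hz)
  have hsum : ∀ (a a' : ℂ) (y : V), a * (planeSq B C₁ C₂ y : ℂ) +
      a' * ((planeSq B C₁ C₂ y - B y y : ℝ) : ℂ) =
      ∑ i, (if i ∈ I then a else a') * (c.equivFun y i : ℂ) ^ 2 := by
    intro a a' y
    have h1 : planeSq B C₁ C₂ y = ∑ i, if i ∈ I then c.equivFun y i ^ 2 else 0 := by
      rw [planeSq, hc.plane, ← Finset.sum_filter]
      congr 1; ext; simp
    have h2 : planeSq B C₁ C₂ y - B y y = ∑ i, if i ∈ I then 0 else c.equivFun y i ^ 2 := by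
      rw [h1, hc.bilin_eq y y, ← Finset.sum_sub_distrib]
      refine Finset.sum_congr rfl fun i _ => ?_
      split_ifs <;> ring
    rw [h2, h1]
    push_cast
    rw [Finset.mul_sum, Finset.mul_sum, ← Finset.sum_add_distrib]
    refine Finset.sum_congr rfl fun i _ => ?_
    split_ifs <;> simp
  -- In adapted coordinates the integral is a product over `i` of one-dimensional Gaussian integrals
  -- with parameter `s i`.
  set s : ι → ℂ := fun i => if i ∈ I then α else β with hs
  have hs0 : ∀ i, s i ≠ 0 := fun i => by
    by_cases hi : i ∈ I <;> simp [hs, hi, hα0, hβ0]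
  have hsre : ∀ i, 0 < (Real.pi * (s i)⁻¹ : ℂ).re := fun i => by
    rw [Complex.re_ofReal_mul]
    refine mul_pos Real.pi_pos (hre _ ?_)
    by_cases hi : i ∈ I <;> simp [hs, hi, hα, hβ]
  have hcont : Continuous fun y : V => planeGauss B C₁ C₂ α⁻¹ β⁻¹ y * e (-(B w y : ℂ)) := by
    have h1 : Continuous fun y => B w y := continuous_const.bilin continuous_id
    exact (continuous_planeGauss _ _ _ _).mul (continuous_e.comp (by fun_prop))
  rw [fourierB, integral_basis_change b c hcont, hc.sqrt_abs_det]
  congr 1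
  have hint : ∀ y : ι → ℝ, planeGauss B C₁ C₂ α⁻¹ β⁻¹ (c.equivFun.symm y) *
      e (-(B w (c.equivFun.symm y) : ℂ)) =
      Complex.exp (-∑ i, (Real.pi * (s i)⁻¹) * (y i : ℂ) ^ 2 +
        ∑ i, (-(2 * Real.pi * Complex.I * (if i ∈ I then 1 else -1) * (c.equivFun w i : ℂ))) *
          (y i : ℂ)) := by
    intro y
    rw [planeGauss, hsum, e, ← Complex.exp_add, hc.bilin_eq w, LinearEquiv.apply_symm_apply]
    congr 1
    congr 1
    · rw [Finset.mul_sum]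
      congr 1
      refine Finset.sum_congr rfl fun i _ => ?_
      simp only [hs]
      split_ifs <;> ring
    · push_cast
      rw [← Finset.sum_neg_distrib, Finset.mul_sum]
      refine Finset.sum_congr rfl fun i _ => ?_
      split_ifs <;> push_cast <;> ring
  simp_rw [hint]
  rw [GaussianFourier.integral_cexp_neg_sum_mul_add hsre]
  have hterm : ∀ i, ((Real.pi : ℂ) / (Real.pi * (s i)⁻¹)) ^ (1 / 2 : ℂ) *
      Complex.exp ((-(2 * Real.pi * Complex.I * (if i ∈ I then 1 else -1) *
        (c.equivFun w i : ℂ))) ^ 2 / (4 * (Real.pi * (s i)⁻¹))) =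
      s i ^ (1 / 2 : ℂ) * Complex.exp (-(Real.pi * (s i * (c.equivFun w i : ℂ) ^ 2))) := by
    intro i
    have hi := hs0 i
    congr 2
    · field_simp
    · have : (if i ∈ I then (1 : ℂ) else -1) ^ 2 = 1 := by split_ifs <;> norm_num
      field_simp
      simp only [this, Complex.I_sq]
      ring
  simp_rw [hterm]
  rw [Finset.prod_mul_distrib, ← Complex.exp_sum, planeGauss, hsum]
  congr 1
  -- Two directions lie in the plane, so the principal roots of `α` multiply to `α`; the others give
  -- `card ι - 2` roots of `β`.
  · have h1 : ∀ i, s i ^ (1 / 2 : ℂ) = if i ∈ I then α ^ (1 / 2 : ℂ) else β ^ (1 / 2 : ℂ) := by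
      intro i; simp only [hs]; split_ifs <;> rfl
    simp_rw [h1]
    rw [Finset.prod_ite, Finset.prod_const, Finset.prod_const]
    have e1 : (Finset.univ.filter fun i => i ∈ I) = I := by ext; simp
    have e2 : (Finset.univ.filter fun i => i ∉ I).card = Fintype.card ι - 2 := by
      have : (Finset.univ.filter fun i => i ∉ I) = Iᶜ := by ext; simp
      rw [this, Finset.card_compl, hc.card]
    rw [e1, e2, hc.card, ← Complex.cpow_nat_mul]
    simp
  · rw [Finset.mul_sum, ← Finset.sum_neg_distrib]

end FourierGauss

end IndefTheta

end

noncomputable section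

namespace IndefTheta

open MeasureTheory Filter Topology Set Module

set_option linter.unusedSectionVars false

/-! ### Fourier transform of the mixed kernel -/

section FourierKernel

variable {V : Type*} [NormedAddCommGroup V] [NormedSpace ℝ V] [FiniteDimensional ℝ V]
  {B : LinearMap.BilinForm ℝ V} {C₁ C₂ : V} {ι : Type*} [Fintype ι]

lemma integral_eq_zero_of_hasDerivAt_line (b : Basis ι ℝ V) {G G' : V → ℂ} (v : V)
    (hG : Integrable fun y : ι → ℝ => G (b.equivFun.symm y))
    (hG' : Integrable fun y : ι → ℝ => G' (b.equivFun.symm y))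
    (h : ∀ y, HasDerivAt (fun t : ℝ => G (y + t • v)) (G' y) 0) :
    ∫ y : ι → ℝ, G' (b.equivFun.symm y) = 0 := by
  have := integral_bilinear_hasLineDerivAt_right_eq_neg_left_of_integrable
    (μ := (volume : Measure (ι → ℝ))) (f := fun _ => (1 : ℂ)) (f' := fun _ => (0 : ℂ))
    (g := fun y => G (b.equivFun.symm y)) (g' := fun y => G' (b.equivFun.symm y))
    (v := b.equivFun v) (B := ContinuousLinearMap.mul ℝ ℂ) (by simp) (by simpa using hG')
    (by simpa using hG) (fun x _ => hasDerivAt_const _ _) (fun x _ => by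
      have := h (b.equivFun.symm x)
      unfold HasLineDerivAt
      simpa only [map_add, map_smul, LinearEquiv.symm_apply_apply] using this)
  simpa using this

/-- Along directions orthogonal to the plane only `Q` varies, which is why the moments below involve
`β` and not `α`. -/
lemma planeSq_add_smul {v : V} (h1 : B C₁ v = 0) (h2 : B (perp B C₂ C₁) v = 0) (y : V) (t : ℝ) :
    planeSq B C₁ C₂ (y + t • v) = planeSq B C₁ C₂ y := by
  simp [planeSq, unitForm, h1, h2]

/-- The integrand of the Fourier transform of `planeGauss`. -/
def gaussWave (B : LinearMap.BilinForm ℝ V) (C₁ C₂ : V) (α β : ℂ) (w y : V) : ℂ :=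
  planeGauss B C₁ C₂ α β y * e (-(B w y : ℂ))

lemma hasDerivAt_gaussWave (hB : B.IsSymm) {v : V} (h1 : B C₁ v = 0)
    (h2 : B (perp B C₂ C₁) v = 0) (α β : ℂ) (w y : V) :
    HasDerivAt (fun t : ℝ => gaussWave B C₁ C₂ α β w (y + t • v))
      (2 * Real.pi * (β * (B v y : ℂ) - Complex.I * (B w v : ℂ)) * gaussWave B C₁ C₂ α β w y) 0 := by
  have e1 : ∀ t : ℝ, gaussWave B C₁ C₂ α β w (y + t • v) = gaussWave B C₁ C₂ α β w y *
      Complex.exp ((t : ℂ) * (2 * Real.pi * (β * (B v y : ℂ) - Complex.I * (B w v : ℂ))) +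
        (t : ℂ) ^ 2 * (Real.pi * β * (B v v : ℂ))) := by
    intro t
    simp only [gaussWave, planeGauss, e, planeSq_add_smul h1 h2]
    rw [← Complex.exp_add, ← Complex.exp_add, ← Complex.exp_add]
    congr 1
    simp only [map_add, map_smul, LinearMap.add_apply, LinearMap.smul_apply, smul_eq_mul,
      hB.eq y v]
    push_cast
    ring
  simp_rw [e1]
  have d : HasDerivAt (fun t : ℝ => (t : ℂ) * (2 * Real.pi * (β * (B v y : ℂ) -
      Complex.I * (B w v : ℂ))) + (t : ℂ) ^ 2 * (Real.pi * β * (B v v : ℂ)))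
      (2 * Real.pi * (β * (B v y : ℂ) - Complex.I * (B w v : ℂ))) 0 := by
    have d0 : HasDerivAt (fun t : ℝ => (t : ℂ)) 1 0 := Complex.ofRealCLM.hasDerivAt
    refine ((d0.mul_const _).add ((d0.fun_pow 2).mul_const _)).congr_deriv ?_
    simp
  refine (d.cexp.const_mul _).congr_deriv ?_
  simp
  ring

lemma norm_gaussWave (α β : ℂ) (w y : V) :
    ‖gaussWave B C₁ C₂ α β w y‖ = ‖planeGauss B C₁ C₂ α β y‖ := by
  rw [gaussWave, norm_mul, ← Complex.ofReal_neg, norm_e_ofReal, mul_one]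

lemma continuous_gaussWave (α β : ℂ) (w : V) : Continuous (gaussWave B C₁ C₂ α β w) := by
  have h1 : Continuous fun y => B w y := continuous_const.bilin continuous_id
  exact (continuous_planeGauss _ _ _ _).mul (continuous_e.comp (by fun_prop))

lemma integrable_mul_gaussWave (hB : B.IsSymm) (hsig : HasTwoPositive B) (h : PosPair B C₁ C₂)
    (b : Basis ι ℝ V) {α β : ℂ} (hα : 0 < α.re) (hβ : 0 < β.re) (w : V) {P : V → ℂ}
    (hP : Continuous P) {K : ℝ} (hK : ∀ y, ‖P y‖ ≤ K * (1 + ‖y‖ ^ 2)) :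
    Integrable fun y : ι → ℝ => P (b.equivFun.symm y) *
      gaussWave B C₁ C₂ α β w (b.equivFun.symm y) := by
  obtain ⟨δ, hδ, hb⟩ := exists_planeGauss_bound hB hsig h hα hβ
  obtain ⟨M, hM, hM'⟩ := exists_poly_le_exp (half_pos hδ)
  have hK0 : 0 ≤ K := by simpa using (norm_nonneg _).trans (hK 0)
  refine integrable_of_gaussian_bound b (f := fun y => P y * gaussWave B C₁ C₂ α β w y)
    (hP.mul (continuous_gaussWave _ _ _)) (C := K * M) (half_pos hδ) fun y => ?_
  rw [norm_mul, norm_gaussWave]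
  calc ‖P y‖ * ‖planeGauss B C₁ C₂ α β y‖
      ≤ K * (1 + ‖y‖ ^ 2) * Real.exp (-(δ * ‖y‖ ^ 2)) := by
        gcongr
        · exact hK y
        · exact hb y
    _ = K * ((1 + ‖y‖ ^ 2) * Real.exp (-(2 * (δ / 2) * ‖y‖ ^ 2))) := by
        rw [show 2 * (δ / 2) = δ by ring]; ring
    _ ≤ K * (M * Real.exp (-(δ / 2 * ‖y‖ ^ 2))) := mul_le_mul_of_nonneg_left (hM' _) hK0
    _ = _ := by ring

lemma integrable_gaussWave_moments (hB : B.IsSymm) (hsig : HasTwoPositive B)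
    (h : PosPair B C₁ C₂) (b : Basis ι ℝ V) {α β : ℂ} (hα : 0 < α.re) (hβ : 0 < β.re)
    (w v v' : V) (k₀ k₁ k₂ : ℂ) :
    Integrable fun y : ι → ℝ => (k₀ + k₁ * (B v (b.equivFun.symm y) : ℂ) +
      k₂ * ((B v (b.equivFun.symm y) : ℂ) * (B v' (b.equivFun.symm y) : ℂ))) *
      gaussWave B C₁ C₂ α β w (b.equivFun.symm y) := by
  obtain ⟨M, hM0, hM⟩ := exists_bilin_bound B
  have c1 : ∀ v, Continuous fun y => (B v y : ℂ) := fun v =>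
    Complex.continuous_ofReal.comp (continuous_const.bilin continuous_id)
  refine integrable_mul_gaussWave hB hsig h b hα hβ w
    (P := fun y => k₀ + k₁ * (B v y : ℂ) + k₂ * ((B v y : ℂ) * (B v' y : ℂ)))
    (K := ‖k₀‖ + ‖k₁‖ * (M * ‖v‖) + ‖k₂‖ * ((M * ‖v‖) * (M * ‖v'‖)))
    (((continuous_const).add (continuous_const.mul (c1 v))).add
      (continuous_const.mul ((c1 v).mul (c1 v')))) fun y => ?_
  have n1 : ∀ v, ‖(B v y : ℂ)‖ ≤ M * ‖v‖ * ‖y‖ := fun v => by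
    rw [Complex.norm_real]; exact hM v y
  have hy : ‖y‖ ≤ 1 + ‖y‖ ^ 2 := by nlinarith [sq_nonneg (‖y‖ - 1)]
  have hy1 : 1 ≤ 1 + ‖y‖ ^ 2 := by nlinarith [sq_nonneg ‖y‖]
  have hy2 : ‖y‖ ^ 2 ≤ 1 + ‖y‖ ^ 2 := by linarith
  calc _ ≤ ‖k₀‖ + ‖k₁‖ * (M * ‖v‖ * ‖y‖) + ‖k₂‖ * ((M * ‖v‖ * ‖y‖) * (M * ‖v'‖ * ‖y‖)) := by
        refine (norm_add₃_le).trans ?_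
        rw [norm_mul, norm_mul, norm_mul]
        have a1 := n1 v
        have a2 := n1 v'
        gcongr
    _ = ‖k₀‖ * 1 + ‖k₁‖ * (M * ‖v‖) * ‖y‖ + ‖k₂‖ * ((M * ‖v‖) * (M * ‖v'‖)) * ‖y‖ ^ 2 := by ring
    _ ≤ ‖k₀‖ * (1 + ‖y‖ ^ 2) + ‖k₁‖ * (M * ‖v‖) * (1 + ‖y‖ ^ 2) +
        ‖k₂‖ * ((M * ‖v‖) * (M * ‖v'‖)) * (1 + ‖y‖ ^ 2) := by gcongr
    _ = _ := by ring

/-- The derivative of the wave along `v` has integral zero, and it equals the wave times a multiple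
of `β B(v, y) - i B(w, v)`. -/
lemma integral_moment_one (hB : B.IsSymm) (hsig : HasTwoPositive B) (h : PosPair B C₁ C₂)
    (b : Basis ι ℝ V) {α β : ℂ} (hα : 0 < α.re) (hβ : 0 < β.re) (w : V) {v : V}
    (h1 : B C₁ v = 0) (h2 : B (perp B C₂ C₁) v = 0) :
    ∫ y : ι → ℝ, (B v (b.equivFun.symm y) : ℂ) * gaussWave B C₁ C₂ α β w (b.equivFun.symm y) =
      Complex.I / β * (B w v : ℂ) * fourierB B b (planeGauss B C₁ C₂ α β) w := by
  have hβ0 : β ≠ 0 := fun h0 => by simp [h0] at hβ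
  have hpi : (Real.pi : ℂ) ≠ 0 := by exact_mod_cast Real.pi_ne_zero
  have i0 := integrable_gaussWave_moments hB hsig h b hα hβ w v v 1 0 0
  have i1 := integrable_gaussWave_moments hB hsig h b hα hβ w v v 0 1 0
  simp only [zero_mul, add_zero, zero_add, one_mul] at i0 i1
  have hz := integral_eq_zero_of_hasDerivAt_line b (G := gaussWave B C₁ C₂ α β w)
    (G' := fun y => 2 * Real.pi * (β * (B v y : ℂ) - Complex.I * (B w v : ℂ)) *
      gaussWave B C₁ C₂ α β w y) v i0
    (by
      have := integrable_gaussWave_moments hB hsig h b hα hβ w v v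
        (2 * Real.pi * (-(Complex.I * (B w v : ℂ)))) (2 * Real.pi * β) 0
      refine this.congr (.of_forall fun y => ?_)
      simp only
      ring)
    (hasDerivAt_gaussWave hB h1 h2 α β w)
  have e1 : ∀ y : ι → ℝ, 2 * Real.pi * (β * (B v (b.equivFun.symm y) : ℂ) -
      Complex.I * (B w v : ℂ)) * gaussWave B C₁ C₂ α β w (b.equivFun.symm y) =
      2 * Real.pi * β * ((B v (b.equivFun.symm y) : ℂ) *
        gaussWave B C₁ C₂ α β w (b.equivFun.symm y)) -
      2 * Real.pi * Complex.I * (B w v : ℂ) * gaussWave B C₁ C₂ α β w (b.equivFun.symm y) := by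
    intro y; ring
  simp_rw [e1] at hz
  rw [integral_sub (i1.const_mul _) (i0.const_mul _), integral_const_mul, integral_const_mul] at hz
  have e2 : fourierB B b (planeGauss B C₁ C₂ α β) w =
    ∫ y : ι → ℝ, gaussWave B C₁ C₂ α β w (b.equivFun.symm y) := rfl
  rw [e2]
  field_simp
  have := mul_left_cancel₀ (mul_ne_zero two_ne_zero hpi) (a := 2 * (Real.pi : ℂ))
    (b := β * ∫ y : ι → ℝ, (B v (b.equivFun.symm y) : ℂ) *
      gaussWave B C₁ C₂ α β w (b.equivFun.symm y))
    (c := Complex.I * (B w v : ℂ) * ∫ y : ι → ℝ, gaussWave B C₁ C₂ α β w (b.equivFun.symm y))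
    (by linear_combination hz)
  linear_combination this

/-- The same argument for the wave times `B(v, y)`, differentiated along `v'`. The derivative of the
linear factor yields the term with `B(v, v')`. -/
lemma integral_moment_two (hB : B.IsSymm) (hsig : HasTwoPositive B) (h : PosPair B C₁ C₂)
    (b : Basis ι ℝ V) {α β : ℂ} (hα : 0 < α.re) (hβ : 0 < β.re) (w : V) {v v' : V}
    (h1 : B C₁ v = 0) (h2 : B (perp B C₂ C₁) v = 0) (h1' : B C₁ v' = 0)
    (h2' : B (perp B C₂ C₁) v' = 0) :
    ∫ y : ι → ℝ, (B v (b.equivFun.symm y) : ℂ) * (B v' (b.equivFun.symm y) : ℂ) *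
        gaussWave B C₁ C₂ α β w (b.equivFun.symm y) =
      (-((B w v : ℂ) * (B w v' : ℂ)) / β ^ 2 - (B v v' : ℂ) / (2 * Real.pi * β)) *
        fourierB B b (planeGauss B C₁ C₂ α β) w := by
  have hβ0 : β ≠ 0 := fun h0 => by simp [h0] at hβ
  have hpi : (Real.pi : ℂ) ≠ 0 := by exact_mod_cast Real.pi_ne_zero
  have i0 := integrable_gaussWave_moments hB hsig h b hα hβ w v v' 1 0 0
  have i1 := integrable_gaussWave_moments hB hsig h b hα hβ w v v' 0 1 0
  have i2 := integrable_gaussWave_moments hB hsig h b hα hβ w v v' 0 0 1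
  simp only [zero_mul, add_zero, zero_add, one_mul] at i0 i1 i2
  have hz := integral_eq_zero_of_hasDerivAt_line b
    (G := fun y => (B v y : ℂ) * gaussWave B C₁ C₂ α β w y)
    (G' := fun y => (B v v' : ℂ) * gaussWave B C₁ C₂ α β w y + (B v y : ℂ) *
      (2 * Real.pi * (β * (B v' y : ℂ) - Complex.I * (B w v' : ℂ)) *
      gaussWave B C₁ C₂ α β w y)) v' i1
    (by
      have := integrable_gaussWave_moments hB hsig h b hα hβ w v v' (B v v' : ℂ)
        (2 * Real.pi * (-(Complex.I * (B w v' : ℂ)))) (2 * Real.pi * β)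
      refine this.congr (.of_forall fun y => ?_)
      simp only
      ring)
    (fun y => by
      have d : HasDerivAt (fun t : ℝ => (B v (y + t • v') : ℂ)) (B v v' : ℂ) 0 := by
        have : (fun t : ℝ => (B v (y + t • v') : ℂ)) =
            fun t : ℝ => (B v y : ℂ) + (t : ℂ) * (B v v' : ℂ) := by ext t; simp
        rw [this]
        have d0 : HasDerivAt (fun t : ℝ => (t : ℂ)) 1 0 := Complex.ofRealCLM.hasDerivAt
        exact ((d0.mul_const _).const_add _).congr_deriv (by simp)
      refine (d.mul (hasDerivAt_gaussWave hB h1' h2' α β w y)).congr_deriv ?_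
      simp)
  have e1 : ∀ y : ι → ℝ, (B v v' : ℂ) * gaussWave B C₁ C₂ α β w (b.equivFun.symm y) +
      (B v (b.equivFun.symm y) : ℂ) * (2 * Real.pi * (β * (B v' (b.equivFun.symm y) : ℂ) -
        Complex.I * (B w v' : ℂ)) * gaussWave B C₁ C₂ α β w (b.equivFun.symm y)) =
      (B v v' : ℂ) * gaussWave B C₁ C₂ α β w (b.equivFun.symm y) +
      (2 * Real.pi * β * ((B v (b.equivFun.symm y) : ℂ) * (B v' (b.equivFun.symm y) : ℂ) *
        gaussWave B C₁ C₂ α β w (b.equivFun.symm y)) -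
      2 * Real.pi * Complex.I * (B w v' : ℂ) * ((B v (b.equivFun.symm y) : ℂ) *
        gaussWave B C₁ C₂ α β w (b.equivFun.symm y))) := by
    intro y; ring
  simp_rw [e1] at hz
  have i21 : Integrable fun y : ι → ℝ => 2 * Real.pi * β * ((B v (b.equivFun.symm y) : ℂ) *
      (B v' (b.equivFun.symm y) : ℂ) * gaussWave B C₁ C₂ α β w (b.equivFun.symm y)) -
      2 * Real.pi * Complex.I * (B w v' : ℂ) * ((B v (b.equivFun.symm y) : ℂ) *
        gaussWave B C₁ C₂ α β w (b.equivFun.symm y)) := (i2.const_mul _).sub (i1.const_mul _)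
  rw [integral_add (i0.const_mul _) i21,
    integral_sub (i2.const_mul _) (i1.const_mul _), integral_const_mul, integral_const_mul,
    integral_const_mul, integral_moment_one hB hsig h b hα hβ w h1 h2] at hz
  have e2 : fourierB B b (planeGauss B C₁ C₂ α β) w =
    ∫ y : ι → ℝ, gaussWave B C₁ C₂ α β w (b.equivFun.symm y) := rfl
  rw [← e2] at hz
  generalize fourierB B b (planeGauss B C₁ C₂ α β) w = F at *
  generalize (∫ y : ι → ℝ, (B v (b.equivFun.symm y) : ℂ) * (B v' (b.equivFun.symm y) : ℂ) *
        gaussWave B C₁ C₂ α β w (b.equivFun.symm y)) = J at *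
  field_simp at hz ⊢
  linear_combination hz + 2 * Real.pi * (B w v : ℂ) * (B w v' : ℂ) * F * Complex.I_sq

/-- The mixed kernel times the holomorphic exponential, as a function on `V` for given `τ`. -/
def kernelAt (B : LinearMap.BilinForm ℝ V) (C₁ C₂ D D' : V) (τ : ℂ) (y : V) : ℂ :=
  (mixedKernel B C₁ C₂ D D' (√(2 * τ.im) • y) : ℂ) * e (-τ * (B y y : ℂ) / 2)

/-- Put `β = -iτ` and let `α` be its conjugate, so that `α + β = 2 Im τ`. The two real Gaussians and
the holomorphic exponential then combine into one Gaussian, with parameter `α` on the plane and `β`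
off it. -/
lemma kernelAt_eq (D D' : V) {τ : ℂ} (hτ : 0 < τ.im) (y : V) :
    kernelAt B C₁ C₂ D D' τ y =
      (4 / (√(B C₁ C₁) * √(B (perp B C₂ C₁) (perp B C₂ C₁))) : ℝ) *
      ((2 * τ.im : ℝ) * ((B (perp B (perp B D C₁) (perp B C₂ C₁)) y : ℂ) *
        (B (perp B (perp B D' C₁) (perp B C₂ C₁)) y : ℂ)) +
        (B (perp B (perp B D C₁) (perp B C₂ C₁)) (perp B (perp B D' C₁) (perp B C₂ C₁)) : ℂ) /
          (2 * Real.pi)) *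
      planeGauss B C₁ C₂ (starRingEnd ℂ (-Complex.I * τ)) (-Complex.I * τ) y := by
  simp only [kernelAt, mixedKernel]
  have hr : √(2 * τ.im) * √(2 * τ.im) = 2 * τ.im := Real.mul_self_sqrt (by positivity)
  set f := perp B C₂ C₁
  set v := perp B (perp B D C₁) f
  set v' := perp B (perp B D' C₁) f
  have hg : (gauss (unitForm B C₁ (√(2 * τ.im) • y)) : ℂ) *
      (gauss (unitForm B f (√(2 * τ.im) • y)) : ℂ) * e (-τ * (B y y : ℂ) / 2) =
      planeGauss B C₁ C₂ (starRingEnd ℂ (-Complex.I * τ)) (-Complex.I * τ) y := by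
    rw [unitForm_smul, unitForm_smul, gauss, gauss, e, planeGauss, planeSq]
    push_cast
    rw [← Complex.exp_add, ← Complex.exp_add]
    congr 1
    have hr' : (√(2 * τ.im) : ℂ) * (√(2 * τ.im) : ℂ) = 2 * τ.im := by exact_mod_cast hr
    have hc : starRingEnd ℂ (-Complex.I * τ) = 2 * τ.im - -Complex.I * τ := by
      apply Complex.ext <;> simp
      ring
    rw [hc, mul_pow, mul_pow, sq (√(2 * τ.im) : ℂ), hr']
    ring
  rw [← hg]
  simp only [map_smul, smul_eq_mul]
  push_cast
  have hr' : (√(2 * τ.im) : ℂ) * (√(2 * τ.im) : ℂ) = 2 * τ.im := by exact_mod_cast hr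
  rw [← hr']
  ring

/-- The kernels at `-1/τ` and at `τ` are Fourier transforms of each other. -/
theorem fourierB_kernelAt [DecidableEq ι] (hB : B.IsSymm) (hsig : HasTwoPositive B)
    (h : PosPair B C₁ C₂) (b : Basis ι ℝ V) (D D' : V) {τ : ℂ} (hτ : 0 < τ.im) (w : V) :
    fourierB B b (kernelAt B C₁ C₂ D D' (-1 / τ)) w =
      -((-Complex.I * τ) ^ ((Fintype.card ι : ℂ) / 2) *
        ((√|(LinearMap.BilinForm.toMatrix b B).det|)⁻¹ : ℝ)) * kernelAt B C₁ C₂ D D' τ w := by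
  have hτ0 : τ ≠ 0 := fun h0 => by simp [h0] at hτ
  have hpi : (Real.pi : ℂ) ≠ 0 := by exact_mod_cast Real.pi_ne_zero
  have hτ' : 0 < (-1 / τ).im := by
    rw [neg_div, one_div, Complex.neg_im, Complex.inv_im, neg_div, neg_neg]
    exact div_pos hτ (Complex.normSq_pos.2 hτ0)
  set β : ℂ := -Complex.I * τ with hβ
  set α : ℂ := starRingEnd ℂ β with hα
  have hβre : 0 < β.re := by simpa [hβ] using hτ
  have hαre : 0 < α.re := by rw [hα, Complex.conj_re]; exact hβre
  have hβ0 : β ≠ 0 := fun h0 => by simp [h0] at hβre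
  have hα0 : α ≠ 0 := fun h0 => by simp [h0] at hαre
  -- Passing from `τ` to `-1/τ` inverts both Gaussian parameters, as the Fourier transform does.
  have hβ' : -Complex.I * (-1 / τ) = β⁻¹ := by
    rw [hβ, mul_inv, inv_neg, Complex.inv_I]; field_simp
  have hα' : starRingEnd ℂ (-Complex.I * (-1 / τ)) = α⁻¹ := by rw [hβ', hα, map_inv₀]
  have him : ((2 * τ.im : ℝ) : ℂ) = α + β := by
    rw [hα, add_comm, Complex.add_conj, hβ]; simp
  have him' : ((2 * (-1 / τ).im : ℝ) : ℂ) = α⁻¹ + β⁻¹ := by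
    rw [← hα', ← hβ', add_comm, Complex.add_conj]; simp
  have hre : ∀ z : ℂ, 0 < z.re → 0 < (z⁻¹).re := fun z hz => by
    rw [Complex.inv_re]
    exact div_pos hz (Complex.normSq_pos.2 fun h0 => by simp [h0] at hz)
  have hk := fun y => kernelAt_eq (B := B) (C₁ := C₁) (C₂ := C₂) D D' hτ' y
  rw [kernelAt_eq D D' hτ, him, ← hβ, ← hα]
  rw [hα', hβ', him'] at hk
  set f := perp B C₂ C₁ with hf
  have p1 := perp_perp_fst hB h D
  have p2 : B f (perp B (perp B D C₁) f) = 0 := perp_apply_self hB _ (h.perp_pos hB).ne'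
  have p1' := perp_perp_fst hB h D'
  have p2' : B f (perp B (perp B D' C₁) f) = 0 := perp_apply_self hB _ (h.perp_pos hB).ne'
  rw [← hf] at p1 p1'
  set v := perp B (perp B D C₁) f
  set v' := perp B (perp B D' C₁) f
  set κ : ℂ := ((4 / (√(B C₁ C₁) * √(B f f)) : ℝ) : ℂ)
  set F := fourierB B b (planeGauss B C₁ C₂ α⁻¹ β⁻¹) w with hF
  have i0 := integrable_gaussWave_moments hB hsig h b (hre α hαre) (hre β hβre) w v v' 1 0 0
  have i2 := integrable_gaussWave_moments hB hsig h b (hre α hαre) (hre β hβre) w v v' 0 0 1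
  simp only [zero_mul, add_zero, zero_add, one_mul] at i0 i2
  have m2 := integral_moment_two hB hsig h b (hre α hαre) (hre β hβre) w p1 p2 p1' p2'
  have m0 : ∫ y : ι → ℝ, gaussWave B C₁ C₂ α⁻¹ β⁻¹ w (b.equivFun.symm y) = F := rfl
  have e1 : fourierB B b (kernelAt B C₁ C₂ D D' (-1 / τ)) w =
      ∫ y : ι → ℝ, (κ * (α⁻¹ + β⁻¹) * ((B v (b.equivFun.symm y) : ℂ) *
        (B v' (b.equivFun.symm y) : ℂ) * gaussWave B C₁ C₂ α⁻¹ β⁻¹ w (b.equivFun.symm y)) +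
        κ * ((B v v' : ℂ) / (2 * Real.pi)) * gaussWave B C₁ C₂ α⁻¹ β⁻¹ w (b.equivFun.symm y)) := by
    rw [fourierB]
    congr 1
    ext y
    rw [hk, gaussWave]
    ring
  rw [e1, integral_add (i2.const_mul _) (i0.const_mul _), integral_const_mul, integral_const_mul,
    m2, m0, ← hF, hF, fourierB_planeGauss hB hsig h b hαre hβre]
  have hcard : 2 ≤ Fintype.card ι := by
    obtain ⟨c, I, hc⟩ := exists_isAdapted hB hsig h b
    rw [← hc.card]
    exact I.card_le_univ
  -- With the principal root on both sides no branch ambiguity arises; the dimension is at least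
  -- two.
  have hpow : β ^ ((Fintype.card ι : ℂ) / 2) = β * (β ^ (1 / 2 : ℂ)) ^ (Fintype.card ι - 2) := by
    have h2 : (β ^ (1 / 2 : ℂ)) ^ 2 = β := by
      rw [← Complex.cpow_nat_mul]; simp
    rw [show (Fintype.card ι : ℂ) / 2 = (Fintype.card ι : ℂ) * (1 / 2) by ring,
      Complex.cpow_nat_mul]
    nth_rewrite 2 [← h2]
    rw [← pow_add]
    congr 1
    omega
  -- The moments carry the coefficient `α⁻¹ + β⁻¹`. The term with `B(v, v')` receives `1 - (α⁻¹ +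
  -- β⁻¹) β = -β/α`, and the quadratic term scales by the same factor. This fixes the constant
  -- `1/(2π)` in `mixedKernel`; together with the Gaussian factor `α` it gives the sign and the
  -- power of `β`.
  rw [hpow, hB.eq v w, hB.eq v' w]
  field_simp
  ring

end FourierKernel

end IndefTheta

end

noncomputable section

namespace IndefTheta

open MeasureTheory Filter Topology Set Module

set_option linter.unusedSectionVars false

/-! ### Fourier transform of the completed kernel -/

section FourierPhi

variable {V : Type*} [NormedAddCommGroup V] [NormedSpace ℝ V] [FiniteDimensional ℝ V]
  {B : LinearMap.BilinForm ℝ V} {C₁ C₁' C₂ C₂' : V} {ι : Type*} [Fintype ι]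

/-- The function `y ↦ F(√(2τ₂) y) e(-τ Q(y)/2)`, whose lattice sums are theta series. -/
def atTau (B : LinearMap.BilinForm ℝ V) (F : V → ℝ) (τ : ℂ) (y : V) : ℂ :=
  (F (√(2 * τ.im) • y) : ℂ) * e (-τ * (B y y : ℂ) / 2)

lemma norm_e_neg_mul (τ : ℂ) (q : ℝ) :
    ‖e (-τ * (q : ℂ) / 2)‖ = Real.exp (Real.pi * τ.im * q) := by
  rw [e, Complex.norm_exp]
  congr 1
  simp [Complex.mul_re, Complex.mul_im]
  ring

lemma norm_atTau_le {F : V → ℝ} {C δ : ℝ} {y : V} {τ : ℂ} (hτ : 0 < τ.im)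
    (h : |F (√(2 * τ.im) • y)| * Real.exp (Real.pi * B (√(2 * τ.im) • y) (√(2 * τ.im) • y) / 2) ≤
      C * Real.exp (-(δ * ‖√(2 * τ.im) • y‖ ^ 2))) :
    ‖atTau B F τ y‖ ≤ C * Real.exp (-(2 * τ.im * δ * ‖y‖ ^ 2)) := by
  have hr : √(2 * τ.im) ^ 2 = 2 * τ.im := Real.sq_sqrt (by positivity)
  rw [atTau, norm_mul, norm_e_neg_mul, Complex.norm_real, Real.norm_eq_abs]
  have e1 : Real.pi * B (√(2 * τ.im) • y) (√(2 * τ.im) • y) / 2 = Real.pi * τ.im * B y y := by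
    simp only [map_smul, LinearMap.smul_apply, smul_eq_mul]
    linear_combination (Real.pi / 2 * B y y) * hr
  have e2 : δ * ‖√(2 * τ.im) • y‖ ^ 2 = 2 * τ.im * δ * ‖y‖ ^ 2 := by
    rw [norm_smul, mul_pow, Real.norm_eq_abs, sq_abs, hr]; ring
  rw [e1, e2] at h
  exact h

lemma continuous_atTau {F : V → ℝ} (hF : Continuous F) (τ : ℂ) : Continuous (atTau B F τ) := by
  have h2 := continuous_quadratic (B := B)
  have h3 : Continuous fun y : V => (F (√(2 * τ.im) • y) : ℂ) :=
    Complex.continuous_ofReal.comp (hF.comp (continuous_const_smul _))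
  exact h3.mul (continuous_e.comp ((continuous_const.mul (Complex.continuous_ofReal.comp h2)).div_const 2))

lemma PosSquare.continuousOn_atTau (hB : B.IsSymm) (h : PosSquare B C₁ C₁' C₂ C₂') (τ : ℂ)
    (b : Basis ι ℝ V) (w : V) :
    ContinuousOn (fun p : (ι → ℝ) × (ℝ × ℝ) =>
      atTau B (sqKernel B C₁ C₁' C₂ C₂' p.2) τ (b.equivFun.symm p.1) *
        e (-(B w (b.equivFun.symm p.1) : ℂ))) (univ ×ˢ unitSq) := by
  have hb := continuous_equivFun_symm b
  have h1 : ContinuousOn (fun p : (ι → ℝ) × (ℝ × ℝ) =>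
      sqKernel B C₁ C₁' C₂ C₂' p.2 (√(2 * τ.im) • b.equivFun.symm p.1)) (univ ×ˢ unitSq) :=
    ContinuousOn.comp (h.continuousOn_sqKernel hB)
      (f := fun p : (ι → ℝ) × (ℝ × ℝ) => (p.2, √(2 * τ.im) • b.equivFun.symm p.1))
      (continuous_snd.prodMk ((hb.comp continuous_fst).const_smul _)).continuousOn
      fun p hp => ⟨hp.2, mem_univ _⟩
  have h2 : Continuous fun p : (ι → ℝ) × (ℝ × ℝ) =>
      e (-τ * (B (b.equivFun.symm p.1) (b.equivFun.symm p.1) : ℂ) / 2) :=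
    continuous_e.comp ((continuous_const.mul (Complex.continuous_ofReal.comp
      (continuous_quadratic.comp (hb.comp continuous_fst)))).div_const 2)
  have h3 : Continuous fun p : (ι → ℝ) × (ℝ × ℝ) => e (-(B w (b.equivFun.symm p.1) : ℂ)) :=
    continuous_e.comp (Complex.continuous_ofReal.comp
      (continuous_const.bilin (hb.comp continuous_fst))).neg
  exact ((Complex.continuous_ofReal.comp_continuousOn h1).mul h2.continuousOn).mul h3.continuousOn

lemma PosSquare.atTau_phiReal (hB : B.IsSymm) (h : PosSquare B C₁ C₁' C₂ C₂') (τ : ℂ) (y : V) :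
    atTau B (phiReal B C₁ C₁' C₂ C₂') τ y =
      1 / 4 * ∫ z in unitSq, atTau B (sqKernel B C₁ C₁' C₂ C₂' z) τ y := by
  simp only [atTau]
  rw [integral_mul_const, h.phiReal_eq hB, integral_complex_ofReal]
  push_cast
  ring

/-- The completed kernels at `-1/τ` and at `τ` are Fourier transforms of each other. -/
theorem PosSquare.fourierB_atTau [DecidableEq ι] (hB : B.IsSymm) (hsig : HasTwoPositive B)
    (h : PosSquare B C₁ C₁' C₂ C₂') (b : Basis ι ℝ V) {τ : ℂ} (hτ : 0 < τ.im) (w : V) :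
    fourierB B b (atTau B (phiReal B C₁ C₁' C₂ C₂') (-1 / τ)) w =
      -((-Complex.I * τ) ^ ((Fintype.card ι : ℂ) / 2) *
        ((√|(LinearMap.BilinForm.toMatrix b B).det|)⁻¹ : ℝ)) *
          atTau B (phiReal B C₁ C₁' C₂ C₂') τ w := by
  have hτ0 : τ ≠ 0 := fun h0 => by simp [h0] at hτ
  have hτ' : 0 < (-1 / τ).im := by
    rw [neg_div, one_div, Complex.neg_im, Complex.inv_im, neg_div, neg_neg]
    exact div_pos hτ (Complex.normSq_pos.2 hτ0)
  set τ' := -1 / τ with hτ'def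
  obtain ⟨C, δ, hC, hδ, hb⟩ := h.exists_sqKernel_bound hB hsig
  have hmeas : (volume : Measure (ι → ℝ)).prod (volume.restrict unitSq) =
      ((volume : Measure (ι → ℝ)).prod (volume : Measure (ℝ × ℝ))).restrict (univ ×ˢ unitSq) := by
    rw [← Measure.prod_restrict, Measure.restrict_univ]
  have hvol : volume unitSq < ⊤ := isCompact_unitSq.measure_lt_top
  have hfin : IsFiniteMeasure (volume.restrict unitSq : Measure (ℝ × ℝ)) :=
    ⟨by simpa using hvol⟩
  have hg : Integrable fun y : ι → ℝ =>
      C * Real.exp (-(2 * τ'.im * δ * ‖b.equivFun.symm y‖ ^ 2)) := by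
    have hc : Continuous fun y : V => ((C * Real.exp (-(2 * τ'.im * δ * ‖y‖ ^ 2)) : ℝ) : ℂ) := by
      fun_prop
    have := integrable_of_gaussian_bound b hc (C := C) (δ := 2 * τ'.im * δ) (by positivity)
      (fun y => by
        rw [Complex.norm_real, Real.norm_eq_abs, abs_of_nonneg (by positivity)])
    exact this.re.congr (.of_forall fun y => Complex.ofReal_re _)
  -- A Gaussian bound uniform over the square allows the Fourier integral to be exchanged with the
  -- integral over planes.
  have hI : Integrable (Function.uncurry fun (y : ι → ℝ) (z : ℝ × ℝ) =>
      atTau B (sqKernel B C₁ C₁' C₂ C₂' z) τ' (b.equivFun.symm y) *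
        e (-(B w (b.equivFun.symm y) : ℂ)))
      ((volume : Measure (ι → ℝ)).prod (volume.restrict unitSq)) := by
    refine Integrable.mono' (hg.comp_fst (volume.restrict unitSq)) ?_ ?_
    · rw [hmeas]
      exact (h.continuousOn_atTau hB τ' b w).aestronglyMeasurable
        (MeasurableSet.univ.prod measurableSet_unitSq)
    · rw [hmeas]
      filter_upwards [ae_restrict_mem (MeasurableSet.univ.prod measurableSet_unitSq)] with p hp
      rw [Function.uncurry, norm_mul, ← Complex.ofReal_neg, norm_e_ofReal, mul_one]
      exact norm_atTau_le hτ' (hb p.2 hp.2 _)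
  have e1 : fourierB B b (atTau B (phiReal B C₁ C₁' C₂ C₂') τ') w =
      1 / 4 * ∫ y : ι → ℝ, ∫ z in unitSq,
        atTau B (sqKernel B C₁ C₁' C₂ C₂' z) τ' (b.equivFun.symm y) *
          e (-(B w (b.equivFun.symm y) : ℂ)) := by
    rw [fourierB, ← integral_const_mul]
    congr 1
    ext y
    rw [h.atTau_phiReal hB, integral_mul_const]
    ring
  rw [e1, integral_integral_swap hI, h.atTau_phiReal hB]
  have e2 : ∀ z ∈ unitSq, ∫ y : ι → ℝ,
      atTau B (sqKernel B C₁ C₁' C₂ C₂' z) τ' (b.equivFun.symm y) *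
          e (-(B w (b.equivFun.symm y) : ℂ)) =
      -((-Complex.I * τ) ^ ((Fintype.card ι : ℂ) / 2) *
        ((√|(LinearMap.BilinForm.toMatrix b B).det|)⁻¹ : ℝ)) *
          atTau B (sqKernel B C₁ C₁' C₂ C₂' z) τ w :=
    fun z hz => fourierB_kernelAt hB hsig (h z hz) b _ _ hτ w
  rw [setIntegral_congr_fun measurableSet_unitSq e2, integral_const_mul]
  ring

end FourierPhi

end IndefTheta

end

noncomputable section

namespace IndefTheta

open MeasureTheory Filter Topology Set Module

set_option linter.unusedSectionVars false

/-! ### The discriminant group -/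

section Disc

variable {V : Type*} [NormedAddCommGroup V] [NormedSpace ℝ V] [FiniteDimensional ℝ V]
  {B : LinearMap.BilinForm ℝ V} {Λ : Submodule ℤ V} {p : V} {ι : Type*} [Fintype ι]

lemma mem_dualSubmodule_iff {x : V} :
    x ∈ B.dualSubmodule Λ ↔ ∀ y ∈ Λ, ∃ m : ℤ, B x y = m := by
  rw [LinearMap.BilinForm.mem_dualSubmodule]
  refine forall₂_congr fun y _ => ?_
  rw [Submodule.mem_one]
  simp [eq_comm]

/-- Polarization: `Q(k) + B(k, p)` takes even values and its polar form is `2 B(k, l)`. -/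
lemma bilin_int_of_characteristic (hB : B.IsSymm)
    (hp : ∀ k ∈ Λ, ∃ m : ℤ, B k k + B k p = 2 * m) {k l : V} (hk : k ∈ Λ) (hl : l ∈ Λ) :
    ∃ m : ℤ, B k l = m := by
  obtain ⟨m₁, h₁⟩ := hp k hk
  obtain ⟨m₂, h₂⟩ := hp l hl
  obtain ⟨m₃, h₃⟩ := hp (k + l) (add_mem hk hl)
  refine ⟨m₃ - m₁ - m₂, ?_⟩
  simp only [map_add, LinearMap.add_apply, hB.eq l k] at h₃
  push_cast
  linarith

lemma le_dualSubmodule_of_characteristic (hB : B.IsSymm)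
    (hp : ∀ k ∈ Λ, ∃ m : ℤ, B k k + B k p = 2 * m) : Λ ≤ B.dualSubmodule Λ :=
  fun _ hk => mem_dualSubmodule_iff.2 fun _ hl => bilin_int_of_characteristic hB hp hk hl

/-- The coordinates of a basis of `Λ` in the dual basis of `Λ*` form the Gram matrix, whose
determinant is up to sign the index. -/
lemma card_discGroup [DecidableEq ι] (hB : B.IsSymm) (hN : B.Nondegenerate) (b : Basis ι ℝ V)
    (hb : Submodule.span ℤ (range b) = Λ) (hle : Λ ≤ B.dualSubmodule Λ) :
    (Nat.card (DiscGroup B Λ) : ℝ) = |(LinearMap.BilinForm.toMatrix b B).det| := by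
  set b' := B.dualBasis hN b with hb'
  have hd : Submodule.span ℤ (range b') = B.dualSubmodule Λ := by
    rw [← hb, LinearMap.BilinForm.dualSubmodule_span_of_basis B hN]
  set bM : Basis ι ℤ (B.dualSubmodule Λ) := (b'.restrictScalars ℤ).map (LinearEquiv.ofEq _ _ hd)
    with hbM
  set bN : Basis ι ℤ (Λ.submoduleOf (B.dualSubmodule Λ)) :=
    ((b.restrictScalars ℤ).map (LinearEquiv.ofEq _ _ hb)).map
      (Submodule.submoduleOfEquivOfLe hle).symm with hbN
  have hrepr : ∀ (x : B.dualSubmodule Λ) i, ((bM.repr x i : ℤ) : ℝ) = B x (b i) := by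
    intro x i
    rw [← LinearMap.BilinForm.dualBasis_repr_apply hN b, ← hb']
    simp only [hbM, Basis.map_repr, LinearEquiv.trans_apply]
    exact Basis.restrictScalars_repr_apply ℤ b' ((LinearEquiv.ofEq _ _ hd).symm x) i
  have := Module.Free.of_basis bM
  have := Module.Finite.of_basis bM
  have h1 := Submodule.natAbs_det_basis_change bM (Λ.submoduleOf (B.dualSubmodule Λ)) bN
  have h2 : Nat.card (DiscGroup B Λ) = (bM.det ((↑) ∘ bN)).natAbs := by
    rw [h1]
  rw [h2, Nat.cast_natAbs, Int.cast_abs, Basis.det_apply, Int.cast_det]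
  congr 2
  ext i j
  rw [Matrix.map_apply, Basis.toMatrix_apply, hrepr, LinearMap.BilinForm.toMatrix_apply, hB.eq (b i)]
  have : ((bN j : B.dualSubmodule Λ) : V) = b j := by
    simp [hbN, Submodule.submoduleOfEquivOfLe]
  rw [Function.comp, this]

lemma finite_discGroup [DecidableEq ι] (hB : B.IsSymm) (hN : B.Nondegenerate) (b : Basis ι ℝ V)
    (hb : Submodule.span ℤ (range b) = Λ) (hle : Λ ≤ B.dualSubmodule Λ) :
    Finite (DiscGroup B Λ) := by
  refine Nat.finite_of_card_ne_zero fun h0 => ?_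
  have h := card_discGroup hB hN b hb hle
  rw [h0, Nat.cast_zero, eq_comm, abs_eq_zero] at h
  exact (LinearMap.BilinForm.nondegenerate_iff_det_ne_zero b).1 hN h

lemma nondegenerate_of_sig (hB : B.IsSymm)
    (hpos : sigPos (LinearMap.BilinMap.toQuadraticMap B) = 2)
    (hneg : sigNeg (LinearMap.BilinMap.toQuadraticMap B) + 2 = Module.finrank ℝ V) :
    B.Nondegenerate := by
  refine ⟨fun x hx => eq_zero_of_sig hB hpos hneg hx, fun y hy => ?_⟩
  exact eq_zero_of_sig hB hpos hneg fun x => by rw [hB.eq]; exact hy x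

end Disc

end IndefTheta

end

noncomputable section

namespace IndefTheta

open MeasureTheory Filter Topology Set Module

set_option linter.unusedSectionVars false

/-! ### Theta series as lattice sums; convergence, elliptic and translation laws -/

section ThetaSeries

variable {V : Type*} [NormedAddCommGroup V] [NormedSpace ℝ V] [FiniteDimensional ℝ V]
  {B : LinearMap.BilinForm ℝ V} {Λ : Submodule ℤ V} {p : V}

/-- A term of a theta series with real kernel `F`. -/
def realTerm (B : LinearMap.BilinForm ℝ V) (p : V) (F : V → ℝ) (τ : ℂ) (b c k : V) : ℂ :=
  e ((B k p : ℂ) / 2) * atTau B F τ (k + b) * e (B c (k + (2⁻¹ : ℝ) • b) : ℂ)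

lemma norm_realTerm (F : V → ℝ) (τ : ℂ) (b c k : V) :
    ‖realTerm B p F τ b c k‖ = ‖atTau B F τ (k + b)‖ := by
  rw [realTerm, norm_mul, norm_mul, norm_e_ofReal, mul_one,
    show ((B k p : ℂ) / 2) = ((B k p / 2 : ℝ) : ℂ) by push_cast; rfl, norm_e_ofReal, one_mul]

lemma thetaTerm_hatPhi2 (C₁ C₁' C₂ C₂' : V) (τ : ℂ) (b c k : V) :
    thetaTerm B p (hatPhi2 B C₁ C₁' C₂ C₂') τ b c k =
      realTerm B p (phiReal B C₁ C₁' C₂ C₂') τ b c k := by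
  rw [thetaTerm, realTerm, atTau, hatPhi2_eq]
  ring

lemma thetaTerm_Psi2 (C₁ C₁' C₂ C₂' : V) (τ : ℂ) (b c k : V) :
    thetaTerm B p (Psi2 B C₁ C₁' C₂ C₂') τ b c k =
      Complex.I / 4 * realTerm B p (psiReal B C₁ C₁' C₂ C₂') τ b c k := by
  rw [thetaTerm, realTerm, atTau, Psi2_eq]
  ring

lemma discMk_eq_iff {m m' : B.dualSubmodule Λ} :
    discMk B Λ m = discMk B Λ m' ↔ (m : V) - m' ∈ Λ := by
  rw [discMk, discMk, Submodule.Quotient.eq]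
  rfl

lemma exists_discMk (μ : DiscGroup B Λ) : ∃ m, discMk B Λ m = μ := Submodule.Quotient.mk_surjective _ μ

/-- A coset `Λ + m + p/2` as a copy of `Λ`. -/
def cosetEquiv (hle : Λ ≤ B.dualSubmodule Λ) (p : V) (m : B.dualSubmodule Λ) :
    Λ ≃ shiftedCoset B Λ p (discMk B Λ m) where
  toFun l := ⟨m + (2⁻¹ : ℝ) • p + l, m + ⟨l, hle l.2⟩, discMk_eq_iff.2 (by simp), by simp; abel⟩
  invFun k := ⟨k - (m + (2⁻¹ : ℝ) • p), by
    obtain ⟨k, m', hm', rfl⟩ := k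
    have := discMk_eq_iff.1 hm'
    simpa using this⟩
  left_inv l := by simp
  right_inv k := by simp

lemma coe_cosetEquiv (hle : Λ ≤ B.dualSubmodule Λ) (p : V) (m : B.dualSubmodule Λ) (l : Λ) :
    (cosetEquiv hle p m l : V) = m + (2⁻¹ : ℝ) • p + l := rfl

/-- Gaussian decay of a real kernel against `exp(πQ/2)`. -/
def GaussianDecay (B : LinearMap.BilinForm ℝ V) (F : V → ℝ) : Prop :=
  ∃ K δ, 0 < K ∧ 0 < δ ∧ ∀ x, |F x| * Real.exp (Real.pi * B x x / 2) ≤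
    K * Real.exp (-(δ * ‖x‖ ^ 2))

lemma summable_realTerm [DiscreteTopology Λ] {F : V → ℝ} (hF : GaussianDecay B F)
    (hle : Λ ≤ B.dualSubmodule Λ) (μ : DiscGroup B Λ) {τ : ℂ} (hτ : 0 < τ.im) (b c : V) :
    Summable fun k : shiftedCoset B Λ p μ => ‖realTerm B p F τ b c k‖ := by
  obtain ⟨m, rfl⟩ := exists_discMk μ
  obtain ⟨K, δ, hK, hδ, hb⟩ := hF
  rw [← (cosetEquiv hle p m).summable_iff]
  have := summable_lattice_of_gaussian_bound Λ (f := atTau B F τ) (C := K) (δ := 2 * τ.im * δ)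
    (by positivity) (fun y => norm_atTau_le hτ (hb _)) (m + (2⁻¹ : ℝ) • p + b)
  refine this.congr fun l => ?_
  rw [Function.comp, norm_realTerm, coe_cosetEquiv]
  congr 2
  abel

lemma tsum_coset (hle : Λ ≤ B.dualSubmodule Λ) (m : B.dualSubmodule Λ) (f : V → ℂ) :
    ∑' k : shiftedCoset B Λ p (discMk B Λ m), f k = ∑' l : Λ, f (m + (2⁻¹ : ℝ) • p + l) :=
  ((cosetEquiv hle p m).tsum_eq fun k : shiftedCoset B Λ p (discMk B Λ m) => f k).symm

lemma theta_hatPhi2 (C₁ C₁' C₂ C₂' : V) (μ : DiscGroup B Λ) (τ : ℂ) (b c : V) :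
    theta B Λ p (hatPhi2 B C₁ C₁' C₂ C₂') 0 μ τ b c =
      ∑' k : shiftedCoset B Λ p μ, realTerm B p (phiReal B C₁ C₁' C₂ C₂') τ b c k := by
  simp [theta, thetaTerm_hatPhi2]

lemma theta_Psi2 (C₁ C₁' C₂ C₂' : V) (μ : DiscGroup B Λ) (τ : ℂ) (b c : V) :
    theta B Λ p (Psi2 B C₁ C₁' C₂ C₂') (-2) μ τ b c = (τ.im : ℂ) * (Complex.I / 4 *
      ∑' k : shiftedCoset B Λ p μ, realTerm B p (psiReal B C₁ C₁' C₂ C₂') τ b c k) := by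
  simp [theta, thetaTerm_Psi2, tsum_mul_left]

lemma e_neg (z : ℂ) : e (-z) = (e z)⁻¹ := by
  rw [e, e, ← Complex.exp_neg]; ring_nf

/-- Elliptic transformation in `b`. -/
lemma tsum_realTerm_add_b (hle : Λ ≤ B.dualSubmodule Λ) (F : V → ℝ)
    (μ : DiscGroup B Λ) (τ : ℂ) (b c : V) {k : V} (hk : k ∈ Λ) {j : ℤ} (hj : B k p = j) :
    ∑' x : shiftedCoset B Λ p μ, realTerm B p F τ (b + k) c x =
      e ((B k p : ℂ) / 2) * e (-(B c k : ℂ) / 2) *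
        ∑' x : shiftedCoset B Λ p μ, realTerm B p F τ b c x := by
  obtain ⟨m, rfl⟩ := exists_discMk μ
  rw [tsum_coset hle m, tsum_coset hle m, ← tsum_mul_left,
    ← (Equiv.addRight (⟨k, hk⟩ : Λ)).tsum_eq fun l : Λ => e ((B k p : ℂ) / 2) *
      e (-(B c k : ℂ) / 2) * realTerm B p F τ b c (m + (2⁻¹ : ℝ) • p + l)]
  refine tsum_congr fun l => ?_
  simp only [Equiv.coe_addRight, Submodule.coe_add]
  set K := (m : V) + (2⁻¹ : ℝ) • p + l
  have h1 : (m : V) + (2⁻¹ : ℝ) • p + (l + k) = K + k := by simp only [K]; abel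
  have h2 : K + k + b = K + (b + k) := by abel
  rw [h1, realTerm, realTerm, h2]
  have h3 : e ((B (K + k) p : ℂ) / 2) = e ((B K p : ℂ) / 2) * e ((B k p : ℂ) / 2) := by
    rw [← e_add]; simp [add_div]
  have h4 : e (B c (K + k + (2⁻¹ : ℝ) • b) : ℂ) =
      e (B c (K + (2⁻¹ : ℝ) • (b + k)) : ℂ) * e ((B c k : ℂ) / 2) := by
    rw [← e_add]
    congr 1
    simp only [map_add, map_smul, smul_eq_mul, smul_add]
    push_cast
    ring
  -- `B(k, p)` is an integer, so this phase is a sign and its own inverse.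
  have h5 : e ((B k p : ℂ) / 2) * e ((B k p : ℂ) / 2) = 1 := by
    rw [← e_add, hj]
    rw [show ((j : ℝ) : ℂ) / 2 + ((j : ℝ) : ℂ) / 2 = ((j : ℤ) : ℂ) by push_cast; ring, e_intCast]
  have h6 : e (-(B c k : ℂ) / 2) * e ((B c k : ℂ) / 2) = 1 := by
    rw [← e_add, neg_div, neg_add_cancel]; simp [e]
  rw [h3, h4]
  linear_combination (-(e ((B K p : ℂ) / 2) * atTau B F τ (K + (b + k)) *
    e (B c (K + (2⁻¹ : ℝ) • (b + k)) : ℂ))) * (h5 * (e (-(B c k : ℂ) / 2) * e ((B c k : ℂ) / 2)) + h6)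

/-- Elliptic transformation in `c`. -/
lemma tsum_realTerm_add_c (hB : B.IsSymm) (F : V → ℝ)
    (μ : DiscGroup B Λ) (τ : ℂ) (b c : V) {k : V} (hk : k ∈ Λ) :
    ∑' x : shiftedCoset B Λ p μ, realTerm B p F τ b (c + k) x =
      e ((B k p : ℂ) / 2) * e ((B b k : ℂ) / 2) *
        ∑' x : shiftedCoset B Λ p μ, realTerm B p F τ b c x := by
  rw [← tsum_mul_left]
  refine tsum_congr fun x => ?_
  obtain ⟨x, m, -, rfl⟩ := x
  obtain ⟨j, hj⟩ := mem_dualSubmodule_iff.1 m.2 k hk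
  have : e (B (c + k) ((m : V) + (2⁻¹ : ℝ) • p + (2⁻¹ : ℝ) • b) : ℂ) =
      e (B c ((m : V) + (2⁻¹ : ℝ) • p + (2⁻¹ : ℝ) • b) : ℂ) * (e ((B k p : ℂ) / 2) *
        e ((B b k : ℂ) / 2)) := by
    rw [← e_add, ← e_add]
    have h : (B (c + k) ((m : V) + (2⁻¹ : ℝ) • p + (2⁻¹ : ℝ) • b) : ℂ) =
      (B c ((m : V) + (2⁻¹ : ℝ) • p + (2⁻¹ : ℝ) • b) : ℂ) + ((B k p : ℂ) / 2 + (B b k : ℂ) / 2) +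
        (j : ℤ) := by
      simp only [map_add, LinearMap.add_apply, map_smul, smul_eq_mul, hB.eq k (m : V), hj,
        hB.eq k b]
      push_cast
      ring
    rw [h, e_add, e_intCast, mul_one]
  simp only [realTerm, this]
  ring

/-- The transformation under `τ ↦ τ + 1`. -/
lemma tsum_realTerm_add_one (hB : B.IsSymm) (hle : Λ ≤ B.dualSubmodule Λ)
    (hp : ∀ k ∈ Λ, ∃ m : ℤ, B k k + B k p = 2 * m) (F : V → ℝ)
    (m : B.dualSubmodule Λ) (τ : ℂ) (b c : V) :
    ∑' x : shiftedCoset B Λ p (discMk B Λ m), realTerm B p F (τ + 1) b (c + b) x =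
      e (-(B (m + (2⁻¹ : ℝ) • p) (m + (2⁻¹ : ℝ) • p) : ℂ) / 2) *
        ∑' x : shiftedCoset B Λ p (discMk B Λ m), realTerm B p F τ b c x := by
  rw [tsum_coset hle m, tsum_coset hle m, ← tsum_mul_left]
  refine tsum_congr fun l => ?_
  obtain ⟨i, hi⟩ := hp l l.2
  obtain ⟨j, hj⟩ := mem_dualSubmodule_iff.1 m.2 l l.2
  set x := (m : V) + (2⁻¹ : ℝ) • p with hx
  have him : (τ + 1).im = τ.im := by simp
  have hxl : (2 : ℝ) * B x l = 2 * j + B l p := by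
    rw [hx]
    simp only [map_add, LinearMap.add_apply, map_smul, LinearMap.smul_apply, smul_eq_mul, hj,
      hB.eq p l]
    ring
  have key : e (-(τ + 1) * (B (x + l + b) (x + l + b) : ℂ) / 2) *
      e (B (c + b) (x + l + (2⁻¹ : ℝ) • b) : ℂ) =
      e (-(B x x : ℂ) / 2) * (e (-τ * (B (x + l + b) (x + l + b) : ℂ) / 2) *
      e (B c (x + l + (2⁻¹ : ℝ) • b) : ℂ)) := by
    -- Expanding the square, `Q(x + l) - Q(x) = 2 B(x, l) + Q(l) = 2j + 2i` because `p` is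
    -- characteristic. Half of it is an integer and disappears from the phase.
    rw [← e_add, ← e_add, ← e_add]
    have h : -(τ + 1) * (B (x + l + b) (x + l + b) : ℂ) / 2 +
        (B (c + b) (x + l + (2⁻¹ : ℝ) • b) : ℂ) =
        -(B x x : ℂ) / 2 + (-τ * (B (x + l + b) (x + l + b) : ℂ) / 2 +
          (B c (x + l + (2⁻¹ : ℝ) • b) : ℂ)) + ((-i - j : ℤ) : ℂ) := by
      have hi' : (B (l : V) l : ℂ) + (B (l : V) p : ℂ) = 2 * i := by exact_mod_cast hi
      have hxl' : (2 : ℂ) * (B x l : ℂ) = 2 * j + (B (l : V) p : ℂ) := by exact_mod_cast hxl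
      simp only [map_add, LinearMap.add_apply, map_smul, smul_eq_mul, hB.eq (l : V) x, hB.eq x b,
        hB.eq (l : V) b]
      push_cast
      linear_combination -(1 / 2) * hi' - (1 / 2) * hxl'
    rw [h, e_add _ ((-i - j : ℤ) : ℂ), e_intCast, mul_one]
  simp only [realTerm, atTau, him]
  linear_combination (e ((B (x + l) p : ℂ) / 2) * (F (√(2 * τ.im) • (x + l + b)) : ℂ)) * key

end ThetaSeries

end IndefTheta

end

noncomputable section

namespace IndefTheta

open MeasureTheory Filter Topology Set Module

set_option linter.unusedSectionVars false

/-! ### The transformation under inversion -/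

section Inversion

variable {V : Type*} [NormedAddCommGroup V] [NormedSpace ℝ V] [FiniteDimensional ℝ V]
  {B : LinearMap.BilinForm ℝ V} {Λ : Submodule ℤ V} {p : V} {ι : Type*} [Fintype ι]

lemma fourierB_mul_character (b : Basis ι ℝ V) (f : V → ℂ) (v w : V) :
    fourierB B b (fun y => f y * e (B v y : ℂ)) w = fourierB B b f (w - v) := by
  rw [fourierB, fourierB]
  congr 1 with y
  rw [mul_assoc, ← e_add]
  congr 2
  simp only [map_sub, LinearMap.sub_apply]
  push_cast
  ring

/-- The fibre of `Λ* → Λ*/Λ` over `ν` as a shifted coset. -/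
def fiberEquiv (p : V) (ν : DiscGroup B Λ) :
    {w : B.dualSubmodule Λ // discMk B Λ w = ν} ≃ shiftedCoset B Λ p ν where
  toFun w := ⟨w.1 + (2⁻¹ : ℝ) • p, w.1, w.2, rfl⟩
  invFun k := ⟨⟨k - (2⁻¹ : ℝ) • p, by
      obtain ⟨k, m', hm', rfl⟩ := k
      simp⟩, by
      obtain ⟨k, m', hm', rfl⟩ := k
      refine Eq.trans (congrArg _ (Subtype.ext ?_)) hm'
      simp⟩
  left_inv w := by ext; simp
  right_inv k := by ext; simp

lemma tsum_dual_eq_finsum [Finite (DiscGroup B Λ)] {G : V → ℂ}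
    (hG : Summable fun w : B.dualSubmodule Λ => G (w + (2⁻¹ : ℝ) • p)) :
    ∑' w : B.dualSubmodule Λ, G (w + (2⁻¹ : ℝ) • p) =
      ∑ᶠ ν : DiscGroup B Λ, ∑' k : shiftedCoset B Λ p ν, G k := by
  have := Fintype.ofFinite (DiscGroup B Λ)
  rw [finsum_eq_sum_of_fintype, ← tsum_fintype (L := SummationFilter.unconditional _),
    ← (Equiv.sigmaFiberEquiv (discMk B Λ)).tsum_eq]
  refine (Summable.tsum_sigma ((Equiv.sigmaFiberEquiv (discMk B Λ)).summable_iff.2 hG)).trans ?_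
  refine tsum_congr fun ν => ?_
  exact (fiberEquiv p ν).tsum_eq fun k => G k

/-- Inversion for a kernel `F` for which `atTau` is an eigenfunction of the Fourier transform. -/
theorem tsum_realTerm_inversion (hB : B.IsSymm) (hN : B.Nondegenerate) [DiscreteTopology Λ]
    (hle : Λ ≤ B.dualSubmodule Λ) [Finite (DiscGroup B Λ)]
    (hpΛ : p ∈ Λ) (b₀ : Basis ι ℝ V) (hb₀ : Submodule.span ℤ (range b₀) = Λ)
    {F : V → ℝ} (hF : GaussianDecay B F) (hFc : Continuous F) {τ A : ℂ} (hτ : 0 < τ.im)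
    (hτ' : 0 < (-1 / τ).im)
    (hA : ∀ w, fourierB B b₀ (atTau B F (-1 / τ)) w = A * atTau B F τ w)
    (m : B.dualSubmodule Λ) (b c : V) :
    ∑' k : shiftedCoset B Λ p (discMk B Λ m), realTerm B p F (-1 / τ) c (-b) k =
      A * e ((B p p : ℂ) / 4) * ∑ᶠ ν : DiscGroup B Λ,
        e (B m (Quotient.out ν : B.dualSubmodule Λ) : ℂ) *
          ∑' k : shiftedCoset B Λ p ν, realTerm B p F τ b c k := by
  obtain ⟨K, δ, hK, hδ, hbd⟩ := hF
  have hd : DiscreteTopology (B.dualSubmodule Λ) := by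
    classical
    refine discreteTopology_span (B.dualBasis hN b₀) ?_
    rw [← hb₀, LinearMap.BilinForm.dualSubmodule_span_of_basis B hN]
  -- The sign `e(B(k, p)/2)` and the phase in `-b` form a single character; multiplication by it
  -- translates the Fourier transform by `v`.
  set v : V := (2⁻¹ : ℝ) • p - b with hv
  set h : V → ℂ := fun y => atTau B F (-1 / τ) y * e (B v y : ℂ) with hh
  have hhc : Continuous h := (continuous_atTau hFc _).mul
    (continuous_e.comp (Complex.continuous_ofReal.comp (bilinCLM B v).continuous))
  have hhF : ∀ w, fourierB B b₀ h w = A * atTau B F τ (w - v) := fun w => by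
    rw [hh, fourierB_mul_character, hA]
  have hbd1 : ∀ y, ‖h y‖ ≤ K * Real.exp (-(2 * (-1 / τ).im * δ * ‖y‖ ^ 2)) := fun y => by
    rw [hh, norm_mul, norm_e_ofReal, mul_one]
    exact norm_atTau_le hτ' (hbd _)
  have hbd2 : ∀ w, ‖fourierB B b₀ h w‖ ≤ (‖A‖ * (K * Real.exp (2 * τ.im * δ * ‖-v‖ ^ 2))) *
      Real.exp (-(2 * τ.im * δ / 2 * ‖w‖ ^ 2)) := fun w => by
    rw [hhF, norm_mul, mul_assoc, mul_assoc]
    refine mul_le_mul_of_nonneg_left ((norm_atTau_le hτ (hbd _)).trans ?_) (norm_nonneg _)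
    refine mul_le_mul_of_nonneg_left ?_ hK.le
    have := exp_neg_sq_add_le w (-v) (δ := 2 * τ.im * δ) (by positivity)
    rwa [neg_add_eq_sub] at this
  have poisson := tsum_lattice_eq_tsum_dual hN b₀ hb₀ hhc (δ := 2 * (-1 / τ).im * δ)
    (δ' := 2 * τ.im * δ / 2) (by positivity) (by positivity) hbd1 hbd2
    ((m : V) + (2⁻¹ : ℝ) • p + c)
  rw [tsum_coset hle m]
  have lhs : ∀ l : Λ, realTerm B p F (-1 / τ) c (-b) ((m : V) + (2⁻¹ : ℝ) • p + l) =
      e (-(B c p : ℂ) / 2 + (B b c : ℂ) / 2) * h ((m : V) + (2⁻¹ : ℝ) • p + c + l) := by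
    intro l
    set k := (m : V) + (2⁻¹ : ℝ) • p + l with hk
    have hk' : (m : V) + (2⁻¹ : ℝ) • p + c + l = k + c := by rw [hk]; abel
    rw [hk', hh, realTerm]
    have : e ((B k p : ℂ) / 2) * e (B (-b) (k + (2⁻¹ : ℝ) • c) : ℂ) =
        e (-(B c p : ℂ) / 2 + (B b c : ℂ) / 2) * e (B v (k + c) : ℂ) := by
      rw [← e_add, ← e_add]
      congr 1
      simp only [hv, map_add, map_neg, map_sub, map_smul, LinearMap.sub_apply, LinearMap.neg_apply,
        LinearMap.smul_apply, smul_eq_mul, hB.eq k p, hB.eq c p]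
      push_cast
      ring
    linear_combination (atTau B F (-1 / τ) (k + c)) * this
  simp_rw [lhs]
  rw [tsum_mul_left, poisson]
  set P : B.dualSubmodule Λ := ⟨p, hle hpΛ⟩ with hP
  -- Shifting the dual variable by `p` turns `w - v` into `w + p/2 + b`, the argument required for
  -- the shifted cosets.
  rw [← (Equiv.addRight P).tsum_eq]
  obtain ⟨j, hj⟩ := mem_dualSubmodule_iff.1 m.2 p hpΛ
  set G : V → ℂ := fun k => e (B m (k - (2⁻¹ : ℝ) • p) : ℂ) * realTerm B p F τ b c k with hG
  have key : ∀ w : B.dualSubmodule Λ,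
      fourierB B b₀ h (Equiv.addRight P w : B.dualSubmodule Λ) *
        e (B (Equiv.addRight P w : B.dualSubmodule Λ) ((m : V) + (2⁻¹ : ℝ) • p + c) : ℂ) =
      (A * e ((B p p : ℂ) / 4) * (e (-(B c p : ℂ) / 2 + (B b c : ℂ) / 2))⁻¹) *
        G (w + (2⁻¹ : ℝ) • p) := by
    intro w
    have hw : ((Equiv.addRight P w : B.dualSubmodule Λ) : V) = w + p := rfl
    rw [hhF, hw, ← e_neg]
    simp only [hG, realTerm]
    have h1 : (w : V) + p - v = w + (2⁻¹ : ℝ) • p + b := by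
      rw [hv]; module
    rw [h1]
    have h2 : e (B (w + p) ((m : V) + (2⁻¹ : ℝ) • p + c) : ℂ) =
        e ((B p p : ℂ) / 4) * e (-(-(B c p : ℂ) / 2 + (B b c : ℂ) / 2)) *
          (e (B m ((w : V) + (2⁻¹ : ℝ) • p - (2⁻¹ : ℝ) • p) : ℂ) *
            (e ((B ((w : V) + (2⁻¹ : ℝ) • p) p : ℂ) / 2) *
              e (B c ((w : V) + (2⁻¹ : ℝ) • p + (2⁻¹ : ℝ) • b) : ℂ))) := by
      simp only [← e_add]
      rw [← mul_one (e (_ / 4 + _ + _)), ← e_intCast j, ← e_add]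
      congr 1
      have hj' : (B (m : V) p : ℂ) = j := by exact_mod_cast hj
      rw [← hj', add_sub_cancel_right]
      simp only [map_add, map_smul, LinearMap.add_apply,
        LinearMap.smul_apply, smul_eq_mul, hB.eq p (m : V), hB.eq (w : V) (m : V), hB.eq (w : V) c,
        hB.eq b c, hB.eq p c]
      push_cast
      ring
    rw [h2]
    ring
  simp_rw [key]
  rw [tsum_mul_left, tsum_dual_eq_finsum]
  · have hne : e (-(B c p : ℂ) / 2 + (B b c : ℂ) / 2) ≠ 0 := Complex.exp_ne_zero _
    rw [← mul_assoc]
    congr 1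
    · rw [mul_comm, inv_mul_cancel_right₀ hne]
    · refine finsum_congr fun ν => ?_
      rw [← tsum_mul_left]
      refine tsum_congr fun k => ?_
      obtain ⟨k, w, hw, rfl⟩ := k
      simp only [hG]
      congr 1
      have ho : discMk B Λ (Quotient.out ν) = ν := Quotient.out_eq ν
      have := discMk_eq_iff.1 (hw.trans ho.symm)
      -- Representatives of one class differ by an element of `Λ`, which pairs integrally with `m`,
      -- so the phase depends only on the class.
      obtain ⟨i, hi⟩ := mem_dualSubmodule_iff.1 m.2 _ this
      rw [add_sub_cancel_right, ← mul_one (e (B m (Quotient.out ν : B.dualSubmodule Λ) : ℂ)),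
        ← e_intCast i, ← e_add]
      congr 1
      have hi' : ((B m w - B m (Quotient.out ν : B.dualSubmodule Λ) : ℝ) : ℂ) = i := by
        rw [← map_sub, hi]; simp
      rw [← hi']
      push_cast
      ring
  · refine Summable.of_norm ?_
    have := summable_lattice_of_gaussian_bound (B.dualSubmodule Λ) (f := atTau B F τ) (C := K)
      (δ := 2 * τ.im * δ) (by positivity) (fun y => norm_atTau_le hτ (hbd _)) ((2⁻¹ : ℝ) • p + b)
    refine this.congr fun w => ?_
    rw [hG, norm_mul, norm_e_ofReal, one_mul, norm_realTerm]
    congr 2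
    abel

end Inversion

end IndefTheta

end

noncomputable section

namespace IndefTheta

open MeasureTheory Filter Topology Set Module

set_option linter.unusedSectionVars false

/-! ### The shadow -/

section Shadow

variable {V : Type*} [NormedAddCommGroup V] [NormedSpace ℝ V] [FiniteDimensional ℝ V]
  {B : LinearMap.BilinForm ℝ V} {Λ : Submodule ℤ V} {p : V}

/-- The kernel `G` is the Euler derivative `r ∂ᵣ F` of `F`. -/
def IsRadialDeriv (F G : V → ℝ) : Prop :=
  ∀ (y : V) (r : ℝ), r ≠ 0 → HasDerivAt (fun r => F (r • y)) (G (r • y) / r) r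

/-- The real derivative of `τ ↦ atTau B F τ y`, when `G` is the radial derivative of `F`. -/
def atTauDeriv (B : LinearMap.BilinForm ℝ V) (F G : V → ℝ) (y : V) (τ : ℂ) : ℂ →L[ℝ] ℂ :=
  (atTau B G τ y / (2 * τ.im)) • (Complex.ofRealCLM.comp Complex.imCLM) +
    (-(Real.pi * Complex.I * (B y y : ℂ)) * atTau B F τ y) • ContinuousLinearMap.id ℝ ℂ

lemma atTauDeriv_apply (F G : V → ℝ) (y : V) (τ z : ℂ) :
    atTauDeriv B F G y τ z = atTau B G τ y / (2 * τ.im) * z.im +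
      -(Real.pi * Complex.I * (B y y : ℂ)) * atTau B F τ y * z := by
  simp [atTauDeriv]

/-- Chain rule for the scaling `r = √(2 Im τ)`: `dr = d(Im τ) / r`, so the quotient `G / r` becomes
`G / (2 Im τ)`. -/
lemma hasFDerivAt_atTau {F G : V → ℝ} (hFG : IsRadialDeriv F G) (y : V) {τ : ℂ} (hτ : 0 < τ.im) :
    HasFDerivAt (fun τ => atTau B F τ y) (atTauDeriv B F G y τ) τ := by
  have hr : √(2 * τ.im) ≠ 0 := (Real.sqrt_pos.2 (by positivity)).ne'
  have him : HasFDerivAt (fun τ : ℂ => 2 * τ.im) ((2 : ℝ) • Complex.imCLM) τ :=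
    Complex.imCLM.hasFDerivAt.const_mul 2
  have h0 : HasFDerivAt (fun τ : ℂ => √(2 * τ.im)) _ τ :=
    (Real.hasDerivAt_sqrt (by positivity)).comp_hasFDerivAt τ him
  have h1 : HasFDerivAt (fun τ : ℂ => F (√(2 * τ.im) • y)) _ τ :=
    HasDerivAt.comp_hasFDerivAt (f := fun τ : ℂ => √(2 * τ.im)) τ (hFG y _ hr) h0
  have h2 : HasFDerivAt (fun τ : ℂ => (F (√(2 * τ.im) • y) : ℂ)) _ τ :=
    Complex.ofRealCLM.hasFDerivAt.comp τ h1
  have h3 : HasDerivAt (fun τ : ℂ => e (-τ * (B y y : ℂ) / 2))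
      (e (-τ * (B y y : ℂ) / 2) * (2 * Real.pi * Complex.I * (-1 * (B y y : ℂ) / 2))) τ := by
    unfold e
    exact ((((hasDerivAt_id τ).neg.mul_const _).div_const 2).const_mul _).cexp
  have h4 := h2.mul (h3.hasFDerivAt.restrictScalars ℝ)
  refine h4.congr_fderiv ?_
  ext z
  rw [atTauDeriv_apply]
  have hs : (√(2 * τ.im) : ℂ) ^ 2 = 2 * τ.im := by
    rw [← Complex.ofReal_pow, Real.sq_sqrt (by positivity)]; push_cast; rfl
  have hr' : (√(2 * τ.im) : ℂ) ≠ 0 := by exact_mod_cast hr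
  have ht : (τ.im : ℂ) ≠ 0 := by exact_mod_cast hτ.ne'
  simp only [add_apply, smul_apply, smul_eq_mul,
    ContinuousLinearMap.comp_apply, Complex.ofRealCLM_apply, Complex.imCLM_apply,
    ContinuousLinearMap.coe_restrictScalars', ContinuousLinearMap.toSpanSingleton_apply,
    Complex.ofReal_mul, Complex.ofReal_div, atTau]
  push_cast
  rw [← hs]
  field_simp
  ring

/-- The complex-linear part coming from the exponential cancels since `1 + i · i = 0`; only the
derivative of the scaling survives. -/
lemma atTauDeriv_one_add (F G : V → ℝ) (y : V) (τ : ℂ) :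
    atTauDeriv B F G y τ 1 + Complex.I * atTauDeriv B F G y τ Complex.I =
      Complex.I / (2 * τ.im) * atTau B G τ y := by
  rw [atTauDeriv_apply, atTauDeriv_apply, Complex.one_im, Complex.I_im, Complex.ofReal_zero,
    Complex.ofReal_one]
  linear_combination (-(Real.pi * Complex.I * (B y y : ℂ)) * atTau B F τ y) * Complex.I_mul_I

lemma norm_atTauDeriv_le (F G : V → ℝ) (y : V) {τ : ℂ} (hτ : 0 < τ.im) :
    ‖atTauDeriv B F G y τ‖ ≤ ‖atTau B G τ y‖ / (2 * τ.im) +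
      Real.pi * |B y y| * ‖atTau B F τ y‖ := by
  refine ContinuousLinearMap.opNorm_le_bound _ (by positivity) fun z => ?_
  rw [atTauDeriv_apply, add_mul]
  refine (norm_add_le _ _).trans (add_le_add ?_ (le_of_eq ?_))
  · rw [norm_mul, norm_div, Complex.norm_real, norm_mul, Complex.norm_real, Complex.norm_two,
      Real.norm_of_nonneg hτ.le]
    exact mul_le_mul_of_nonneg_left (Complex.abs_im_le_norm z) (by positivity)
  · simp [abs_of_pos Real.pi_pos]

lemma exists_norm_atTauDeriv_bound {F G : V → ℝ} (hF : GaussianDecay B F) (hG : GaussianDecay B G)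
    {t : ℝ} (ht : 0 < t) : ∃ K η, 0 < η ∧ ∀ (y : V) (τ : ℂ), t < τ.im →
      ‖atTauDeriv B F G y τ‖ ≤ K * Real.exp (-(η * ‖y‖ ^ 2)) := by
  obtain ⟨K, δ, hK, hδ, h⟩ := hF
  obtain ⟨K', δ', hK', hδ', h'⟩ := hG
  obtain ⟨M, hM, hMb⟩ := exists_bilin_bound B
  -- For `Im τ > t` the available decay is at least `2η`: one copy absorbs the factor `B y y`, the
  -- other remains for the summation.
  set η := t * min δ δ' with hη
  have hη0 : 0 < η := mul_pos ht (lt_min hδ hδ')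
  refine ⟨K' / (2 * t) + Real.pi * (M * η⁻¹) * K, η, hη0, fun y τ hτ => ?_⟩
  have hτ0 : 0 < τ.im := ht.trans hτ
  refine (norm_atTauDeriv_le F G y hτ0).trans ?_
  have hb : ∀ d, min δ δ' ≤ d → Real.exp (-(2 * τ.im * d * ‖y‖ ^ 2)) ≤
      Real.exp (-(η * ‖y‖ ^ 2)) * Real.exp (-(η * ‖y‖ ^ 2)) := fun d hd => by
    rw [← Real.exp_add, Real.exp_le_exp]
    have : η ≤ τ.im * d := mul_le_mul hτ.le hd (lt_min hδ hδ').le hτ0.le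
    nlinarith [mul_le_mul_of_nonneg_right this (sq_nonneg ‖y‖)]
  have hle1 : Real.exp (-(η * ‖y‖ ^ 2)) ≤ 1 := Real.exp_le_one_iff.2 (by
    have := mul_nonneg hη0.le (sq_nonneg ‖y‖); linarith)
  have hG := (norm_atTau_le hτ0 (h' (√(2 * τ.im) • y))).trans
    (mul_le_mul_of_nonneg_left (hb δ' (min_le_right _ _)) hK'.le)
  have hF := (norm_atTau_le hτ0 (h (√(2 * τ.im) • y))).trans
    (mul_le_mul_of_nonneg_left (hb δ (min_le_left _ _)) hK.le)
  set E := Real.exp (-(η * ‖y‖ ^ 2)) with hE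
  have hE0 : 0 < E := Real.exp_pos _
  have hq : |B y y| * E ≤ M * η⁻¹ := by
    have h1 : η * ‖y‖ ^ 2 * E ≤ 1 := by
      rw [hE, Real.exp_neg, ← div_eq_mul_inv, div_le_one (Real.exp_pos _)]
      linarith [Real.add_one_le_exp (η * ‖y‖ ^ 2)]
    calc |B y y| * E ≤ M * ‖y‖ * ‖y‖ * E := mul_le_mul_of_nonneg_right (hMb y y) hE0.le
      _ = M * η⁻¹ * (η * ‖y‖ ^ 2 * E) := by field_simp
      _ ≤ M * η⁻¹ * 1 := mul_le_mul_of_nonneg_left h1 (by positivity)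
      _ = M * η⁻¹ := mul_one _
  rw [add_mul]
  refine add_le_add ?_ ?_
  · calc ‖atTau B G τ y‖ / (2 * τ.im) ≤ (K' * E) / (2 * t) := by
          refine div_le_div₀ (by positivity) (hG.trans ?_) (by positivity) (by linarith)
          exact mul_le_mul_of_nonneg_left (by nlinarith) hK'.le
      _ = _ := by ring
  · calc Real.pi * |B y y| * ‖atTau B F τ y‖ ≤ Real.pi * |B y y| * (K * (E * E)) :=
          mul_le_mul_of_nonneg_left hF (by positivity)
      _ = (|B y y| * E) * (Real.pi * K * E) := by ring
      _ ≤ (M * η⁻¹) * (Real.pi * K * E) := mul_le_mul_of_nonneg_right hq (by positivity)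
      _ = _ := by ring

lemma summable_exp_coset [DiscreteTopology Λ] (hle : Λ ≤ B.dualSubmodule Λ) (μ : DiscGroup B Λ)
    {η : ℝ} (hη : 0 < η) (K : ℝ) (b : V) :
    Summable fun k : shiftedCoset B Λ p μ => K * Real.exp (-(η * ‖(k : V) + b‖ ^ 2)) := by
  obtain ⟨m, rfl⟩ := exists_discMk μ
  refine Summable.mul_left K ?_
  rw [← (cosetEquiv hle p m).summable_iff]
  have := summable_lattice_of_gaussian_bound Λ
    (f := fun y => ((Real.exp (-(η * ‖y‖ ^ 2)) : ℝ) : ℂ)) (C := 1) hη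
    (fun y => by rw [Complex.norm_real, Real.norm_of_nonneg (Real.exp_pos _).le, one_mul])
    (m + (2⁻¹ : ℝ) • p + b)
  refine this.congr fun l => ?_
  rw [Complex.norm_real, Real.norm_of_nonneg (Real.exp_pos _).le, Function.comp, coe_cosetEquiv]
  congr 5
  abel

lemma hasSum_apply_of_summable {α : Type*} {L : α → ℂ →L[ℝ] ℂ} (hL : Summable L) (z : ℂ) :
    HasSum (fun k => L k z) ((∑' k, L k) z) :=
  ((ContinuousLinearMap.apply ℝ ℂ z).hasSum hL.hasSum :)

/-- Theta series with radially differentiable kernel are real-differentiable in `τ`, and their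
antiholomorphic derivative is the theta series of the radial derivative. -/
theorem differentiableAt_tsum_realTerm [DiscreteTopology Λ] (hle : Λ ≤ B.dualSubmodule Λ)
    {F G : V → ℝ} (hFG : IsRadialDeriv F G) (hF : GaussianDecay B F) (hG : GaussianDecay B G)
    (μ : DiscGroup B Λ) {τ : ℂ} (hτ : 0 < τ.im) (b c : V) :
    DifferentiableAt ℝ (fun τ => ∑' k : shiftedCoset B Λ p μ, realTerm B p F τ b c k) τ ∧
    (τ.im : ℂ) ^ 2 * dbar (fun τ => ∑' k : shiftedCoset B Λ p μ, realTerm B p F τ b c k) τ =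
      τ.im * (Complex.I / 4 * ∑' k : shiftedCoset B Λ p μ, realTerm B p G τ b c k) := by
  obtain ⟨K, η, hη, hbd⟩ := exists_norm_atTauDeriv_bound hF hG (half_pos hτ)
  set a : V → ℂ := fun k => e ((B k p : ℂ) / 2) * e (B c (k + (2⁻¹ : ℝ) • b) : ℂ) with ha
  have hanorm : ∀ k, ‖a k‖ = 1 := fun k => by
    rw [ha, norm_mul, norm_e_ofReal, mul_one,
      show ((B k p : ℂ) / 2) = ((B k p / 2 : ℝ) : ℂ) by push_cast; rfl, norm_e_ofReal]
  have hterm : ∀ (F : V → ℝ) (τ : ℂ) (k : V),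
      realTerm B p F τ b c k = a k * atTau B F τ (k + b) := fun F τ k => by
    rw [realTerm, ha]; ring
  have hsum := summable_exp_coset (p := p) hle μ hη K b
  set L : shiftedCoset B Λ p μ → ℂ → ℂ →L[ℝ] ℂ := fun k τ => a k • atTauDeriv B F G (k + b) τ
    with hL
  have hLn : ∀ k, ∀ τ' ∈ {τ' : ℂ | τ.im / 2 < τ'.im}, ‖L k τ'‖ ≤
      K * Real.exp (-(η * ‖(k : V) + b‖ ^ 2)) := fun k τ' h => by
    rw [hL, norm_smul, hanorm, one_mul]
    exact hbd _ _ h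
  have hmem : τ ∈ {τ' : ℂ | τ.im / 2 < τ'.im} := half_lt_self hτ
  have hderiv : ∀ (k : shiftedCoset B Λ p μ), ∀ τ' ∈ {τ' : ℂ | τ.im / 2 < τ'.im},
      HasFDerivAt (fun τ => realTerm B p F τ b c k) (L k τ') τ' := fun k τ' h => by
    simp only [hterm, hL]
    exact (hasFDerivAt_atTau hFG _ ((half_pos hτ).trans h)).const_mul (a k)
  -- On this half-plane the derivatives have a summable bound independent of the point, which
  -- permits termwise differentiation.
  have hopen : IsOpen {τ' : ℂ | τ.im / 2 < τ'.im} := isOpen_lt continuous_const Complex.continuous_im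
  have hconn : IsPreconnected {τ' : ℂ | τ.im / 2 < τ'.im} :=
    (convex_halfSpace_im_gt (τ.im / 2)).isPreconnected
  have hs0 : Summable fun k : shiftedCoset B Λ p μ => realTerm B p F τ b c k :=
    (summable_realTerm hF hle μ hτ b c).of_norm
  have hd : HasFDerivAt (fun τ => ∑' k : shiftedCoset B Λ p μ, realTerm B p F τ b c k)
      (∑' k, L k τ) τ :=
    hasFDerivAt_tsum_of_isPreconnected hsum hopen hconn hderiv hLn hmem hs0 hmem
  have hLs : Summable fun k => L k τ :=
    Summable.of_norm_bounded hsum fun k => hLn k τ hmem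
  refine ⟨hd.differentiableAt, ?_⟩
  have happ := fun z => hasSum_apply_of_summable hLs z
  have h1 : HasSum (fun k => 1 / 2 * (L k τ 1 + Complex.I * L k τ Complex.I))
      (dbar (fun τ => ∑' k : shiftedCoset B Λ p μ, realTerm B p F τ b c k) τ) := by
    rw [dbar, hd.fderiv]
    exact ((happ 1).add ((happ Complex.I).mul_left Complex.I)).mul_left _
  have h2 : (fun k => 1 / 2 * (L k τ 1 + Complex.I * L k τ Complex.I)) =
      fun k : shiftedCoset B Λ p μ => Complex.I / (4 * τ.im) * realTerm B p G τ b c k := by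
    funext k
    have h3 := atTauDeriv_one_add (B := B) F G ((k : V) + b) τ
    rw [hterm]
    have h4 : ∀ z, L k τ z = a k * atTauDeriv B F G ((k : V) + b) τ z := fun z => rfl
    rw [h4, h4]
    linear_combination (1 / 2) * a k * h3
  rw [← h1.tsum_eq, h2, tsum_mul_left]
  have ht : (τ.im : ℂ) ≠ 0 := by exact_mod_cast hτ.ne'
  field_simp

end Shadow

end IndefTheta

end

noncomputable section

namespace IndefTheta

open MeasureTheory Filter Topology Set Module

set_option linter.unusedSectionVars false

/-! ### Failure of holomorphy -/

section Uniqueness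

variable {ι : Type*} [Fintype ι]

/-- Take the inner product with the `m`-th character in `L²`; continuity permits doing so term by
term. -/
lemma eq_zero_of_tsum_smul_mFourier {ν : Measure (UnitAddTorus ι)} {_ : IsFiniteMeasure ν}
    (ho : Orthonormal ℂ fun n : ι → ℤ =>
      ContinuousMap.toLp (E := ℂ) 2 ν ℂ (UnitAddTorus.mFourier n))
    {a : (ι → ℤ) → ℂ} (hs : Summable fun m => a m • UnitAddTorus.mFourier m)
    (h0 : ∑' m, a m • UnitAddTorus.mFourier m = 0) (m : ι → ℤ) : a m = 0 := by
  classical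
  have h1 := (ContinuousMap.toLp (E := ℂ) 2 ν ℂ).hasSum hs.hasSum
  rw [h0, map_zero] at h1
  have h3 := (innerSL ℂ (ContinuousMap.toLp (E := ℂ) 2 ν ℂ (UnitAddTorus.mFourier m))).hasSum h1
  rw [map_zero] at h3
  refine (hasSum_ite_eq m (a m)).unique (h3.congr_fun fun n => ?_)
  rw [map_smul, map_smul, innerSL_apply_apply, orthonormal_iff_ite.1 ho]
  by_cases hnm : n = m
  · simp [hnm]
  · simp [hnm, Ne.symm hnm]

/-- Uniqueness of coefficients of absolutely convergent Fourier series. -/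
lemma eq_zero_of_tsum_character_eq_zero {a : (ι → ℤ) → ℂ} (ha : Summable fun m => ‖a m‖)
    (h : ∀ x : ι → ℝ, ∑' m : ι → ℤ, a m * e ((∑ i, m i * x i : ℝ) : ℂ) = 0) (m : ι → ℤ) :
    a m = 0 := by
  have hs : Summable fun m => a m • UnitAddTorus.mFourier m := by
    refine Summable.of_norm (ha.congr fun m => ?_)
    rw [norm_smul, UnitAddTorus.mFourier_norm, mul_one]
  refine eq_zero_of_tsum_smul_mFourier UnitAddTorus.orthonormal_mFourier hs ?_ m
  ext θ
  obtain ⟨x, rfl⟩ := isOpenQuotientMap_toTorus.surjective θ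
  have h1 := (ContinuousMap.evalCLM ℂ (toTorus x)).map_tsum hs
  simp only [ContinuousMap.evalCLM_apply, ContinuousMap.smul_apply, mFourier_toTorus,
    smul_eq_mul] at h1
  rw [h1, h, ContinuousMap.zero_apply]

end Uniqueness

section NonHolomorphic

variable {V : Type*} [NormedAddCommGroup V] [NormedSpace ℝ V] [FiniteDimensional ℝ V]
  {B : LinearMap.BilinForm ℝ V} {Λ : Submodule ℤ V} {p : V} {C₁ C₁' C₂ C₂' : V}
  {ι : Type*} [Fintype ι]

lemma dbar_eq_zero {f : ℂ → ℂ} {τ : ℂ} (hf : DifferentiableAt ℂ f τ) : dbar f τ = 0 := by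
  rw [dbar, hf.fderiv_restrictScalars ℝ]
  have : fderiv ℂ f τ Complex.I = Complex.I * fderiv ℂ f τ 1 := by
    rw [← smul_eq_mul, ← map_smul, smul_eq_mul, mul_one]
  simp only [ContinuousLinearMap.coe_restrictScalars', this]
  linear_combination (1 / 2) * fderiv ℂ f τ 1 * Complex.I_mul_I

/-- A theta series that vanishes for all `b, c` has zero kernel. -/
lemma eq_zero_of_tsum_realTerm_eq_zero [DiscreteTopology Λ] (hN : B.Nondegenerate)
    (hle : Λ ≤ B.dualSubmodule Λ) (b₀ : Basis ι ℝ V) (hb₀ : Submodule.span ℤ (range b₀) = Λ)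
    {F : V → ℝ} (hF : GaussianDecay B F) (μ : DiscGroup B Λ) {τ : ℂ} (hτ : 0 < τ.im)
    (h : ∀ b c, ∑' k : shiftedCoset B Λ p μ, realTerm B p F τ b c k = 0) (x : V) :
    F (√(2 * τ.im) • x) = 0 := by
  classical
  obtain ⟨m, rfl⟩ := exists_discMk μ
  set k₀ : V := m + (2⁻¹ : ℝ) • p with hk₀
  -- With this `b` the term of the lattice point `0` evaluates the kernel at a multiple of `x`. As
  -- `c` varies, the series is an absolutely convergent Fourier series having that term as a
  -- coefficient.
  set b : V := x - k₀ with hb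
  set a : (ι → ℤ) → ℂ := fun n =>
    e ((B (k₀ + spanEquiv b₀ hb₀ n) p : ℂ) / 2) * atTau B F τ (k₀ + spanEquiv b₀ hb₀ n + b)
    with ha
  have hs : Summable fun n => ‖a n‖ := by
    have := summable_realTerm (p := p) hF hle (discMk B Λ m) hτ b 0
    rw [← (cosetEquiv hle p m).summable_iff, ← (spanEquiv b₀ hb₀).summable_iff] at this
    refine this.congr fun n => ?_
    simp only [Function.comp, norm_realTerm, coe_cosetEquiv, ha, norm_mul, ← hk₀]
    rw [show ((B (k₀ + spanEquiv b₀ hb₀ n) p : ℂ) / 2) =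
      ((B (k₀ + spanEquiv b₀ hb₀ n) p / 2 : ℝ) : ℂ) by push_cast; rfl, norm_e_ofReal, one_mul]
  have hz := eq_zero_of_tsum_character_eq_zero hs (fun y => by
    set c := ∑ i, y i • B.dualBasis hN b₀ i with hc
    have h1 := h b c
    rw [tsum_coset hle m, ← (spanEquiv b₀ hb₀).tsum_eq] at h1
    have hcn : ∀ n : ι → ℤ, B c (spanEquiv b₀ hb₀ n : V) = ∑ i, n i * y i := fun n => by
      rw [coe_spanEquiv, Basis.equivFun_symm_apply, hc]
      simp [LinearMap.BilinForm.apply_dualBasis_left, mul_comm]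
    have hterm : ∀ n : ι → ℤ, realTerm B p F τ b c (k₀ + spanEquiv b₀ hb₀ n) =
        e (B c (k₀ + (2⁻¹ : ℝ) • b) : ℂ) * (a n * e ((∑ i, n i * y i : ℝ) : ℂ)) := fun n => by
      rw [realTerm, ← hcn]
      have : e (B c (k₀ + spanEquiv b₀ hb₀ n + (2⁻¹ : ℝ) • b) : ℂ) =
          e (B c (k₀ + (2⁻¹ : ℝ) • b) : ℂ) * e (B c (spanEquiv b₀ hb₀ n : V) : ℂ) := by
        rw [← e_add]
        congr 1
        simp only [map_add]
        push_cast
        ring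
      rw [this, ha]
      ring
    simp_rw [← hk₀, hterm] at h1
    rw [tsum_mul_left] at h1
    exact (mul_eq_zero.1 h1).resolve_left (Complex.exp_ne_zero _)) 0
  have h0 : ((spanEquiv b₀ hb₀ 0 : Λ) : V) = 0 := by
    rw [coe_spanEquiv, Basis.equivFun_symm_apply]; simp
  rw [ha] at hz
  simp only [h0, add_zero, hb, add_sub_cancel, atTau] at hz
  have := (mul_eq_zero.1 ((mul_eq_zero.1 hz).resolve_left (Complex.exp_ne_zero _))).resolve_right
    (Complex.exp_ne_zero _)
  exact_mod_cast this

lemma tendsto_e2Boost_atTop (hB : B.IsSymm) (h : PosPair B C₁ C₂) {x : V} (h1 : B C₁ x ≠ 0)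
    (h2 : B C₂ x ≠ 0) : Tendsto (fun r : ℝ => e2Boost B C₁ C₂ (r • x)) atTop
      (𝓝 (Real.sign (B C₁ x) * Real.sign (B C₂ x))) := by
  set α := B C₁ C₂ / √(gramDet B ![C₁, C₂]) with hα
  have f1 : (unitForm B (perp B C₁ C₂) x + α * unitForm B C₂ x) =
      B C₁ x * (√(1 + α ^ 2) / √(B C₁ C₁)) := by
    have h0 : √(1 + α ^ 2) ≠ 0 := (Real.sqrt_pos.2 (by positivity)).ne'
    rw [mul_div_left_comm, mul_comm (√_), ← div_eq_iff h0, hα, gramDet_two hB, unitForm, unitForm,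
      perp_sq hB _ h.snd.ne', perp_apply_left, rotate_fst h.fst h.snd h.gram]
  have hs : ∀ {a t : ℝ}, 0 < t → Real.sign (a * t) = Real.sign a := fun {a t} ht => by
    rcases lt_trichotomy a 0 with ha | ha | ha
    · rw [Real.sign_of_neg ha, Real.sign_of_neg (mul_neg_of_neg_of_pos ha ht)]
    · rw [ha, zero_mul]
    · rw [Real.sign_of_pos ha, Real.sign_of_pos (mul_pos ha ht)]
  have p1 : 0 < √(1 + α ^ 2) / √(B C₁ C₁) :=
    div_pos (Real.sqrt_pos.2 (by positivity)) (Real.sqrt_pos.2 h.fst)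
  have p2 : 0 < (√(B C₂ C₂))⁻¹ := inv_pos.2 (Real.sqrt_pos.2 h.snd)
  have f2 : unitForm B C₂ x = B C₂ x * (√(B C₂ C₂))⁻¹ := div_eq_mul_inv _ _
  have := tendsto_dblErf_atTop (α := α) (u₁ := unitForm B (perp B C₁ C₂) x)
    (u₂ := unitForm B C₂ x) (by rw [f2]; exact mul_ne_zero h2 p2.ne')
    (by rw [f1]; exact mul_ne_zero h1 p1.ne')
  rw [f1, hs p1, f2, hs p2, ← f2, mul_comm] at this
  simpa only [e2Boost, unitForm_smul] using this

/-- Inverting the Gram matrix prescribes the pairings with the four vectors, so every sign pattern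
occurs. -/
lemma exists_bilin_eq (hg : gramDet B ![C₁, C₁', C₂, C₂'] ≠ 0) (t : Fin 4 → ℝ) :
    ∃ x, B C₁ x = t 0 ∧ B C₁' x = t 1 ∧ B C₂ x = t 2 ∧ B C₂' x = t 3 := by
  set G : Matrix (Fin 4) (Fin 4) ℝ :=
    Matrix.of fun i j => B (![C₁, C₁', C₂, C₂'] i) (![C₁, C₁', C₂, C₂'] j) with hG
  have hu : IsUnit G.det := isUnit_iff_ne_zero.2 hg
  refine ⟨∑ j, (G⁻¹.mulVec t) j • ![C₁, C₁', C₂, C₂'] j, ?_⟩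
  have : ∀ i, B (![C₁, C₁', C₂, C₂'] i) (∑ j, (G⁻¹.mulVec t) j • ![C₁, C₁', C₂, C₂'] j) = t i := by
    intro i
    rw [← gramMatrix_mulVec, ← hG, Matrix.mulVec_mulVec, Matrix.mul_nonsing_inv _ hu,
      Matrix.one_mulVec]
  exact ⟨this 0, this 1, this 2, this 3⟩

/-- A function constant on an open ray has the same limit at both ends; continuity identifies the
one at the origin. -/
lemma eq_of_isRadialDeriv_zero {F : V → ℝ} (hF : Continuous F)
    (hd : IsRadialDeriv F fun _ => 0) {x : V} {l : ℝ}
    (hl : Tendsto (fun r : ℝ => F (r • x)) atTop (𝓝 l)) : F 0 = l := by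
  have hc : ∀ r ∈ Ioi (0 : ℝ), ∀ s ∈ Ioi (0 : ℝ), F (r • x) = F (s • x) := by
    intro r hr s hs
    refine (convex_Ioi (0 : ℝ)).is_const_of_fderivWithin_eq_zero (𝕜 := ℝ)
      (f := fun r : ℝ => F (r • x))
      (fun t ht => (hd x t (ne_of_gt ht)).differentiableAt.differentiableWithinAt)
      (fun t ht => ?_) hr hs
    rw [fderivWithin_of_isOpen isOpen_Ioi ht, ← ContinuousLinearMap.toSpanSingleton_zero,
      (hd x t (ne_of_gt ht)).hasFDerivAt.fderiv, zero_div]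
  have h1 : Tendsto (fun r : ℝ => F (r • x)) (𝓝[>] 0) (𝓝 (F 0)) := by
    have : ContinuousAt (fun r : ℝ => F (r • x)) 0 := by fun_prop
    simpa [ContinuousAt] using this.mono_left nhdsWithin_le_nhds
  have h2 : F 0 = F ((1 : ℝ) • x) := tendsto_nhds_unique h1 (tendsto_const_nhds.congr' (by
    filter_upwards [self_mem_nhdsWithin] with r hr using hc 1 (mem_Ioi.2 one_pos) r hr))
  have h3 : l = F ((1 : ℝ) • x) := tendsto_nhds_unique hl (tendsto_const_nhds.congr' (by
    filter_upwards [eventually_gt_atTop 0] with r hr using hc 1 (mem_Ioi.2 one_pos) r hr))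
  rw [h2, h3]

lemma PosSquare.corner (h : PosSquare B C₁ C₁' C₂ C₂') :
    PosPair B C₁ C₂ ∧ PosPair B C₁ C₂' ∧ PosPair B C₁' C₂ ∧ PosPair B C₁' C₂' := by
  refine ⟨?_, ?_, ?_, ?_⟩
  · simpa using h (0, 0) (by simp [unitSq])
  · simpa using h (0, 1) (by simp [unitSq])
  · simpa using h (1, 0) (by simp [unitSq])
  · simpa using h (1, 1) (by simp [unitSq])

lemma PosSquare.tendsto_phiReal_atTop (hB : B.IsSymm) (h : PosSquare B C₁ C₁' C₂ C₂') {x : V}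
    (h1 : B C₁ x ≠ 0) (h1' : B C₁' x ≠ 0) (h2 : B C₂ x ≠ 0) (h2' : B C₂' x ≠ 0) :
    Tendsto (fun r : ℝ => phiReal B C₁ C₁' C₂ C₂' (r • x)) atTop
      (𝓝 (1 / 4 * (Real.sign (B C₁ x) - Real.sign (B C₁' x)) *
        (Real.sign (B C₂ x) - Real.sign (B C₂' x)))) := by
  obtain ⟨a, b, c, d⟩ := h.corner
  have := ((((tendsto_e2Boost_atTop hB a h1 h2).sub (tendsto_e2Boost_atTop hB b h1 h2')).sub
    (tendsto_e2Boost_atTop hB c h1' h2)).add (tendsto_e2Boost_atTop hB d h1' h2')).const_mul (1 / 4)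
  refine (this.congr fun r => rfl).trans (le_of_eq ?_)
  congr 1
  ring

/-- If the Euler derivative vanished, the limits of the completed kernel along all rays would equal
its value at `0`. The pairings `(1, 1, 1, 1)` give the limit `0` and `(1, -1, 1, -1)` the limit `1`.
-/
lemma PosSquare.psiReal_ne_zero (hB : B.IsSymm) (h : PosSquare B C₁ C₁' C₂ C₂')
    (hg : gramDet B ![C₁, C₁', C₂, C₂'] ≠ 0) : ∃ x, psiReal B C₁ C₁' C₂ C₂' x ≠ 0 := by
  by_contra! h0
  have hd : IsRadialDeriv (phiReal B C₁ C₁' C₂ C₂') fun _ => 0 := fun y r hr => by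
    simpa only [h0] using hasDerivAt_phiReal_radial hB h y hr
  have hc := (contDiff_phiReal (B := B) C₁ C₁' C₂ C₂').continuous
  obtain ⟨x, hx⟩ := exists_bilin_eq hg ![1, 1, 1, 1]
  obtain ⟨y, hy⟩ := exists_bilin_eq hg ![1, -1, 1, -1]
  simp at hx hy
  have e1 := eq_of_isRadialDeriv_zero hc hd (h.tendsto_phiReal_atTop hB (x := x)
    (by simp [hx]) (by simp [hx]) (by simp [hx]) (by simp [hx]))
  have e2 := eq_of_isRadialDeriv_zero hc hd (h.tendsto_phiReal_atTop hB (x := y)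
    (by simp [hy]) (by simp [hy]) (by simp [hy]) (by simp [hy]))
  rw [e1] at e2
  simp only [hx, hy, Real.sign_one, Real.sign_neg] at e2
  norm_num at e2

end NonHolomorphic

end IndefTheta

end

noncomputable section

namespace IndefTheta

open MeasureTheory Filter Topology Set Module

set_option linter.unusedSectionVars false

/-! ### The completed theta series -/

section Completed

variable {V : Type*} [NormedAddCommGroup V] [NormedSpace ℝ V] [FiniteDimensional ℝ V]
  {B : LinearMap.BilinForm ℝ V} {Λ : Submodule ℤ V} {p : V} {C₁ C₁' C₂ C₂' : V}

lemma ConvergenceConditions.posSquare (hB : B.IsSymm) (hsig : HasTwoPositive B)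
    (hc : ConvergenceConditions B C₁ C₁' C₂ C₂') (h12 : 0 < gramDet B ![C₁, C₂]) :
    PosSquare B C₁ C₁' C₂ C₂' := fun _ hz =>
  hc.posPair hB hsig ⟨hc.timelike.1, hc.timelike.2.2.1, by rwa [gramDet_two hB] at h12⟩ hz.1 hz.2

lemma thetaConverges_hatPhi2 [DiscreteTopology Λ] (hle : Λ ≤ B.dualSubmodule Λ)
    (hF : GaussianDecay B (phiReal B C₁ C₁' C₂ C₂')) :
    ThetaConverges B Λ p (hatPhi2 B C₁ C₁' C₂ C₂') := fun μ τ b c hτ => by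
  simp only [thetaTerm_hatPhi2]
  exact summable_realTerm hF hle μ hτ b c

lemma thetaConverges_Psi2 [DiscreteTopology Λ] (hle : Λ ≤ B.dualSubmodule Λ)
    (hG : GaussianDecay B (psiReal B C₁ C₁' C₂ C₂')) :
    ThetaConverges B Λ p (Psi2 B C₁ C₁' C₂ C₂') := fun μ τ b c hτ => by
  simp only [thetaTerm_Psi2, norm_mul]
  exact (summable_realTerm hG hle μ hτ b c).mul_left _

lemma isShadow_theta [DiscreteTopology Λ] (hB : B.IsSymm) (hle : Λ ≤ B.dualSubmodule Λ)
    (h : PosSquare B C₁ C₁' C₂ C₂') (hF : GaussianDecay B (phiReal B C₁ C₁' C₂ C₂'))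
    (hG : GaussianDecay B (psiReal B C₁ C₁' C₂ C₂')) (μ : DiscGroup B Λ) (b c : V) :
    IsShadow (fun τ => theta B Λ p (hatPhi2 B C₁ C₁' C₂ C₂') 0 μ τ b c)
      (fun τ => theta B Λ p (Psi2 B C₁ C₁' C₂ C₂') (-2) μ τ b c) := fun τ hτ => by
  simp only [theta_hatPhi2, theta_Psi2]
  exact differentiableAt_tsum_realTerm hle
    (fun y _ hr => hasDerivAt_phiReal_radial hB h y hr) hF hG μ hτ b c

lemma inv_neg_im_pos {τ : ℂ} (hτ : 0 < τ.im) : 0 < (-1 / τ).im := by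
  have hτ0 : τ ≠ 0 := fun h0 => by simp [h0] at hτ
  rw [neg_div, one_div, Complex.neg_im, Complex.inv_im, neg_div, neg_neg]
  exact div_pos hτ (Complex.normSq_pos.2 hτ0)

lemma isVectorValuedJacobiForm_theta [DiscreteTopology Λ] [IsZLattice ℝ Λ] (hB : B.IsSymm)
    (hsig : HasTwoPositive B) (hN : B.Nondegenerate) (hpΛ : p ∈ Λ)
    (hp : ∀ k ∈ Λ, ∃ m : ℤ, B k k + B k p = 2 * m) (h : PosSquare B C₁ C₁' C₂ C₂') :
    IsVectorValuedJacobiForm B Λ p (-1) ((Module.finrank ℝ V : ℂ) / 2)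
      (theta B Λ p (hatPhi2 B C₁ C₁' C₂ C₂') 0) := by
  classical
  have hle := le_dualSubmodule_of_characteristic hB hp
  have := ZLattice.module_free ℝ Λ
  have := ZLattice.module_finite ℝ Λ
  set b₀ := (Module.Free.chooseBasis ℤ Λ).ofZLatticeBasis ℝ Λ
  have hb₀ : Submodule.span ℤ (range b₀) = Λ := Basis.ofZLatticeBasis_span ℝ Λ _
  have hfin : Finite (DiscGroup B Λ) := finite_discGroup hB hN b₀ hb₀ hle
  refine ⟨hfin, fun μ τ b c _ k hk => ?_, fun μ τ b c _ k hk => ?_, fun m τ b c hτ => ?_,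
    fun m τ b c _ => ?_⟩
  · simp only [theta_hatPhi2]
    obtain ⟨j, hj⟩ := bilin_int_of_characteristic hB hp hk hpΛ
    exact tsum_realTerm_add_b hle _ μ τ b c hk hj
  · simp only [theta_hatPhi2]
    exact tsum_realTerm_add_c hB _ μ τ b c hk
  · simp only [theta_hatPhi2]
    rw [tsum_realTerm_inversion hB hN hle hpΛ b₀ hb₀ (h.exists_phiReal_bound hB hsig)
      (contDiff_phiReal C₁ C₁' C₂ C₂').continuous hτ (inv_neg_im_pos hτ)
      (h.fourierB_atTau hB hsig b₀ hτ) m b c, card_discGroup hB hN b₀ hb₀ hle,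
      ← finrank_eq_card_basis b₀]
    congr 2
    push_cast
    ring
  · simp only [theta_hatPhi2]
    exact tsum_realTerm_add_one hB hle hp _ m τ b c

/-- Holomorphy for all `b, c` would make the theta series of the shadow vanish at `τ = i` for all
`b, c`, forcing its kernel to be zero everywhere. -/
lemma exists_not_differentiableOn_theta [DiscreteTopology Λ] [IsZLattice ℝ Λ] (hB : B.IsSymm)
    (hN : B.Nondegenerate) (hle : Λ ≤ B.dualSubmodule Λ) (h : PosSquare B C₁ C₁' C₂ C₂')
    (hg : gramDet B ![C₁, C₁', C₂, C₂'] ≠ 0) (hF : GaussianDecay B (phiReal B C₁ C₁' C₂ C₂'))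
    (hG : GaussianDecay B (psiReal B C₁ C₁' C₂ C₂')) (μ : DiscGroup B Λ) :
    ∃ b c : V, ¬ DifferentiableOn ℂ
      (fun τ => theta B Λ p (hatPhi2 B C₁ C₁' C₂ C₂') 0 μ τ b c) {τ : ℂ | 0 < τ.im} := by
  by_contra! hd
  obtain ⟨x, hx⟩ := h.psiReal_ne_zero hB hg
  have := ZLattice.module_free ℝ Λ
  have := ZLattice.module_finite ℝ Λ
  have hb₀ := Basis.ofZLatticeBasis_span ℝ Λ (Module.Free.chooseBasis ℤ Λ)
  have hI : (0 : ℝ) < Complex.I.im := by simp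
  have hz := eq_zero_of_tsum_realTerm_eq_zero (p := p) hN hle _ hb₀ hG μ hI (fun b c => by
    have h1 := (isShadow_theta (p := p) hB hle h hF hG μ b c Complex.I hI).2
    rw [dbar_eq_zero ((hd b c).differentiableAt
      ((isOpen_lt continuous_const Complex.continuous_im).mem_nhds hI))] at h1
    simpa [theta_Psi2] using h1) ((√(2 * Complex.I.im))⁻¹ • x)
  rw [smul_inv_smul₀ (Real.sqrt_pos.2 (by positivity)).ne'] at hz
  exact hx hz

end Completed

end IndefTheta

end

theorem mainTheorem1 {V : Type*} [NormedAddCommGroup V] [NormedSpace ℝ V] [FiniteDimensional ℝ V]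
    (n : ℕ) (hn : Module.finrank ℝ V = n)
    (Λ : Submodule ℤ V) [DiscreteTopology Λ] [IsZLattice ℝ Λ]
    (B : LinearMap.BilinForm ℝ V) (hB : B.IsSymm)
    (hpos : sigPos (LinearMap.BilinMap.toQuadraticMap B) = 2)
    (hneg : sigNeg (LinearMap.BilinMap.toQuadraticMap B) + 2 = n)
    (hQ : ∀ k ∈ Λ, ∃ m : ℤ, B k k = m)
    (p : V) (hpΛ : p ∈ Λ) (hp : ∀ k ∈ Λ, ∃ m : ℤ, B k k + B k p = 2 * m)
    (C₁ C₁' C₂ C₂' : V)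
    (hconv : ConvergenceConditions B C₁ C₁' C₂ C₂')
    (hcomp : CompletionConditions B C₁ C₁' C₂ C₂') :
    ContDiff ℝ ∞ (hatPhi2 B C₁ C₁' C₂ C₂') ∧
    ThetaConverges B Λ p (hatPhi2 B C₁ C₁' C₂ C₂') ∧
    IsVectorValuedJacobiForm B Λ p (-1) ((n : ℂ) / 2)
      (theta B Λ p (hatPhi2 B C₁ C₁' C₂ C₂') 0) ∧
    (∀ μ : DiscGroup B Λ, ∃ b c : V,
      ¬ DifferentiableOn ℂ (fun τ => theta B Λ p (hatPhi2 B C₁ C₁' C₂ C₂') 0 μ τ b c)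
        {τ : ℂ | 0 < τ.im}) ∧
    ThetaConverges B Λ p (Psi2 B C₁ C₁' C₂ C₂') ∧
    (∀ (μ : DiscGroup B Λ) (b c : V),
      IsShadow (fun τ => theta B Λ p (hatPhi2 B C₁ C₁' C₂ C₂') 0 μ τ b c)
        (fun τ => theta B Λ p (Psi2 B C₁ C₁' C₂ C₂') (-2) μ τ b c)) := by
  subst hn
  have hsig := hasTwoPositive_of_sig hB hpos hneg
  have hN := nondegenerate_of_sig hB hpos hneg
  have hle := le_dualSubmodule_of_characteristic hB hp
  have hsq := hconv.posSquare hB hsig hcomp.gram_pos.1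
  have hF : GaussianDecay B (phiReal B C₁ C₁' C₂ C₂') := hsq.exists_phiReal_bound hB hsig
  have hG : GaussianDecay B (psiReal B C₁ C₁' C₂ C₂') := hsq.exists_psiReal_bound hB hsig
  exact ⟨contDiff_hatPhi2 C₁ C₁' C₂ C₂', thetaConverges_hatPhi2 hle hF,
    isVectorValuedJacobiForm_theta hB hsig hN hpΛ hp hsq,
    exists_not_differentiableOn_theta hB hN hle hsq hconv.gram_pos.ne' hF hG,
    thetaConverges_Psi2 hle hG, isShadow_theta hB hle hsq hF hG⟩
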